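/- Let $d\in\{1,2,\dots\}$, $\alpha\in(0,2)$, $\beta\in[\alpha,2]$, $\gamma\in[1,d]$, and let $\mu$ be a finite nonnegative Borel measure on the unit sphere $\mathbb S=\{\theta\in\mathbb R^d:|\theta|=1\}$ which is a $(\gamma-1)$-measure: there is a constant $c_\mu$ with $$\mu(\mathbb S\cap B(\theta,\rho))\le c_\mu\,\rho^{\gamma-1},\qquad \theta\in\mathbb S,\ \rho>0 .$$ Let $q,\phi:[0,\infty)\to(0,\infty)$ be bounded nonincreasing functions such that, for some positive constants $\kappa_1,\kappa_2$, $$q(s)\le\kappa_1 q(2s)\quad(s>0),\qquad \phi(a)\phi(b)\le\kappa_2\,\phi(a+b)\quad(a,b\ge0),$$ and such that, for some finite constant $c_*\ge 0$, $$\int_0^r s^{1-\alpha}q(s)\frac{\phi(s)}{\phi(s/2)}\,ds\le c_*\,r^{2-\beta},\qquad r>1 .$$ Let $c_0>0$. Then there are positive constants $c,c_1,c_2,c_3$, depending only on $d,\alpha,\beta,\gamma,\mu,q,\phi$ and $c_0$, such that the following holds. Let $b\in\mathbb R^d$ and let $\nu$ be a Lévy measure on $\mathbb R^d$, i.e. a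 Borel measure with $\int(1\wedge|y|^2)\,\nu(dy)<\infty$, satisfying $$\nu(A)\le\int_{\mathbb S}\int_0^\infty \mathbf 1_A(s\theta)\,s^{-1-\alpha}q(s)\phi(s)\,ds\,\mu(d\theta)\qquad\text{for all Borel } A\subset\mathbb R^d .$$ Put $$\Phi(\xi)=-\int\left(e^{i\langle\xi,y\rangle}-1-i\langle\xi,y\rangle\mathbf 1_{B(0,1)}(y)\right)\nu(dy)-i\langle\xi,b\rangle,\qquad \xi\in\mathbb R^d,$$ assume that $$\operatorname{Re}\Phi(\xi)\ge c_0\left(|\xi|^\alpha\wedge|\xi|^\beta\right),\qquad \xi\in\mathbb R^d,$$ and let $\{P_t,\ t\ge0\}$ be the convolution semigroup of probability measures on $\mathbb R^d$ with Fourier transform $\int e^{i\langle\xi,y\rangle}P_t(dy)=e^{-t\Phi(\xi)}$. For $r>0$ let $$b_r=\begin{cases} b-\int_{r<|y|<1}y\,\nu(dy), & r\le1,\\ b+\int_{1<|y|<r}y\,\nu(dy), & r>1.\end{cases}$$ Then for every $t>0$ the measure $P_t$ is absolutely continuous with respect to the Lebesgue measure and has a continuous density $p_t$, and these densities satisfy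 $$p_t(x+t\,b_{t^{1/\alpha}})\le c\,t^{-d/\alpha}\min\left\{1,\ t^{1+\gamma/\alpha}|x|^{-\gamma-\alpha}q(|x|)\,\phi(|x|/4)\right\},\qquad t\in(0,1],\ x\in\mathbb R^d,$$ and $$p_t(x+t\,b_{t^{1/\beta}})\le c_1 t^{-d/\beta}\left(\min\left\{1,\ t^{1+\gamma/\beta}|x|^{-\gamma-\alpha}q(|x|)\,\phi(|x|/4)\right\}+e^{-c_2t^{-1/\beta}|x|\log\left(1+c_3t^{-1/\beta}|x|\right)}\right),\qquad t>1,\ x\in\mathbb R^d,$$ where $|x|^{-\gamma-\alpha}=\infty$ for $x=0$, so that both minima are then equal to $1$. -/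

import Mathlib

open MeasureTheory Set Metric
open scoped ENNReal RealInnerProductSpace

noncomputable section

/-- A Lévy measure on `ℝ^d`: `∫ (1 ∧ |y|²) ν(dy) < ∞`. (An atom at the origin is irrelevant for
the exponent below, and it is excluded by `PolarDominated`.) -/
def IsLevyMeasure {d : ℕ} (ν : Measure (EuclideanSpace ℝ (Fin d))) : Prop :=
  ∫⁻ y, ENNReal.ofReal (min 1 (‖y‖ ^ 2)) ∂ν < ∞

/-- The Lévy–Khinchin exponent
`Φ(ξ) = -∫ (e^{i⟨ξ,y⟩} - 1 - i⟨ξ,y⟩ 1_{B(0,1)}(y)) ν(dy) - i⟨ξ,b⟩`. -/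
def levyExponent {d : ℕ} (ν : Measure (EuclideanSpace ℝ (Fin d)))
    (b ξ : EuclideanSpace ℝ (Fin d)) : ℂ :=
  -(∫ y, (Complex.exp (Complex.I * (⟪ξ, y⟫ : ℝ)) - 1
      - Complex.I * (⟪ξ, y⟫ : ℝ) * (ball (0 : EuclideanSpace ℝ (Fin d)) 1).indicator 1 y) ∂ν)
    - Complex.I * (⟪ξ, b⟫ : ℝ)

/-- `(P t)_{t ≥ 0}` is the convolution semigroup of probability measures whose Fourier transform is
`∫ e^{i⟨ξ,y⟩} P_t(dy) = exp(-t Φ(ξ))`. -/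
structure IsLevySemigroup {d : ℕ} (ν : Measure (EuclideanSpace ℝ (Fin d)))
    (b : EuclideanSpace ℝ (Fin d)) (P : ℝ → Measure (EuclideanSpace ℝ (Fin d))) : Prop where
  isProbabilityMeasure : ∀ t, 0 ≤ t → IsProbabilityMeasure (P t)
  conv_eq : ∀ s t, 0 ≤ s → 0 ≤ t → P (s + t) = (P s).conv (P t)
  charFun_eq : ∀ t, 0 ≤ t → ∀ ξ, charFun (P t) ξ = Complex.exp (-(t : ℂ) * levyExponent ν b ξ)

/-- `ν(A) ≤ ∫_S ∫_0^∞ 1_A(sθ) s^{-1-α} q(s) φ(s) ds μ(dθ)` for all Borel sets `A`. -/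
def PolarDominated {d : ℕ} (ν : Measure (EuclideanSpace ℝ (Fin d)))
    (μ : Measure (sphere (0 : EuclideanSpace ℝ (Fin d)) 1)) (α : ℝ) (q φ : ℝ → ℝ) : Prop :=
  ∀ A : Set (EuclideanSpace ℝ (Fin d)), MeasurableSet A →
    ν A ≤ ∫⁻ θ, (∫⁻ s in Ioi (0 : ℝ),
      A.indicator 1 (s • (θ : EuclideanSpace ℝ (Fin d)))
        * ENNReal.ofReal (s ^ (-1 - α) * q s * φ s)) ∂μ

/-- The drift correction `b_r`: `b - ∫_{r<|y|<1} y ν(dy)` for `r ≤ 1` and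
`b + ∫_{1<|y|<r} y ν(dy)` for `r > 1`. -/
def driftAt {d : ℕ} (ν : Measure (EuclideanSpace ℝ (Fin d)))
    (b : EuclideanSpace ℝ (Fin d)) (r : ℝ) : EuclideanSpace ℝ (Fin d) :=
  if r ≤ 1 then b - ∫ y in {y | r < ‖y‖ ∧ ‖y‖ < 1}, y ∂ν
  else b + ∫ y in {y | 1 < ‖y‖ ∧ ‖y‖ < r}, y ∂ν

/-- `min {1, t^{1+γ/δ} ρ^{-γ-α} q(ρ) φ(ρ/4)}`, for a radius `ρ ≥ 0`. At `ρ = 0` the second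
entry is `+∞`, so that the minimum is `1` (the real power `0 ^ (-γ-α)` would be `0` here). -/
def minProfile (α γ δ : ℝ) (q φ : ℝ → ℝ) (t ρ : ℝ) : ℝ :=
  if ρ = 0 then 1
  else min 1 (t ^ (1 + γ / δ) * ρ ^ (-γ - α) * q ρ * φ (ρ / 4))

end

/-! Cut the jumps at radius `h`, where `h = t^{1/α}` for `t ≤ 1` and `h = t^{1/β}` for `t > 1`. The
exponent of `P_t` splits into the drift `t b_h`, a small-jump part with Lévy measure `σ = tν` on
`|y| < h`, and a compound Poisson law with jump measure `τ = tν` on `|y| ≥ h`. Dropping the large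
jumps costs only a bounded amount in the real part, so the assumed lower bound on `Re Φ` passes to
`σ` at scale `h`. Fourier inversion and Fubini then bound `p_t(x + t b_h)` by the compound Poisson
average of `|I(x - y)|`, where `I` is the inversion integral of the small-jump part
(`exists_density_le_of_charFun_eq`).

Small jumps. Bounded jumps make the exponent of `σ` entire, so the inversion integral may be moved
from `ξ` to `ξ + iη` (`integral_shiftedInversionIntegrand_eq`). With `η` opposite to `x` and `|η| h
= s`, this gains `e^{-s|x|/h}` and costs `exp(A s² e^s + s d/α)`. The choice `s = ½ log(1 + R)`, `R
= |x|/h`, gives a bound of order `h^{-d} exp(-¼ R log(1 + R))` (`exists_smallJump_density_bound`).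

Large jumps. Domination of `ν` gives `τ ≤ φ(|y|/2) Λ`, where `Λ` has radial density `t s^{-1-α} q(s)
φ(s)/φ(s/2)` on `s ≥ h`. The product inequality for `φ` pulls this weight through convolution powers
(`lintegral_convPow_le_of_submultiplicative`). The part of a ball of radius `r` outside `B(0,a)` has
`Λ`-mass at most a constant times `t r^γ a^{-γ-α} q(a)`: the angular measure gives `(r/a)^{γ-1}`,
the radial variable one more factor `r`. This survives convolution up to `C^n`, because one of two
summands has at least half the norm of the sum and `a^{-γ-α} q(a)` is doubling
(`convPow_annulus_ball_le`). Integrating powers when `h ≤ 1`, and the growth condition when `h > 1`,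
show that `Λ` has bounded mass and `σ` second moment `O(h²)`.

In the average, `|y| < |x|/2` produces the superexponential term and `|y| ≥ |x|/2` the polynomial
one, with `φ(|x|/4)` coming from `φ(|y|/2)`. For `t ≤ 1` one has `h ≤ 1`; since `q` and `φ` decay at
most exponentially, the polynomial profile absorbs the superexponential term. -/

/-! ### Fourier inversion: continuous densities from integrable characteristic functions. -/

section FourierInversionOfMeasures

open Filter Topology FourierTransform
open scoped ContDiff

variable {E : Type*} [NormedAddCommGroup E] [InnerProductSpace ℝ E] [FiniteDimensional ℝ E]
  [MeasurableSpace E] [BorelSpace E]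

theorem integral_fourierInv_measure (P : Measure E) [IsFiniteMeasure P] {f : E → ℂ}
    (hf : Integrable f) :
    ∫ x, (𝓕⁻ f : E → ℂ) x ∂P = ∫ v, f v * charFun P ((2 * Real.pi) • v) := by
  simp_rw [Real.fourierInv_eq']
  rw [integral_integral_swap]
  · refine integral_congr_ae (Eventually.of_forall fun v => ?_)
    simp only [smul_eq_mul]
    rw [integral_mul_const, mul_comm, charFun_apply]
    congr 1
    refine integral_congr_ae (Eventually.of_forall fun x => ?_)
    simp only [inner_smul_right, real_inner_comm x v]
  · have h1 : Integrable (fun z : E × E => f z.2) (P.prod volume) := hf.comp_snd P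
    refine h1.norm.mono' ?_ (Eventually.of_forall fun z => ?_)
    · have hc : Continuous fun z : E × E =>
          Complex.exp (((2 * Real.pi * ⟪z.2, z.1⟫ : ℝ) : ℂ) * Complex.I) := by fun_prop
      exact hc.aestronglyMeasurable.smul h1.aestronglyMeasurable
    · simp only [Function.uncurry, norm_smul]
      rw [Complex.norm_exp_ofReal_mul_I, one_mul]

/-- Inversion of `f` moves the integral against `P` to the frequency side, and self-adjointness of
the Fourier transform brings it back. This identifies `P`, as a distribution, with the transform of
its characteristic function. -/
theorem integral_schwartz_measure (P : Measure E) [IsFiniteMeasure P]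
    (hP : Integrable fun v => charFun P ((2 * Real.pi) • v)) (f : SchwartzMap E ℂ) :
    ∫ x, f x ∂P = ∫ x, f x * (𝓕 fun v => charFun P ((2 * Real.pi) • v) : E → ℂ) x := by
  have h1 := integral_fourierInv_measure P (f := ⇑(𝓕 f : SchwartzMap E ℂ)) (𝓕 f : SchwartzMap E ℂ).integrable
  have h2 : (𝓕⁻ (⇑(𝓕 f : SchwartzMap E ℂ)) : E → ℂ) = f := by
    rw [← SchwartzMap.fourierInv_coe, FourierTransform.fourierInv_fourier_eq]
  rw [h2] at h1
  rw [h1]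
  have h3 := VectorFourier.integral_bilin_fourierIntegral_eq_flip (ContinuousLinearMap.mul ℂ ℂ)
    (L := innerₗ E) (μ := volume) (ν := volume)
    Real.continuous_fourierChar continuous_inner f.integrable hP
  have h4 : (innerₗ E).flip = innerₗ E := by
    ext x y; simp
  rw [h4] at h3
  exact h3

theorem integral_contDiff_smul_measure (P : Measure E) [IsFiniteMeasure P]
    (hP : Integrable fun v => charFun P ((2 * Real.pi) • v)) {f : E → ℝ}
    (hf : ContDiff ℝ ∞ f) (hfs : HasCompactSupport f) :
    ((∫ x, f x ∂P : ℝ) : ℂ)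
      = ∫ x, f x • (𝓕 fun v => charFun P ((2 * Real.pi) • v) : E → ℂ) x := by
  have h := integral_schwartz_measure P hP
    (HasCompactSupport.toSchwartzMap (f := fun x => (f x : ℂ))
      (hfs.comp_left Complex.ofReal_zero) (Complex.ofRealCLM.contDiff.comp hf))
  rw [← integral_complex_ofReal]
  exact h

/-- A finite measure on a Euclidean space with integrable characteristic function has a continuous
density given by the Fourier inversion formula. -/
theorem withDensity_of_integrable_charFun (P : Measure E) [IsFiniteMeasure P]
    (hP : Integrable fun v => charFun P ((2 * Real.pi) • v)) :
    ∃ p : E → ℝ, Continuous p ∧ (∀ x, 0 ≤ p x) ∧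
      (∀ x, (p x : ℂ) = (𝓕 fun v => charFun P ((2 * Real.pi) • v) : E → ℂ) x) ∧
      P = volume.withDensity (fun x => ENNReal.ofReal (p x)) := by
  set g : E → ℂ := fun v => charFun P ((2 * Real.pi) • v) with hg
  have hcont : Continuous (𝓕 g : E → ℂ) :=
    VectorFourier.fourierIntegral_continuous Real.continuous_fourierChar continuous_inner hP
  have hgc : Continuous g := by
    have : Continuous (charFun P) := by
      refine continuous_of_dominated (bound := fun _ => 1) ?_ ?_ ?_ ?_
      · intro ξ; exact Continuous.aestronglyMeasurable (by fun_prop)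
      · intro ξ; refine Eventually.of_forall fun x => ?_
        rw [Complex.norm_exp_ofReal_mul_I]
      · exact integrable_const _
      · refine Eventually.of_forall fun x => ?_; fun_prop
    exact this.comp (by fun_prop)
  have key : ∀ f : E → ℝ, ContDiff ℝ ∞ f → HasCompactSupport f →
      ((∫ x, f x ∂P : ℝ) : ℂ) = ∫ x, f x • (𝓕 g : E → ℂ) x :=
    fun f hf hfs => integral_contDiff_smul_measure P hP hf hfs
  have hint : ∀ f : E → ℝ, ContDiff ℝ ∞ f → HasCompactSupport f →
      Integrable fun x => f x • (𝓕 g : E → ℂ) x := fun f hf hfs =>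
    (hf.continuous.smul hcont).integrable_of_hasCompactSupport hfs.smul_right
  -- Real test functions have real integrals against `P`, so the imaginary part vanishes as a
  -- distribution, and everywhere by continuity.
  have him : ∀ x, ((𝓕 g : E → ℂ) x).im = 0 := by
    have hc : Continuous fun x => ((𝓕 g : E → ℂ) x).im := Complex.continuous_im.comp hcont
    have h0 : ∀ᵐ x ∂(volume : Measure E), ((𝓕 g : E → ℂ) x).im = 0 := by
      refine ae_eq_zero_of_integral_contDiff_smul_eq_zero hc.locallyIntegrable fun f hf hfs => ?_
      have h1 := congrArg Complex.im (key f hf hfs)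
      rw [Complex.ofReal_im, ← RCLike.im_eq_complex_im, ← integral_im (hint f hf hfs)] at h1
      simpa using h1.symm
    exact fun x => congrFun (hc.ae_eq_iff_eq volume continuous_const |>.1 h0) x
  have hre : ∀ f : E → ℝ, ContDiff ℝ ∞ f → HasCompactSupport f →
      ∫ x, f x ∂P = ∫ x, f x * ((𝓕 g : E → ℂ) x).re := fun f hf hfs => by
    have h1 := congrArg Complex.re (key f hf hfs)
    rw [Complex.ofReal_re, ← RCLike.re_eq_complex_re, ← integral_re (hint f hf hfs)] at h1
    simpa using h1
  have hrc : Continuous fun x => ((𝓕 g : E → ℂ) x).re := Complex.continuous_re.comp hcont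
  -- At a point of negativity, a bump supported where the transform is negative would have a
  -- nonnegative integral against `P` equal to a negative number.
  have hpos : ∀ x, 0 ≤ ((𝓕 g : E → ℂ) x).re := by
    intro x₀
    by_contra! hneg
    obtain ⟨δ, hδ, hball⟩ := Metric.mem_nhds_iff.1 (hrc.continuousAt.eventually_lt_const hneg)
    let f : ContDiffBump x₀ := ⟨δ / 4, δ / 2, by positivity, by linarith⟩
    have h1 := hre f f.contDiff f.hasCompactSupport
    have h2 : 0 ≤ ∫ x, f x ∂P := integral_nonneg fun x => f.nonneg
    have h3 : ∫ x, f x * ((𝓕 g : E → ℂ) x).re < 0 := by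
      rw [← neg_pos, ← integral_neg]
      refine (integral_pos_iff_support_of_nonneg ?_ ?_).2 ?_
      · intro x
        simp only [Pi.zero_apply]
        by_cases hx : x ∈ Metric.ball x₀ δ
        · have := hball hx
          simp only [mem_ofPred_eq] at this
          nlinarith [f.nonneg (x := x)]
        · have : f x = 0 := by
            apply f.zero_of_le_dist
            simp only [Metric.mem_ball, not_lt] at hx
            have : f.rOut = δ / 2 := rfl
            linarith
          simp [this]
      · exact ((f.continuous.mul hrc).integrable_of_hasCompactSupport
          f.hasCompactSupport.mul_right).neg
      · refine lt_of_lt_of_le (Metric.measure_ball_pos volume x₀ (r := δ / 2) (by positivity))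
          (measure_mono fun x hx => ?_)
        have hx' : x ∈ Metric.ball x₀ δ := Metric.ball_subset_ball (by linarith) hx
        have := hball hx'
        simp only [mem_ofPred_eq] at this
        have hf0 : 0 < f x := f.pos_of_mem_ball hx
        simp only [Function.mem_support]
        nlinarith
    linarith
  -- Bumps that equal one on large balls bound the integral over each ball by the total mass of `P`.
  -- Integrability is what makes the inversion of `g` legitimate below.
  have hinteg : Integrable fun x => ((𝓕 g : E → ℂ) x).re := by
    have hcov : AECover (volume : Measure E) atTop fun n : ℕ => Metric.ball (0 : E) n :=
      aecover_ball tendsto_natCast_atTop_atTop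
    refine hcov.integrable_of_lintegral_enorm_bounded (P.real univ)
      hrc.aestronglyMeasurable (Eventually.of_forall fun n => ?_)
    let f : ContDiffBump (0 : E) := ⟨n + 1, n + 2, by positivity, by linarith⟩
    have hfi : Integrable fun x => f x * ((𝓕 g : E → ℂ) x).re :=
      (f.continuous.mul hrc).integrable_of_hasCompactSupport f.hasCompactSupport.mul_right
    calc ∫⁻ x in Metric.ball (0 : E) n, ‖((𝓕 g : E → ℂ) x).re‖ₑ
        ≤ ∫⁻ x in Metric.ball (0 : E) n, ENNReal.ofReal (f x * ((𝓕 g : E → ℂ) x).re) := by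
          refine setLIntegral_mono' measurableSet_ball fun x hx => ?_
          rw [← ofReal_norm, Real.norm_of_nonneg (hpos x), f.one_of_mem_closedBall, one_mul]
          have : f.rIn = n + 1 := rfl
          simp only [Metric.mem_ball, Metric.mem_closedBall] at hx ⊢
          linarith
      _ ≤ ∫⁻ x, ENNReal.ofReal (f x * ((𝓕 g : E → ℂ) x).re) := setLIntegral_le_lintegral _ _
      _ = ENNReal.ofReal (∫ x, f x * ((𝓕 g : E → ℂ) x).re) :=
          (ofReal_integral_eq_lintegral_ofReal hfi
            (Eventually.of_forall fun x => mul_nonneg f.nonneg (hpos x))).symm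
      _ ≤ ENNReal.ofReal (P.real univ) := by
          refine ENNReal.ofReal_le_ofReal ?_
          rw [← hre f f.contDiff f.hasCompactSupport]
          calc ∫ x, f x ∂P ≤ ∫ _, (1 : ℝ) ∂P :=
                integral_mono (f.continuous.integrable_of_hasCompactSupport f.hasCompactSupport)
                  (integrable_const _) fun x => f.le_one
            _ = P.real univ := by simp
  have heq : ∀ x, (((𝓕 g : E → ℂ) x).re : ℂ) = (𝓕 g : E → ℂ) x := fun x =>
    Complex.ext (by simp) (by simp [him x])
  have hFi : Integrable (𝓕 g : E → ℂ) := by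
    have := hinteg.ofReal (𝕜 := ℂ)
    refine this.congr (Eventually.of_forall fun x => heq x)
  refine ⟨fun x => ((𝓕 g : E → ℂ) x).re, hrc, hpos, heq, ?_⟩
  have : IsFiniteMeasure (volume.withDensity fun x => ENNReal.ofReal ((𝓕 g : E → ℂ) x).re) :=
    isFiniteMeasure_withDensity_ofReal hinteg.2
  refine Measure.ext_of_charFun (funext fun ξ => ?_)
  have hinv := hgc.fourierInv_fourier_eq hP hFi
  have hξ : ξ = (2 * Real.pi) • ((2 * Real.pi)⁻¹ • ξ) := by
    rw [smul_smul, mul_inv_cancel₀ (by positivity), one_smul]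
  have h1 : charFun P ξ = g ((2 * Real.pi)⁻¹ • ξ) := by
    rw [hg]; simp only; rw [← hξ]
  have h2 : g ((2 * Real.pi)⁻¹ • ξ) = (𝓕⁻ (𝓕 g) : E → ℂ) ((2 * Real.pi)⁻¹ • ξ) := by rw [hinv]
  rw [h1, h2, Real.fourierInv_eq', charFun_apply]
  rw [integral_withDensity_eq_integral_toReal_smul hrc.measurable.ennreal_ofReal
    (Eventually.of_forall fun x => ENNReal.ofReal_lt_top)]
  refine integral_congr_ae (Eventually.of_forall fun x => ?_)
  simp only [ENNReal.toReal_ofReal (hpos x), smul_eq_mul, Complex.real_smul]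
  rw [heq, mul_comm, inner_smul_right, ← mul_assoc, mul_inv_cancel₀ (by positivity), one_mul]

end FourierInversionOfMeasures

/-! ### Entire dependence on a complex parameter. -/

section HolomorphicParameterIntegrals

open Filter Topology

/-- Cauchy's estimate on circles of radius `1/2` turns domination of `F` into domination of its
derivative, so no separate bound on the derivative is needed. -/
theorem differentiable_integral_of_locally_dominated {X : Type*} [MeasurableSpace X]
    {μ : Measure X} {F : ℂ → X → ℂ} (hF : ∀ᵐ a ∂μ, Differentiable ℂ fun w => F w a)
    (hmeas : ∀ w, AEStronglyMeasurable (F w) μ)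
    (hbound : ∀ w₀, ∃ B : X → ℝ, Integrable B μ ∧
      ∀ᵐ a ∂μ, ∀ w ∈ ball w₀ 2, ‖F w a‖ ≤ B a) :
    Differentiable ℂ fun w => ∫ a, F w a ∂μ := by
  intro w₀
  obtain ⟨B, hB, hFB⟩ := hbound w₀
  have hmem : ∀ w ∈ ball w₀ 1, ∀ z ∈ closedBall w (1 / 2), z ∈ ball w₀ 2 := by
    intro w hw z hz
    rw [mem_ball] at *
    rw [mem_closedBall] at hz
    linarith [dist_triangle z w w₀]
  refine (hasDerivAt_integral_of_dominated_loc_of_deriv_le (μ := μ) (𝕜 := ℂ) (F := F)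
    (F' := fun w a => deriv (fun w => F w a) w) (bound := fun a => B a / (1 / 2))
    (ball_mem_nhds w₀ one_pos) (Eventually.of_forall hmeas) ?_ ?_ ?_ (hB.div_const _)
    ?_).2.differentiableAt
  · refine hB.mono' (hmeas w₀) ?_
    filter_upwards [hFB] with a ha using ha w₀ (mem_ball_self two_pos)
  · let u : ℕ → ℂ := fun n => ((1 / ((n : ℝ) + 1) : ℝ) : ℂ)
    have hu : Tendsto u atTop (𝓝[≠] 0) := by
      refine tendsto_nhdsWithin_iff.2 ⟨?_, Eventually.of_forall fun n => ?_⟩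
      · have := (Complex.continuous_ofReal.tendsto 0).comp
          (tendsto_one_div_add_atTop_nhds_zero_nat (𝕜 := ℝ))
        simpa [u, Function.comp_def] using this
      · simp only [u, mem_compl_iff, mem_singleton_iff, Complex.ofReal_eq_zero]
        positivity
    refine aestronglyMeasurable_of_tendsto_ae atTop
      (f := fun (n : ℕ) a => (u n)⁻¹ • (F (w₀ + u n) a - F w₀ a))
      (fun n => ((hmeas (w₀ + u n)).sub (hmeas w₀)).const_smul ((u n)⁻¹)) ?_
    filter_upwards [hF] with a ha
    exact ((hasDerivAt_iff_tendsto_slope_zero.1 (ha w₀).hasDerivAt).comp hu)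
  · filter_upwards [hF, hFB] with a ha hFa w hw
    exact Complex.norm_deriv_le_of_forall_mem_sphere_norm_le (by norm_num) ha.diffContOnCl
      fun z hz => hFa z (hmem w hw z (sphere_subset_closedBall hz))
  · filter_upwards [hF] with a ha w _ using (ha w).hasDerivAt

/-- The complex derivative can be computed along the real direction, where `f` does not change. This
replaces the contour argument: translation invariance of Lebesgue measure gives the real invariance.
-/
theorem Differentiable.const_of_real_periodic {f : ℂ → ℂ} (hf : Differentiable ℂ f)
    (h : ∀ (w : ℂ) (a : ℝ), f (w + a) = f w) (z w : ℂ) : f z = f w := by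
  refine is_const_of_deriv_eq_zero hf (fun w => ?_) z w
  have h1 : HasDerivAt (fun z : ℂ => f (w + z)) (_root_.deriv f w) ((0 : ℝ) : ℂ) := by
    have := (hf w).hasDerivAt
    rw [← add_zero w] at this
    simpa using HasDerivAt.comp_const_add w 0 this
  have h2 := h1.comp_ofReal
  simp only [h] at h2
  exact h2.unique (hasDerivAt_const _ _)

end HolomorphicParameterIntegrals

/-! ### Integrals of stretched exponentials. -/

section StretchedExponential

variable {E : Type*} [NormedAddCommGroup E] [InnerProductSpace ℝ E] [FiniteDimensional ℝ E]
  [MeasurableSpace E] [BorelSpace E]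

theorem integrable_exp_neg_mul_norm_rpow [Nontrivial E] {k α : ℝ} (hk : 0 < k) (hα : 0 < α) :
    Integrable fun ξ : E => Real.exp (-k * ‖ξ‖ ^ α) := by
  rw [integrable_fun_norm_addHaar (μ := volume) (f := fun u => Real.exp (-k * u ^ α))]
  have h : (-1 : ℝ) < ((Module.finrank ℝ E - 1 : ℕ) : ℝ) := by
    have : (0 : ℝ) ≤ ((Module.finrank ℝ E - 1 : ℕ) : ℝ) := by positivity
    linarith
  refine (integrableOn_rpow_mul_exp_neg_mul_rpow h hα hk).congr_fun (fun u _ => ?_)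
    measurableSet_Ioi
  simp

/-- The substitution `ξ ↦ e^{-s/α} h ξ` absorbs the damping factor `e^{-s}`; its Jacobian is the
price `e^{sd/α}` of the complex shift, together with the expected `h^{-d}`. -/
theorem integral_exp_neg_mul_norm_smul_rpow {c α s h : ℝ} (hα : 0 < α) (hh : 0 < h) :
    ∫ ξ : E, Real.exp (-(Real.exp (-s) * (c * (h * ‖ξ‖) ^ α)))
      = Real.exp (s * Module.finrank ℝ E / α) * (h ^ Module.finrank ℝ E)⁻¹
        * ∫ ξ : E, Real.exp (-c * ‖ξ‖ ^ α) := by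
  have h1 := Measure.integral_comp_smul (volume : Measure E)
    (fun ξ => Real.exp (-c * ‖ξ‖ ^ α)) (Real.exp (-s / α) * h)
  have h2 : 0 < Real.exp (-s / α) * h := by positivity
  rw [abs_of_pos (by positivity), smul_eq_mul, mul_pow, ← Real.exp_nat_mul, mul_inv,
    ← Real.exp_neg] at h1
  rw [show s * Module.finrank ℝ E / α = -(Module.finrank ℝ E * (-s / α)) by ring, ← h1]
  refine integral_congr_ae (Filter.Eventually.of_forall fun ξ => ?_)
  simp only
  congr 1
  rw [norm_smul, Real.norm_of_nonneg h2.le, mul_assoc,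
    Real.mul_rpow (Real.exp_pos _).le (by positivity), ← Real.exp_mul,
    div_mul_cancel₀ _ hα.ne']
  ring

end StretchedExponential

/-! ### The small-jump part at complex frequencies. -/

section SmallJumps

open Filter Topology

variable {E : Type*} [NormedAddCommGroup E] [InnerProductSpace ℝ E]

/-- `e^{iz} - 1 - iz`. -/
noncomputable def compensatedExp (z : ℂ) : ℂ :=
  Complex.exp (Complex.I * z) - 1 - Complex.I * z

theorem differentiable_compensatedExp : Differentiable ℂ compensatedExp := by
  unfold compensatedExp; fun_prop

theorem norm_compensatedExp_le (z : ℂ) : ‖compensatedExp z‖ ≤ ‖z‖ ^ 2 * Real.exp ‖z‖ := by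
  have := Complex.norm_exp_sub_sum_le_norm_mul_exp (Complex.I * z) 2
  simpa [Finset.sum_range_succ, sub_sub, compensatedExp] using this

/-- The real part is exactly `-e^{-b}(1 - cos a) + (e^{-b} - 1 + b)`. An imaginary shift thus
weakens the oscillatory decay by at most `e^{-|b|}` and adds a second-order remainder. -/
theorem re_compensatedExp_le (a b : ℝ) :
    (compensatedExp (a + b * Complex.I)).re
      ≤ -(Real.exp (-|b|) * (1 - Real.cos a)) + b ^ 2 * Real.exp |b| := by
  have h1 : Complex.I * (a + b * Complex.I) = ((-b : ℝ) : ℂ) + a * Complex.I := by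
    push_cast; ring_nf; simp [sub_eq_add_neg]
  have h2 : (compensatedExp (a + b * Complex.I)).re
      = -(Real.exp (-b) * (1 - Real.cos a)) + (Real.exp (-b) - 1 - (-b)) := by
    rw [compensatedExp, h1, Complex.exp_add]
    simp only [Complex.sub_re, ← Complex.ofReal_exp,
      Complex.exp_ofReal_mul_I_re, Complex.one_re, Complex.add_re, Complex.ofReal_re,
      Complex.mul_re, Complex.ofReal_im, Complex.I_re, Complex.I_im]
    ring
  have h3 : Real.exp (-b) - 1 - (-b) ≤ b ^ 2 * Real.exp |b| := by
    have h := norm_compensatedExp_le (b * Complex.I)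
    have h' : compensatedExp (b * Complex.I) = ((Real.exp (-b) - 1 - (-b) : ℝ) : ℂ) := by
      have : Complex.I * (b * Complex.I) = ((-b : ℝ) : ℂ) := by
        rw [mul_comm, mul_assoc, Complex.I_mul_I]; simp
      rw [compensatedExp, this]; push_cast; ring
    rw [h', Complex.norm_real] at h
    simp only [norm_mul, Complex.norm_real, Complex.norm_I, mul_one, Real.norm_eq_abs,
      sq_abs] at h
    exact (le_abs_self _).trans h
  have h4 : Real.exp (-|b|) ≤ Real.exp (-b) := Real.exp_le_exp.2 (neg_le_neg (le_abs_self b))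
  have h5 : 0 ≤ 1 - Real.cos a := by linarith [Real.cos_le_one a]
  rw [h2]
  nlinarith

theorem norm_shiftedExponent_integrand_le {ξ η y : E} {w : ℂ} {K h : ℝ} (hy : ‖y‖ ≤ h)
    (hK : ‖ξ‖ + ‖w‖ * ‖η‖ ≤ K) :
    ‖compensatedExp (⟪ξ, y⟫ + w * ⟪η, y⟫)‖ ≤ K ^ 2 * Real.exp (K * h) * ‖y‖ ^ 2 := by
  have hz : ‖((⟪ξ, y⟫ : ℝ) : ℂ) + w * (⟪η, y⟫ : ℝ)‖ ≤ K * ‖y‖ := by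
    calc ‖((⟪ξ, y⟫ : ℝ) : ℂ) + w * (⟪η, y⟫ : ℝ)‖ ≤ |⟪ξ, y⟫| + ‖w‖ * |⟪η, y⟫| := by
          refine (norm_add_le _ _).trans ?_
          simp
      _ ≤ ‖ξ‖ * ‖y‖ + ‖w‖ * (‖η‖ * ‖y‖) := by
          gcongr <;> exact abs_real_inner_le_norm _ _
      _ = (‖ξ‖ + ‖w‖ * ‖η‖) * ‖y‖ := by ring
      _ ≤ K * ‖y‖ := by gcongr
  have hK0 : 0 ≤ K := le_trans (by positivity) hK
  calc _ ≤ _ := norm_compensatedExp_le _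
    _ ≤ (K * ‖y‖) ^ 2 * Real.exp (K * h) := by
        gcongr
        exact hz.trans (by gcongr)
    _ = _ := by ring

theorem continuous_shiftedExponent_integrand (ξ η : E) (w : ℂ) :
    Continuous fun y : E => compensatedExp (⟪ξ, y⟫ + w * ⟪η, y⟫) :=
  differentiable_compensatedExp.continuous.comp (by fun_prop)

variable [MeasurableSpace E]

/-- The compensated Lévy–Khinchin integral at the complex frequency `ξ + w η`. -/
noncomputable def shiftedExponent (σ : Measure E) (ξ η : E) (w : ℂ) : ℂ :=
  ∫ y, compensatedExp (⟪ξ, y⟫ + w * ⟪η, y⟫) ∂σ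

theorem shiftedExponent_add_real (σ : Measure E) (ξ η : E) (w : ℂ) (a : ℝ) :
    shiftedExponent σ ξ η (w + a) = shiftedExponent σ (ξ + a • η) η w := by
  unfold shiftedExponent
  congr 1; ext y; congr 1
  simp only [inner_add_left, inner_smul_left, RCLike.conj_to_real]
  push_cast; ring

/-- The integrand of the Fourier inversion integral for the small jump part at the complex
frequency `ξ + w η`. -/
noncomputable def shiftedInversionIntegrand (σ : Measure E) (x η : E) (w : ℂ) (ξ : E) : ℂ :=
  Complex.exp (-Complex.I * (⟪ξ, x⟫ + w * ⟪η, x⟫) + shiftedExponent σ ξ η w)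

theorem shiftedInversionIntegrand_add_real (σ : Measure E) (x η ξ : E) (w : ℂ) (a : ℝ) :
    shiftedInversionIntegrand σ x η (w + a) ξ
      = shiftedInversionIntegrand σ x η w (ξ + a • η) := by
  unfold shiftedInversionIntegrand
  rw [shiftedExponent_add_real]
  congr 2
  simp only [inner_add_left, inner_smul_left, RCLike.conj_to_real]
  push_cast; ring

variable {σ : Measure E} {h : ℝ}

variable [BorelSpace E]

theorem integrable_shiftedExponent_integrand (hσ : Integrable (fun y => ‖y‖ ^ 2) σ)
    (hσh : ∀ᵐ y ∂σ, ‖y‖ ≤ h) (ξ η : E) (w : ℂ) :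
    Integrable (fun y : E => compensatedExp (⟪ξ, y⟫ + w * ⟪η, y⟫)) σ := by
  refine (hσ.const_mul ((‖ξ‖ + ‖w‖ * ‖η‖) ^ 2 * Real.exp ((‖ξ‖ + ‖w‖ * ‖η‖) * h))).mono'
    (continuous_shiftedExponent_integrand ξ η w).aestronglyMeasurable ?_
  filter_upwards [hσh] with y hy using norm_shiftedExponent_integrand_le hy le_rfl

theorem differentiable_shiftedExponent (hσ : Integrable (fun y => ‖y‖ ^ 2) σ)
    (hσh : ∀ᵐ y ∂σ, ‖y‖ ≤ h) (ξ η : E) : Differentiable ℂ (shiftedExponent σ ξ η) := by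
  refine differentiable_integral_of_locally_dominated (Eventually.of_forall fun y => ?_)
    (fun w => (continuous_shiftedExponent_integrand ξ η w).aestronglyMeasurable) fun w₀ => ?_
  · exact differentiable_compensatedExp.comp (by fun_prop)
  · set K := ‖ξ‖ + (‖w₀‖ + 2) * ‖η‖ with hK
    refine ⟨_, hσ.const_mul (K ^ 2 * Real.exp (K * h)), ?_⟩
    filter_upwards [hσh] with y hy w hw
    refine norm_shiftedExponent_integrand_le hy ?_
    have : ‖w‖ ≤ ‖w₀‖ + 2 := by
      rw [mem_ball_iff_norm] at hw
      linarith [norm_le_norm_add_norm_sub' w w₀]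
    rw [hK]
    gcongr

theorem continuous_shiftedExponent (hσ : Integrable (fun y => ‖y‖ ^ 2) σ)
    (hσh : ∀ᵐ y ∂σ, ‖y‖ ≤ h) (η : E) (w : ℂ) :
    Continuous fun ξ => shiftedExponent σ ξ η w := by
  refine continuous_iff_continuousAt.2 fun ξ₀ => ?_
  set K := (‖ξ₀‖ + 1) + ‖w‖ * ‖η‖ with hK
  refine continuousAt_of_dominated (bound := fun y => K ^ 2 * Real.exp (K * h) * ‖y‖ ^ 2)
    (Eventually.of_forall fun ξ =>
      (continuous_shiftedExponent_integrand ξ η w).aestronglyMeasurable) ?_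
    (hσ.const_mul _) (Eventually.of_forall fun y => ?_)
  · filter_upwards [ball_mem_nhds ξ₀ one_pos] with ξ hξ
    filter_upwards [hσh] with y hy
    refine norm_shiftedExponent_integrand_le hy ?_
    have : ‖ξ‖ ≤ ‖ξ₀‖ + 1 := by
      rw [mem_ball_iff_norm] at hξ
      linarith [norm_le_norm_add_norm_sub' ξ ξ₀]
    rw [hK]
    gcongr
  · refine Continuous.continuousAt ?_
    exact differentiable_compensatedExp.continuous.comp (by fun_prop)

theorem one_sub_cos_le_sq_div_two (a : ℝ) : 1 - Real.cos a ≤ a ^ 2 / 2 := by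
  linarith [Real.one_sub_sq_div_two_le_cos (x := a)]

theorem integrable_one_sub_cos_inner (hσ : Integrable (fun y => ‖y‖ ^ 2) σ) (ξ : E) :
    Integrable (fun y : E => 1 - Real.cos ⟪ξ, y⟫) σ := by
  refine (hσ.const_mul (‖ξ‖ ^ 2 / 2)).mono' (Continuous.aestronglyMeasurable (by fun_prop))
    (Eventually.of_forall fun y => ?_)
  rw [Real.norm_of_nonneg (by linarith [Real.cos_le_one ⟪ξ, y⟫])]
  refine (one_sub_cos_le_sq_div_two _).trans ?_
  have : ⟪ξ, y⟫ ^ 2 ≤ (‖ξ‖ * ‖y‖) ^ 2 := by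
    rw [← sq_abs ⟪ξ, y⟫]
    exact pow_le_pow_left₀ (abs_nonneg _) (abs_real_inner_le_norm ξ y) 2
  nlinarith

/-- Integrate `re_compensatedExp_le`, using `|y| ≤ h` in the exponentials only, so that the
remainder retains the second moment of `σ`. -/
theorem re_shiftedExponent_le (hσ : Integrable (fun y => ‖y‖ ^ 2) σ)
    (hσh : ∀ᵐ y ∂σ, ‖y‖ ≤ h) (ξ η : E) (w : ℂ) :
    (shiftedExponent σ ξ η w).re
      ≤ -(Real.exp (-(|w.im| * ‖η‖ * h)) * ∫ y, (1 - Real.cos ⟪ξ + w.re • η, y⟫) ∂σ)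
        + (|w.im| * ‖η‖) ^ 2 * Real.exp (|w.im| * ‖η‖ * h) * ∫ y, ‖y‖ ^ 2 ∂σ := by
  have hi := integrable_shiftedExponent_integrand hσ hσh ξ η w
  have hc := integrable_one_sub_cos_inner hσ (ξ + w.re • η)
  have h1 := (hc.const_mul (Real.exp (-(|w.im| * ‖η‖ * h)))).neg
  have h2 := hσ.const_mul ((|w.im| * ‖η‖) ^ 2 * Real.exp (|w.im| * ‖η‖ * h))
  have hl : (shiftedExponent σ ξ η w).re
      = ∫ y, (compensatedExp (⟪ξ, y⟫ + w * ⟪η, y⟫)).re ∂σ := (integral_re hi).symm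
  rw [hl, ← integral_const_mul, ← integral_const_mul, ← integral_neg]
  refine le_of_le_of_eq (integral_mono_ae hi.re (h1.add h2) ?_) (integral_add h1 h2)
  filter_upwards [hσh] with y hy
  have e1 : ((⟪ξ, y⟫ : ℝ) : ℂ) + w * (⟪η, y⟫ : ℝ)
      = ((⟪ξ + w.re • η, y⟫ : ℝ) : ℂ) + ((w.im * ⟪η, y⟫ : ℝ) : ℂ) * Complex.I := by
    conv_lhs => rw [← Complex.re_add_im w]
    simp only [inner_add_left, inner_smul_left, RCLike.conj_to_real]
    push_cast; ring
  rw [e1]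
  refine (re_compensatedExp_le _ _).trans ?_
  have hb : |w.im * ⟪η, y⟫| ≤ |w.im| * ‖η‖ * ‖y‖ := by
    rw [abs_mul, mul_assoc]
    gcongr
    exact abs_real_inner_le_norm _ _
  have hb' : |w.im * ⟪η, y⟫| ≤ |w.im| * ‖η‖ * h := hb.trans (by gcongr)
  have hcos : 0 ≤ 1 - Real.cos ⟪ξ + w.re • η, y⟫ := by
    linarith [Real.cos_le_one ⟪ξ + w.re • η, y⟫]
  refine add_le_add (neg_le_neg ?_) ?_
  · exact mul_le_mul_of_nonneg_right (Real.exp_le_exp.2 (neg_le_neg hb')) hcos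
  · calc (w.im * ⟪η, y⟫) ^ 2 * Real.exp |w.im * ⟪η, y⟫|
        ≤ (|w.im| * ‖η‖ * ‖y‖) ^ 2 * Real.exp (|w.im| * ‖η‖ * h) := by
          rw [← sq_abs (w.im * ⟪η, y⟫)]
          gcongr
      _ = _ := by ring

theorem norm_shiftedInversionIntegrand_le {c C α : ℝ} (hh : 0 ≤ h) (hC : 0 ≤ C)
    (hσ : Integrable (fun y => ‖y‖ ^ 2) σ) (hσh : ∀ᵐ y ∂σ, ‖y‖ ≤ h)
    (hlow : ∀ ξ : E, c * (h * ‖ξ‖) ^ α - C ≤ ∫ y, (1 - Real.cos ⟪ξ, y⟫) ∂σ) (x η ξ : E) (w : ℂ) :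
    ‖shiftedInversionIntegrand σ x η w ξ‖
      ≤ Real.exp (w.im * ⟪η, x⟫ + C
          + (|w.im| * ‖η‖) ^ 2 * Real.exp (|w.im| * ‖η‖ * h) * ∫ y, ‖y‖ ^ 2 ∂σ)
        * Real.exp (-(Real.exp (-(|w.im| * ‖η‖ * h)) * (c * (h * ‖ξ + w.re • η‖) ^ α))) := by
  rw [shiftedInversionIntegrand, Complex.norm_exp, ← Real.exp_add]
  refine Real.exp_le_exp.2 ?_
  have h1 := re_shiftedExponent_le hσ hσh ξ η w
  have h2 : (-Complex.I * (((⟪ξ, x⟫ : ℝ) : ℂ) + w * (⟪η, x⟫ : ℝ))).re = w.im * ⟪η, x⟫ := by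
    simp
  rw [Complex.add_re, h2]
  set e := Real.exp (-(|w.im| * ‖η‖ * h)) with he
  have he1 : e ≤ 1 := Real.exp_le_one_iff.2 (by rw [neg_nonpos]; positivity)
  have he0 : 0 < e := Real.exp_pos _
  have h3 := mul_le_mul_of_nonneg_left (hlow (ξ + w.re • η)) he0.le
  have h4 : e * C ≤ C := mul_le_of_le_one_left hC he1
  linarith

variable [FiniteDimensional ℝ E] [Nontrivial E]

/-- The integral is entire in `w`, and a real increment of `w` only translates the variable `ξ`.
Hence it is constant, and the frequency may be shifted by `iη`. -/
theorem integral_shiftedInversionIntegrand_eq {c C α : ℝ} (hh : 0 < h) (hC : 0 ≤ C) (hc : 0 < c)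
    (hα : 0 < α)
    (hσ : Integrable (fun y => ‖y‖ ^ 2) σ) (hσh : ∀ᵐ y ∂σ, ‖y‖ ≤ h)
    (hlow : ∀ ξ : E, c * (h * ‖ξ‖) ^ α - C ≤ ∫ y, (1 - Real.cos ⟪ξ, y⟫) ∂σ) (x η : E) (w z : ℂ) :
    ∫ ξ, shiftedInversionIntegrand σ x η w ξ = ∫ ξ, shiftedInversionIntegrand σ x η z ξ := by
  refine Differentiable.const_of_real_periodic
    (f := fun w => ∫ ξ, shiftedInversionIntegrand σ x η w ξ) ?_ (fun w a => ?_) w z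
  · refine differentiable_integral_of_locally_dominated (Eventually.of_forall fun ξ => ?_)
      (fun w => ?_) fun w₀ => ?_
    · refine Differentiable.cexp (Differentiable.add (by fun_prop) ?_)
      exact differentiable_shiftedExponent hσ hσh ξ η
    · refine Continuous.aestronglyMeasurable (Complex.continuous_exp.comp (Continuous.add
        (by fun_prop) (continuous_shiftedExponent hσ hσh η w)))
    · set K := ‖w₀‖ + 2 with hK
      have hK0 : 0 ≤ K := by positivity
      set V := ∫ y, ‖y‖ ^ 2 ∂σ with hV
      have hV0 : 0 ≤ V := integral_nonneg fun y => by positivity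
      set k := Real.exp (-(K * ‖η‖ * h)) * c * h ^ α with hk
      have hk0 : 0 < k := by positivity
      refine ⟨fun ξ => Real.exp (K * (‖η‖ * ‖x‖) + C
          + (K * ‖η‖) ^ 2 * Real.exp (K * ‖η‖ * h) * V) * (Real.exp (k * (K * ‖η‖) ^ α)
            * Real.exp (-(k / 2 ^ α) * ‖ξ‖ ^ α)),
        ((integrable_exp_neg_mul_norm_rpow (by positivity) hα).const_mul _).const_mul _,
        Eventually.of_forall fun ξ w hw => ?_⟩
      have hwK : ‖w‖ ≤ K := by
        rw [mem_ball_iff_norm] at hw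
        linarith [norm_le_norm_add_norm_sub' w w₀]
      have hwi : |w.im| ≤ K := (Complex.abs_im_le_norm w).trans hwK
      have hwr : |w.re| ≤ K := (Complex.abs_re_le_norm w).trans hwK
      refine (norm_shiftedInversionIntegrand_le hh.le hC hσ hσh hlow x η ξ w).trans ?_
      refine mul_le_mul ?_ ?_ (Real.exp_pos _).le (Real.exp_pos _).le
      · refine Real.exp_le_exp.2 ?_
        have : w.im * ⟪η, x⟫ ≤ K * (‖η‖ * ‖x‖) := by
          refine (le_abs_self _).trans ?_
          rw [abs_mul]
          gcongr
          exact abs_real_inner_le_norm _ _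
        gcongr
      · rw [← Real.exp_add]
        refine Real.exp_le_exp.2 ?_
        have h1 : ‖ξ‖ ≤ ‖ξ + w.re • η‖ + K * ‖η‖ := by
          calc ‖ξ‖ = ‖(ξ + w.re • η) - w.re • η‖ := by rw [add_sub_cancel_right]
            _ ≤ ‖ξ + w.re • η‖ + ‖w.re • η‖ := norm_sub_le _ _
            _ ≤ _ := by rw [norm_smul, Real.norm_eq_abs]; gcongr
        -- Since `‖ξ‖` is at most twice the larger of the two norms, this holds for every `α > 0`.
        -- It trades the moving centre of the stretched exponential for a fixed one, as a dominating
        -- function requires.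
        have h2 : ‖ξ‖ ^ α ≤ 2 ^ α * (‖ξ + w.re • η‖ ^ α + (K * ‖η‖) ^ α) := by
          rcases le_total (‖ξ + w.re • η‖) (K * ‖η‖) with h3 | h3
          · calc ‖ξ‖ ^ α ≤ (2 * (K * ‖η‖)) ^ α := by gcongr; linarith
              _ = 2 ^ α * (K * ‖η‖) ^ α := Real.mul_rpow (by positivity) (by positivity)
              _ ≤ _ := by
                gcongr
                exact le_add_of_nonneg_left (by positivity)
          · calc ‖ξ‖ ^ α ≤ (2 * ‖ξ + w.re • η‖) ^ α := by gcongr; linarith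
              _ = 2 ^ α * ‖ξ + w.re • η‖ ^ α := Real.mul_rpow (by positivity) (by positivity)
              _ ≤ _ := by
                gcongr
                exact le_add_of_nonneg_right (by positivity)
        have h3 : k * ‖ξ + w.re • η‖ ^ α
            ≤ Real.exp (-(|w.im| * ‖η‖ * h)) * (c * (h * ‖ξ + w.re • η‖) ^ α) := by
          rw [Real.mul_rpow hh.le (norm_nonneg _), hk]
          have : Real.exp (-(K * ‖η‖ * h)) ≤ Real.exp (-(|w.im| * ‖η‖ * h)) := by gcongr
          calc _ = Real.exp (-(K * ‖η‖ * h)) * (c * (h ^ α * ‖ξ + w.re • η‖ ^ α)) := by ring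
            _ ≤ _ := by gcongr
        have h4 : k / 2 ^ α * ‖ξ‖ ^ α ≤ k * (‖ξ + w.re • η‖ ^ α + (K * ‖η‖) ^ α) := by
          rw [div_mul_eq_mul_div, div_le_iff₀ (by positivity)]
          nlinarith
        linarith
  · simp only [shiftedInversionIntegrand_add_real]
    exact integral_add_right_eq_self _ (a • η)

/-- A shift by `i` along `η`, opposite to `x`, makes the plane wave contribute `e^{-s‖x‖/h}`; the
remaining factors are its cost. The parameter `s` stays free and is optimized later. -/
theorem norm_integral_shiftedInversionIntegrand_le {c C A α : ℝ} (hh : 0 < h) (hC : 0 ≤ C)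
    (hc : 0 < c) (hα : 0 < α)
    (hσ : Integrable (fun y => ‖y‖ ^ 2) σ) (hσh : ∀ᵐ y ∂σ, ‖y‖ ≤ h)
    (hσA : ∫ y, ‖y‖ ^ 2 ∂σ ≤ A * h ^ 2)
    (hlow : ∀ ξ : E, c * (h * ‖ξ‖) ^ α - C ≤ ∫ y, (1 - Real.cos ⟪ξ, y⟫) ∂σ) (x : E) {s : ℝ}
    (hs : 0 ≤ s) :
    ‖∫ ξ, shiftedInversionIntegrand σ x 0 0 ξ‖
      ≤ Real.exp (-(s * (‖x‖ / h)) + C + A * (s ^ 2 * Real.exp s))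
        * (Real.exp (s * Module.finrank ℝ E / α) * (h ^ Module.finrank ℝ E)⁻¹
          * ∫ ξ : E, Real.exp (-c * ‖ξ‖ ^ α)) := by
  have hA : 0 ≤ A * h ^ 2 := le_trans (integral_nonneg fun y => by positivity) hσA
  have hA0 : 0 ≤ A := nonneg_of_mul_nonneg_left hA (by positivity)
  -- Normalized so that `‖η‖ h = s` for `x ≠ 0`. For `x = 0` the vector is zero, which is why only
  -- `‖η‖ h ≤ s` is claimed next.
  set η : E := (-(s / (‖x‖ * h))) • x with hη
  have hηn : ‖η‖ * h ≤ s := by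
    rw [hη, norm_smul, norm_neg, Real.norm_of_nonneg (by positivity)]
    rcases eq_or_ne ‖x‖ 0 with h0 | h0
    · simpa [h0] using hs
    · refine le_of_eq ?_; field_simp
  have hηx : ⟪η, x⟫ = -(s * (‖x‖ / h)) := by
    rw [hη, real_inner_smul_left, real_inner_self_eq_norm_sq]
    rcases eq_or_ne ‖x‖ 0 with h0 | h0
    · simp [h0]
    · field_simp
  have e0 : ∫ ξ, shiftedInversionIntegrand σ x 0 0 ξ
      = ∫ ξ, shiftedInversionIntegrand σ x η 0 ξ := by
    congr 1; ext ξ; simp [shiftedInversionIntegrand, shiftedExponent]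
  rw [e0, integral_shiftedInversionIntegrand_eq hh hC hc hα hσ hσh hlow x η 0 Complex.I,
    ← integral_exp_neg_mul_norm_smul_rpow hα hh, ← integral_const_mul]
  refine norm_integral_le_of_norm_le ?_ (Eventually.of_forall fun ξ => ?_)
  · refine Integrable.const_mul ?_ _
    have := integrable_exp_neg_mul_norm_rpow (E := E) (k := Real.exp (-s) * (c * h ^ α))
      (by positivity) hα
    refine this.congr (Eventually.of_forall fun ξ => ?_)
    simp only
    rw [Real.mul_rpow hh.le (norm_nonneg _)]
    ring_nf
  · refine (norm_shiftedInversionIntegrand_le hh.le hC hσ hσh hlow x η ξ Complex.I).trans ?_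
    simp only [Complex.I_im, Complex.I_re, abs_one, one_mul, zero_smul, add_zero]
    have h1 : ‖η‖ ^ 2 * Real.exp (‖η‖ * h) * ∫ y, ‖y‖ ^ 2 ∂σ ≤ A * (s ^ 2 * Real.exp s) := by
      calc ‖η‖ ^ 2 * Real.exp (‖η‖ * h) * ∫ y, ‖y‖ ^ 2 ∂σ
          ≤ ‖η‖ ^ 2 * Real.exp (‖η‖ * h) * (A * h ^ 2) := by gcongr
        _ = A * ((‖η‖ * h) ^ 2 * Real.exp (‖η‖ * h)) := by ring
        _ ≤ _ := by gcongr
    rw [hηx]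
    gcongr

theorem integrable_shiftedInversionIntegrand {c C α : ℝ} (hh : 0 < h) (hC : 0 ≤ C)
    (hc : 0 < c) (hα : 0 < α)
    (hσ : Integrable (fun y => ‖y‖ ^ 2) σ) (hσh : ∀ᵐ y ∂σ, ‖y‖ ≤ h)
    (hlow : ∀ ξ : E, c * (h * ‖ξ‖) ^ α - C ≤ ∫ y, (1 - Real.cos ⟪ξ, y⟫) ∂σ) (x : E) :
    Integrable (shiftedInversionIntegrand σ x 0 0) := by
  refine ((integrable_exp_neg_mul_norm_rpow (E := E) (k := c * h ^ α) (by positivity)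
    hα).const_mul (Real.exp C)).mono' (Continuous.aestronglyMeasurable
      (Complex.continuous_exp.comp (Continuous.add (by fun_prop)
        (continuous_shiftedExponent hσ hσh 0 0)))) (Eventually.of_forall fun ξ => ?_)
  refine (norm_shiftedInversionIntegrand_le hh.le hC hσ hσh hlow x 0 ξ 0).trans ?_
  simp [Real.mul_rpow hh.le (norm_nonneg _), mul_assoc]

end SmallJumps

/-! ### Convolution powers and compound Poisson laws. -/

section ConvolutionPowers

open Filter Topology

variable {E : Type*} [NormedAddCommGroup E] [InnerProductSpace ℝ E] [FiniteDimensional ℝ E]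
  [MeasurableSpace E] [BorelSpace E]

/-- The convolution powers of a measure. -/
noncomputable def convPow (τ : Measure E) : ℕ → Measure E
  | 0 => Measure.dirac 0
  | n + 1 => τ.conv (convPow τ n)

instance isFiniteMeasure_convPow (τ : Measure E) [IsFiniteMeasure τ] (n : ℕ) :
    IsFiniteMeasure (convPow τ n) := by
  induction n with
  | zero => unfold convPow; infer_instance
  | succ n ih => unfold convPow; infer_instance

theorem convPow_univ (τ : Measure E) [IsFiniteMeasure τ] (n : ℕ) :
    convPow τ n univ = τ univ ^ n := by
  induction n with
  | zero => simp [convPow]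
  | succ n ih =>
    rw [convPow, ← setLIntegral_one, Measure.restrict_univ,
      Measure.lintegral_conv measurable_const]
    simp [ih, pow_succ]

theorem charFun_convPow (τ : Measure E) [IsFiniteMeasure τ] (n : ℕ) (ξ : E) :
    charFun (convPow τ n) ξ = charFun τ ξ ^ n := by
  induction n with
  | zero => simp [convPow, charFun_dirac]
  | succ n ih => rw [convPow, charFun_conv, ih, pow_succ, mul_comm]

/-- The compound Poisson distribution with jump measure `τ`. -/
noncomputable def compoundPoisson (τ : Measure E) : Measure E :=
  Measure.sum fun n : ℕ =>
    ENNReal.ofReal (Real.exp (-τ.real univ) / n.factorial) • convPow τ n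

instance isProbabilityMeasure_compoundPoisson (τ : Measure E) [IsFiniteMeasure τ] :
    IsProbabilityMeasure (compoundPoisson τ) := by
  refine ⟨?_⟩
  rw [compoundPoisson, Measure.sum_apply _ MeasurableSet.univ]
  have h1 : ∀ n : ℕ, (ENNReal.ofReal (Real.exp (-τ.real univ) / n.factorial) • convPow τ n) univ
      = ENNReal.ofReal (Real.exp (-τ.real univ) * (τ.real univ ^ n / n.factorial)) := by
    intro n
    rw [Measure.smul_apply, convPow_univ, smul_eq_mul, ← ofReal_measureReal (s := univ) (μ := τ),
      ← ENNReal.ofReal_pow measureReal_nonneg, ← ENNReal.ofReal_mul (by positivity)]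
    congr 1; ring
  have h2 : HasSum (fun n : ℕ => Real.exp (-τ.real univ) * (τ.real univ ^ n / n.factorial)) 1 := by
    have := (NormedSpace.expSeries_div_hasSum_exp (τ.real univ)).mul_left
      (Real.exp (-τ.real univ))
    rwa [← Real.exp_eq_exp_ℝ, ← Real.exp_add, neg_add_cancel, Real.exp_zero] at this
  simp_rw [h1]
  rw [← ENNReal.ofReal_tsum_of_nonneg (fun n => by positivity) h2.summable, h2.tsum_eq,
    ENNReal.ofReal_one]

theorem charFun_compoundPoisson (τ : Measure E) [IsFiniteMeasure τ] (ξ : E) :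
    charFun (compoundPoisson τ) ξ = Complex.exp (charFun τ ξ - τ.real univ) := by
  have hint : Integrable (fun x => Complex.exp (⟪x, ξ⟫ * Complex.I)) (compoundPoisson τ) := by
    refine (integrable_const (1 : ℝ)).mono' (Continuous.aestronglyMeasurable (by fun_prop))
      (Eventually.of_forall fun x => ?_)
    rw [Complex.norm_exp_ofReal_mul_I]
  have h1 := hasSum_integral_measure hint
  have h2 : HasSum (fun n : ℕ => Complex.exp (-τ.real univ) * (charFun τ ξ ^ n / n.factorial))
      (Complex.exp (charFun τ ξ - τ.real univ)) := by
    have := (NormedSpace.expSeries_div_hasSum_exp (charFun τ ξ)).mul_left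
      (Complex.exp (-τ.real univ))
    rwa [← Complex.exp_eq_exp_ℂ, ← Complex.exp_add, neg_add_eq_sub] at this
  refine h1.unique (h2.congr_fun fun n => ?_)
  rw [integral_smul_measure, ← charFun_apply, charFun_convPow,
    ENNReal.toReal_ofReal (by positivity), Complex.real_smul]
  push_cast
  ring

/-- Each convolution merges two weights at the cost of one factor `κ`, leaving a single weight at
the sum. The constant `C₀` serves the point mass at the origin, where there is no weight to merge.
-/
theorem lintegral_convPow_le_of_submultiplicative {τ Λ : Measure E} [IsFiniteMeasure τ]
    [IsFiniteMeasure Λ] {w : E → ℝ≥0∞} (hw : Measurable w) {κ C₀ : ℝ≥0∞}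
    (hτ : ∀ F : E → ℝ≥0∞, Measurable F → ∫⁻ y, F y ∂τ ≤ ∫⁻ y, F y * w y ∂Λ)
    (hκ : ∀ a b, w a * w b ≤ κ * w (a + b)) (h0 : 1 ≤ C₀ * w 0) (n : ℕ) {F : E → ℝ≥0∞}
    (hF : Measurable F) :
    ∫⁻ y, F y ∂convPow τ n ≤ C₀ * κ ^ n * ∫⁻ y, F y * w y ∂convPow Λ n := by
  have hFw : Measurable fun y => F y * w y := hF.mul hw
  induction n generalizing F with
  | zero =>
    simp only [convPow, pow_zero, mul_one]
    rw [lintegral_dirac' _ hF, lintegral_dirac' _ hFw]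
    calc F 0 = 1 * F 0 := (one_mul _).symm
      _ ≤ C₀ * w 0 * F 0 := by gcongr
      _ = _ := by ring
  | succ n ih =>
    simp only [convPow]
    rw [Measure.lintegral_conv hF, Measure.lintegral_conv hFw]
    calc ∫⁻ x, ∫⁻ y, F (x + y) ∂convPow τ n ∂τ
        ≤ ∫⁻ x, C₀ * κ ^ n * ∫⁻ y, F (x + y) * w y ∂convPow Λ n ∂τ :=
          lintegral_mono fun x => ih (F := fun y => F (x + y)) (by fun_prop) (by fun_prop)
      _ ≤ ∫⁻ x, (C₀ * κ ^ n * ∫⁻ y, F (x + y) * w y ∂convPow Λ n) * w x ∂Λ := by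
          refine hτ _ (Measurable.const_mul ?_ _)
          exact Measurable.lintegral_prod_right' (f := fun p : E × E => F (p.1 + p.2) * w p.2)
            (by fun_prop)
      _ ≤ ∫⁻ x, C₀ * κ ^ (n + 1) * ∫⁻ y, F (x + y) * w (x + y) ∂convPow Λ n ∂Λ := by
          refine lintegral_mono fun x => ?_
          calc (C₀ * κ ^ n * ∫⁻ y, F (x + y) * w y ∂convPow Λ n) * w x
              = C₀ * κ ^ n * ∫⁻ y, F (x + y) * w y * w x ∂convPow Λ n := by
                rw [lintegral_mul_const _ (by fun_prop), mul_assoc]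
            _ ≤ C₀ * κ ^ n * ∫⁻ y, κ * (F (x + y) * w (x + y)) ∂convPow Λ n := by
                refine mul_le_mul_right (lintegral_mono fun y => ?_) _
                calc F (x + y) * w y * w x = F (x + y) * (w x * w y) := by ring
                  _ ≤ F (x + y) * (κ * w (x + y)) := mul_le_mul_right (hκ x y) _
                  _ = κ * (F (x + y) * w (x + y)) := by ring
            _ = _ := by
                rw [lintegral_const_mul _ (by fun_prop), pow_succ]
                ring
      _ = _ := by
          rw [lintegral_const_mul]
          exact Measurable.lintegral_prod_right'
            (f := fun p : E × E => F (p.1 + p.2) * w (p.1 + p.2)) (by fun_prop)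

/-- If `‖x + y‖ ≥ a`, one summand has norm at least `a/2`, and given the other it lies in a
translated ball of the same radius `r`. The large summand is controlled by `G` or by induction, the
other by total mass. The factor `L` on the left supplies the missing mass factor, so that the power
on the right is exactly `n`. -/
theorem convPow_annulus_ball_le {Λ : Measure E} [IsFiniteMeasure Λ] {L D : ℝ≥0∞}
    {r : ℝ} {G : ℝ → ℝ≥0∞} (hL : Λ univ ≤ L) (hD : 1 ≤ D)
    (hG : ∀ a u, 0 < a → Λ ({y | a ≤ ‖y‖} ∩ ball u r) ≤ G a)
    (hGD : ∀ a, 0 < a → G (a / 2) ≤ D * G a) (n : ℕ) {a : ℝ} (ha : 0 < a) (u : E) :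
    L * convPow Λ n ({y | a ≤ ‖y‖} ∩ ball u r) ≤ (2 * D * L) ^ n * G a := by
  have hms : ∀ (a : ℝ) (u : E), MeasurableSet ({y : E | a ≤ ‖y‖} ∩ ball u r) := fun a u =>
    (measurableSet_le measurable_const measurable_norm).inter measurableSet_ball
  induction n generalizing a u with
  | zero =>
    have : convPow Λ 0 ({y | a ≤ ‖y‖} ∩ ball u r) = 0 := by
      rw [convPow, Measure.dirac_apply' _ (hms a u), indicator_of_notMem]
      simp [ha]
    simp [this]
  | succ n ih =>
    set S : ℝ → E → Set E := fun a u => {y : E | a ≤ ‖y‖} ∩ ball u r with hS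
    have hLn : convPow Λ n univ ≤ L ^ n := by
      rw [convPow_univ]; gcongr
    have hsplit : ∀ x y : E, (S a u).indicator (1 : E → ℝ≥0∞) (x + y)
        ≤ (S (a / 2) (u - y)).indicator 1 x + (S (a / 2) (u - x)).indicator 1 y := by
      intro x y
      by_cases h : x + y ∈ S a u
      · have hmem := h
        obtain ⟨h1, h2⟩ := h
        simp only [mem_ofPred_eq] at h1
        have h3 := h1.trans (norm_add_le x y)
        rw [mem_ball_iff_norm] at h2
        rcases le_total (a / 2) ‖x‖ with hx | hx
        · have : x ∈ S (a / 2) (u - y) :=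
            ⟨hx, by rw [mem_ball_iff_norm, ← sub_add, ← add_sub_right_comm]; exact h2⟩
          rw [indicator_of_mem this, indicator_of_mem hmem]
          exact le_self_add
        · have : y ∈ S (a / 2) (u - x) :=
            ⟨show a / 2 ≤ ‖y‖ by linarith, by
              rw [mem_ball_iff_norm, ← sub_add, ← add_sub_right_comm, add_comm]; exact h2⟩
          rw [indicator_of_mem this, indicator_of_mem hmem]
          exact le_add_self
      · rw [indicator_of_notMem h]; exact zero_le
    have hmeas : ∀ a, Measurable fun p : E × E => (S a (u - p.2)).indicator (1 : E → ℝ≥0∞) p.1 := by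
      intro a
      have : MeasurableSet {p : E × E | p.1 ∈ S a (u - p.2)} := by
        simp only [hS, mem_inter_iff, mem_ofPred_eq, mem_ball]
        exact (measurableSet_le (g := fun p : E × E => ‖p.1‖) measurable_const
          (by fun_prop)).inter
          (measurableSet_lt (f := fun p : E × E => dist p.1 (u - p.2)) (by fun_prop)
            measurable_const)
      exact measurable_one.indicator this
    have hmeas' : Measurable fun p : E × E =>
        (S (a / 2) (u - p.1)).indicator (1 : E → ℝ≥0∞) p.2 :=
      (hmeas (a / 2)).comp measurable_swap
    have hA : ∫⁻ x, ∫⁻ y, (S (a / 2) (u - y)).indicator 1 x ∂convPow Λ n ∂Λ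
        ≤ L ^ n * (D * G a) := by
      rw [lintegral_lintegral_swap (hmeas (a / 2)).aemeasurable]
      calc ∫⁻ y, ∫⁻ x, (S (a / 2) (u - y)).indicator 1 x ∂Λ ∂convPow Λ n
          ≤ ∫⁻ _, D * G a ∂convPow Λ n := by
            refine lintegral_mono fun y => ?_
            rw [lintegral_indicator_one (hms _ _)]
            exact (hG _ _ (half_pos ha)).trans (hGD a ha)
        _ = D * G a * convPow Λ n univ := by simp
        _ ≤ D * G a * L ^ n := by gcongr
        _ = _ := mul_comm _ _
    have hB : L * ∫⁻ x, ∫⁻ y, (S (a / 2) (u - x)).indicator 1 y ∂convPow Λ n ∂Λ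
        ≤ (2 * D * L) ^ n * (D * G a) * L := by
      rw [← lintegral_const_mul _ (Measurable.lintegral_prod_right' hmeas')]
      calc ∫⁻ x, L * ∫⁻ y, (S (a / 2) (u - x)).indicator 1 y ∂convPow Λ n ∂Λ
          ≤ ∫⁻ _, (2 * D * L) ^ n * (D * G a) ∂Λ := by
            refine lintegral_mono fun x => ?_
            rw [lintegral_indicator_one (hms _ _)]
            refine (ih (half_pos ha) _).trans ?_
            gcongr
            exact hGD a ha
        _ = (2 * D * L) ^ n * (D * G a) * Λ univ := by simp
        _ ≤ _ := by gcongr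
    have hLD : L ^ n ≤ (2 * D * L) ^ n := by
      gcongr
      calc L = 1 * 1 * L := by simp
        _ ≤ 2 * D * L := by gcongr; norm_num
    calc L * convPow Λ (n + 1) (S a u)
        = L * ∫⁻ x, ∫⁻ y, (S a u).indicator 1 (x + y) ∂convPow Λ n ∂Λ := by
          rw [← lintegral_indicator_one (hms a u), convPow,
            Measure.lintegral_conv (measurable_one.indicator (hms a u))]
      _ ≤ L * ∫⁻ x, ∫⁻ y, ((S (a / 2) (u - y)).indicator 1 x
            + (S (a / 2) (u - x)).indicator 1 y) ∂convPow Λ n ∂Λ := by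
          gcongr with x y
          exact hsplit x y
      _ = L * (∫⁻ x, ∫⁻ y, (S (a / 2) (u - y)).indicator 1 x ∂convPow Λ n ∂Λ
            + ∫⁻ x, ∫⁻ y, (S (a / 2) (u - x)).indicator 1 y ∂convPow Λ n ∂Λ) := by
          rw [← lintegral_add_left (Measurable.lintegral_prod_right' (hmeas (a / 2)))]
          congr 1
          refine lintegral_congr fun x => ?_
          exact lintegral_add_left ((hmeas (a / 2)).comp measurable_prodMk_left) _
      _ ≤ L * (L ^ n * (D * G a)) + (2 * D * L) ^ n * (D * G a) * L := by
          rw [mul_add]; gcongr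
      _ ≤ L * ((2 * D * L) ^ n * (D * G a)) + (2 * D * L) ^ n * (D * G a) * L := by gcongr
      _ = _ := by rw [pow_succ]; ring

/-- With `k = ⌊‖x - y‖/h⌋`, the point `y` lies in the ball of radius `(k+1)h` about `x`, and
monotonicity bounds the profile there by `g k`. -/
theorem lintegral_radial_le_tsum {X : Type*} [NormedAddCommGroup X] [MeasurableSpace X]
    [BorelSpace X] (M : Measure X) {g : ℝ → ℝ≥0∞} (hg : AntitoneOn g (Ici 0))
    {h : ℝ} (hh : 0 < h) {S : Set X} (x : X) :
    ∫⁻ y in S, g (‖x - y‖ / h) ∂M ≤ ∑' k : ℕ, g k * M (S ∩ ball x ((k + 1) * h)) := by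
  calc ∫⁻ y in S, g (‖x - y‖ / h) ∂M
      ≤ ∫⁻ y in S, ∑' k : ℕ, (ball x (((k : ℝ) + 1) * h)).indicator (fun _ => g k) y ∂M := by
        refine lintegral_mono fun y => ?_
        have h0 : 0 ≤ ‖x - y‖ / h := by positivity
        set k := ⌊‖x - y‖ / h⌋₊ with hk
        have h1 : (k : ℝ) ≤ ‖x - y‖ / h := Nat.floor_le h0
        have h2 : ‖x - y‖ / h < k + 1 := Nat.lt_floor_add_one _
        have h3 : y ∈ ball x (((k : ℝ) + 1) * h) := by
          rw [mem_ball, dist_comm, dist_eq_norm]; exact (div_lt_iff₀ hh).1 h2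
        refine le_trans ?_ (ENNReal.le_tsum k)
        rw [indicator_of_mem h3]
        exact hg (mem_Ici.2 (Nat.cast_nonneg k)) (mem_Ici.2 h0) h1
    _ = ∑' k : ℕ, ∫⁻ y in S, (ball x (((k : ℝ) + 1) * h)).indicator (fun _ => g k) y ∂M :=
        lintegral_tsum fun k => (measurable_const.indicator measurableSet_ball).aemeasurable
    _ = _ := by
        refine tsum_congr fun k => ?_
        rw [lintegral_indicator_const measurableSet_ball, Measure.restrict_apply measurableSet_ball,
          inter_comm]

/-- Convolution of a radially decreasing profile with a compound Poisson law whose jump measure is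
dominated by a submultiplicative weight times a measure with small local mass. -/
theorem lintegral_compoundPoisson_le {τ Λ : Measure E} [IsFiniteMeasure τ]
    [IsFiniteMeasure Λ] {ω : ℝ → ℝ≥0∞} (hω : AntitoneOn ω (Ici 0))
    (hωm : Measurable fun y : E => ω ‖y‖) {κ C₀ L D : ℝ≥0∞}
    (hτ : ∀ F : E → ℝ≥0∞, Measurable F → ∫⁻ y, F y ∂τ ≤ ∫⁻ y, F y * ω ‖y‖ ∂Λ)
    (hκ : ∀ a b, 0 ≤ a → 0 ≤ b → ω a * ω b ≤ κ * ω (a + b)) (h0 : 1 ≤ C₀ * ω 0)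
    {g : ℝ → ℝ≥0∞} (hg : AntitoneOn g (Ici 0)) (hgm : Measurable g)
    {h : ℝ} (hh : 0 < h) {G : ℝ → ℝ → ℝ≥0∞} (hL : Λ univ ≤ L) (hL0 : L ≠ 0) (hLt : L ≠ ∞)
    (hD : 1 ≤ D)
    (hG : ∀ r a u, 0 < r → 0 < a → Λ ({y | a ≤ ‖y‖} ∩ ball u r) ≤ G r a)
    (hGD : ∀ r a, 0 < r → 0 < a → G r (a / 2) ≤ D * G r a) {x : E} (hx : x ≠ 0) :
    ∫⁻ y, g (‖x - y‖ / h) ∂compoundPoisson τ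
      ≤ g (‖x‖ / (2 * h)) + C₀ * L⁻¹ * ω (‖x‖ / 2)
        * (∑' n : ℕ, ENNReal.ofReal (1 / n.factorial) * (κ * (2 * D * L)) ^ n)
        * ∑' k : ℕ, g k * G ((k + 1) * h) (‖x‖ / 2) := by
  set a := ‖x‖ / 2 with ha
  have ha0 : 0 < a := half_pos (norm_pos_iff.2 hx)
  set S : Set E := {y | a ≤ ‖y‖} with hS
  have hSm : MeasurableSet S := measurableSet_le measurable_const measurable_norm
  have hgx : Measurable fun y => g (‖x - y‖ / h) := by fun_prop
  set T := ∑' k : ℕ, g k * G ((k + 1) * h) a with hT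
  have hfar : ∀ n, ∫⁻ y in S, g (‖x - y‖ / h) ∂convPow Λ n ≤ L⁻¹ * (2 * D * L) ^ n * T := by
    intro n
    refine (lintegral_radial_le_tsum _ hg hh x).trans ?_
    rw [hT, ← ENNReal.tsum_mul_left]
    refine ENNReal.tsum_le_tsum fun k => ?_
    have hr : 0 < ((k : ℝ) + 1) * h := by positivity
    have := convPow_annulus_ball_le hL hD (fun a u ha => hG _ a u hr ha)
      (fun a ha => hGD _ a hr ha) n ha0 x
    calc g k * convPow Λ n (S ∩ ball x ((k + 1) * h))
        = g k * (L⁻¹ * (L * convPow Λ n (S ∩ ball x ((k + 1) * h)))) := by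
          rw [← mul_assoc L⁻¹, ENNReal.inv_mul_cancel hL0 hLt, one_mul]
      _ ≤ g k * (L⁻¹ * ((2 * D * L) ^ n * G ((k + 1) * h) a)) := by gcongr
      _ = _ := by ring
  have hfarτ : ∀ n, ∫⁻ y in S, g (‖x - y‖ / h) ∂convPow τ n
      ≤ C₀ * L⁻¹ * ω a * (κ * (2 * D * L)) ^ n * T := by
    intro n
    rw [← lintegral_indicator hSm]
    refine (lintegral_convPow_le_of_submultiplicative (κ := κ) hωm hτ (fun b c => ?_) (by simpa using h0) n
      (hgx.indicator hSm)).trans ?_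
    · refine (hκ _ _ (norm_nonneg b) (norm_nonneg c)).trans ?_
      gcongr
      exact hω (norm_nonneg _) (mem_Ici.2 (by positivity)) (norm_add_le b c)
    · calc C₀ * κ ^ n * ∫⁻ y, S.indicator (fun y => g (‖x - y‖ / h)) y * ω ‖y‖ ∂convPow Λ n
          ≤ C₀ * κ ^ n * ∫⁻ y, S.indicator (fun y => g (‖x - y‖ / h)) y * ω a ∂convPow Λ n := by
            refine mul_le_mul_right (lintegral_mono fun y => ?_) _
            by_cases hy : y ∈ S
            · exact mul_le_mul_right (hω ha0.le (norm_nonneg y) hy) _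
            · simp [indicator_of_notMem hy]
        _ = C₀ * κ ^ n * ((∫⁻ y in S, g (‖x - y‖ / h) ∂convPow Λ n) * ω a) := by
            rw [lintegral_mul_const _ (hgx.indicator hSm), lintegral_indicator hSm]
        _ ≤ C₀ * κ ^ n * ((L⁻¹ * (2 * D * L) ^ n * T) * ω a) := by gcongr; exact hfar n
        _ = _ := by rw [mul_pow κ]; ring
  -- Inside `‖y‖ < ‖x‖/2` the distance to `x` exceeds `‖x‖/2`, so the profile alone is small.
  -- Outside, the weighted convolution powers are summed against `1/n!`, the factor `e^{-τ(E)}`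
  -- being bounded by one.
  rw [← lintegral_add_compl _ hSm, add_comm]
  refine add_le_add ?_ ?_
  · calc ∫⁻ y in Sᶜ, g (‖x - y‖ / h) ∂compoundPoisson τ
        ≤ ∫⁻ _ in Sᶜ, g (‖x‖ / (2 * h)) ∂compoundPoisson τ := by
          refine setLIntegral_mono' hSm.compl fun y hy => ?_
          simp only [hS, mem_compl_iff, mem_ofPred_eq, not_le] at hy
          refine hg (mem_Ici.2 (by positivity)) (mem_Ici.2 (by positivity)) ?_
          rw [← div_div]
          gcongr
          linarith [norm_sub_norm_le x y]
      _ ≤ ∫⁻ _, g (‖x‖ / (2 * h)) ∂compoundPoisson τ := setLIntegral_le_lintegral _ _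
      _ = _ := by simp
  · rw [compoundPoisson, Measure.restrict_sum _ hSm, lintegral_sum_measure,
      ← ENNReal.tsum_mul_left (a := C₀ * L⁻¹ * ω a), ← ENNReal.tsum_mul_right (a := T)]
    refine ENNReal.tsum_le_tsum fun n => ?_
    rw [Measure.restrict_smul, lintegral_smul_measure, smul_eq_mul]
    calc _ ≤ ENNReal.ofReal (1 / n.factorial)
          * (C₀ * L⁻¹ * ω a * (κ * (2 * D * L)) ^ n * T) := by
          gcongr
          · exact Real.exp_le_one_iff.2 (neg_nonpos.2 measureReal_nonneg)
          · exact hfarτ n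
      _ = _ := by ring

end ConvolutionPowers

/-! ### Superexponential decay against exponential and polynomial factors. -/

section SuperexponentialDecay

/-- Once `log(1 + δR) ≥ k/ε` the left side is nonpositive; before that, `R` is at most `e^{k/ε}/δ`.
-/
theorem exists_linear_sub_mul_log_le {k ε δ : ℝ} (hk : 0 ≤ k) (hε : 0 < ε) (hδ : 0 < δ) :
    ∃ C, 0 ≤ C ∧ ∀ R, 0 ≤ R → -(ε * R * Real.log (1 + δ * R)) + k * R ≤ C := by
  refine ⟨k * (Real.exp (k / ε) / δ), by positivity, fun R hR => ?_⟩
  have h1 : 0 < 1 + δ * R := by positivity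
  have h2 : 0 ≤ Real.log (1 + δ * R) := Real.log_nonneg (by nlinarith [mul_nonneg hδ.le hR])
  rcases le_total (k / ε) (Real.log (1 + δ * R)) with h | h
  · rw [div_le_iff₀ hε] at h
    have : 0 ≤ k * (Real.exp (k / ε) / δ) := by positivity
    nlinarith
  · have h3 : 1 + δ * R ≤ Real.exp (k / ε) := (Real.log_le_iff_le_exp h1).1 h
    have h4 : R ≤ Real.exp (k / ε) / δ := by rw [le_div_iff₀ hδ]; linarith
    have h5 : k * R ≤ k * (Real.exp (k / ε) / δ) := by gcongr
    have : 0 ≤ ε * R * Real.log (1 + δ * R) := by positivity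
    linarith

/-- For `s = ½ log(1 + R)` the gain is `½ R log(1 + R)`, while `s² e^s ≤ 2e^{2s} = 2(1 + R)` and `s
≤ 1 + R` make the cost linear in `R`. Half of the gain absorbs it. -/
theorem exists_optimal_shift {A C k : ℝ} (hA : 0 ≤ A) (hk : 0 ≤ k) :
    ∃ B, ∀ R, 0 ≤ R → ∃ s, 0 ≤ s ∧
      -(s * R) + C + A * (s ^ 2 * Real.exp s) + s * k ≤ B - 1 / 4 * R * Real.log (1 + R) := by
  obtain ⟨D, -, hD⟩ := exists_linear_sub_mul_log_le (k := 2 * A + k) (ε := 1 / 4) (δ := 1)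
    (by positivity) (by norm_num) one_pos
  refine ⟨C + (2 * A + k) + D, fun R hR => ⟨1 / 2 * Real.log (1 + R), ?_, ?_⟩⟩
  · have := Real.log_nonneg (show (1 : ℝ) ≤ 1 + R by linarith)
    positivity
  · set s := 1 / 2 * Real.log (1 + R) with hs
    have hs0 : 0 ≤ s := by
      have := Real.log_nonneg (show (1 : ℝ) ≤ 1 + R by linarith)
      positivity
    have he : Real.exp (2 * s) = 1 + R := by
      rw [hs, show 2 * (1 / 2 * Real.log (1 + R)) = Real.log (1 + R) by ring,
        Real.exp_log (by linarith)]
    have h1 : s ^ 2 * Real.exp s ≤ 2 * (1 + R) := by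
      have h2 : s ^ 2 ≤ 2 * Real.exp s := by
        have := Real.quadratic_le_exp_of_nonneg hs0
        linarith
      calc s ^ 2 * Real.exp s ≤ 2 * Real.exp s * Real.exp s := by gcongr
        _ = 2 * Real.exp (2 * s) := by rw [two_mul s, Real.exp_add]; ring
        _ = _ := by rw [he]
    have h3 : s ≤ 1 + R := by
      have := Real.add_one_le_exp (2 * s)
      linarith
    have h4 := hD R hR
    rw [one_mul] at h4
    have h5 : s * R = 1 / 2 * R * Real.log (1 + R) := by rw [hs]; ring
    have h6 : A * (s ^ 2 * Real.exp s) ≤ A * (2 * (1 + R)) := by gcongr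
    have h7 : s * k ≤ (1 + R) * k := by gcongr
    rw [h5]
    linarith

theorem antitoneOn_exp_neg_mul_log {ε δ : ℝ} (hε : 0 ≤ ε) (hδ : 0 ≤ δ) :
    AntitoneOn (fun R => Real.exp (-(ε * R * Real.log (1 + δ * R)))) (Ici 0) := by
  intro a ha b hb hab
  simp only [mem_Ici] at ha hb
  have h1 : 0 ≤ Real.log (1 + δ * a) := Real.log_nonneg (by nlinarith [mul_nonneg hδ ha])
  simp only
  gcongr

theorem summable_exp_neg_mul_log_mul_rpow {ε δ : ℝ} (hε : 0 < ε) (hδ : 0 < δ) {γ : ℝ}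
    (hγ : 0 ≤ γ) :
    Summable fun k : ℕ => Real.exp (-(ε * k * Real.log (1 + δ * k))) * ((k : ℝ) + 1) ^ γ := by
  obtain ⟨C, -, hC⟩ := exists_linear_sub_mul_log_le (k := γ + 1) (by positivity) hε hδ
  refine Summable.of_nonneg_of_le (fun k => by positivity) (fun k => ?_)
    (Real.summable_exp_neg_nat.mul_left (Real.exp C))
  have h1 : ((k : ℝ) + 1) ^ γ ≤ Real.exp (γ * k) := by
    rw [mul_comm, Real.exp_mul]
    exact Real.rpow_le_rpow (by positivity) (Real.add_one_le_exp _) hγ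
  calc _ ≤ Real.exp (-(ε * k * Real.log (1 + δ * k))) * Real.exp (γ * k) := by gcongr
    _ ≤ Real.exp C * Real.exp (-k) := by
      rw [← Real.exp_add, ← Real.exp_add]
      refine Real.exp_le_exp.2 ?_
      linarith [hC k (Nat.cast_nonneg k)]

/-- Iteration gives `f n ≥ f(0) δ^n`. Monotonicity interpolates, and passing to the ceiling costs at
most one more factor `δ`, hence the constant `f(0) δ`. -/
theorem exists_exp_lower_bound {f : ℝ → ℝ} (hpos : ∀ s, 0 ≤ s → 0 < f s)
    (hanti : AntitoneOn f (Ici 0)) {δ : ℝ} (hδ : 0 < δ)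
    (hf : ∀ n : ℕ, δ * f n ≤ f ((n : ℝ) + 1)) :
    ∃ c k, 0 < c ∧ 0 ≤ k ∧ ∀ ρ, 0 ≤ ρ → c * Real.exp (-(k * ρ)) ≤ f ρ := by
  have hδ1 : δ ≤ 1 := by
    have h1 := hf 0
    have h2 : f ((0 : ℕ) + 1) ≤ f (0 : ℕ) :=
      hanti (by simp) (mem_Ici.2 (by positivity)) (by simp)
    have h3 := hpos (0 : ℕ) (by simp)
    by_contra! h
    nlinarith
  have hn : ∀ n : ℕ, f 0 * δ ^ n ≤ f n := by
    intro n
    induction n with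
    | zero => simp
    | succ n ih =>
      push_cast
      refine le_trans ?_ (hf n)
      rw [pow_succ]
      nlinarith
  refine ⟨f 0 * δ, -Real.log δ, mul_pos (hpos 0 le_rfl) hδ,
    neg_nonneg.2 (Real.log_nonpos hδ.le hδ1), fun ρ hρ => ?_⟩
  have h1 : f ⌈ρ⌉₊ ≤ f ρ := hanti hρ (mem_Ici.2 (Nat.cast_nonneg _)) (Nat.le_ceil ρ)
  refine le_trans ?_ ((hn _).trans h1)
  rw [mul_assoc]
  refine mul_le_mul_of_nonneg_left ?_ (hpos 0 le_rfl).le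
  rw [neg_mul, neg_neg, mul_comm (Real.log δ), mul_comm (δ : ℝ), ← Real.rpow_natCast δ]
  have h2 : Real.exp (ρ * Real.log δ) = δ ^ ρ := by
    rw [Real.rpow_def_of_pos hδ, mul_comm]
  rw [h2]
  calc δ ^ ρ * δ = δ ^ (ρ + 1) := by rw [Real.rpow_add hδ, Real.rpow_one]
    _ ≤ δ ^ (⌈ρ⌉₊ : ℝ) :=
      Real.rpow_le_rpow_of_exponent_ge hδ hδ1 (Nat.ceil_lt_add_one hρ).le

/-- Both `R^{-a} ≥ e^{-aR}` and `f(ρ) ≥ c e^{-kR}` decay only exponentially in `R`; the second uses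
`ρ ≤ R`. -/
theorem exists_exp_neg_mul_log_le_rpow_mul {f : ℝ → ℝ} {c k ε δ a : ℝ} (hc : 0 < c) (hk : 0 ≤ k)
    (hε : 0 < ε) (hδ : 0 < δ) (ha : 0 ≤ a)
    (hf : ∀ ρ, 0 ≤ ρ → c * Real.exp (-(k * ρ)) ≤ f ρ) :
    ∃ C, 0 < C ∧ ∀ R ρ, 0 < ρ → ρ ≤ R →
      Real.exp (-(ε * R * Real.log (1 + δ * R))) ≤ C * (R ^ (-a) * f ρ) := by
  obtain ⟨D, -, hD⟩ := exists_linear_sub_mul_log_le (k := k + a) (by positivity) hε hδ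
  refine ⟨Real.exp D / c, by positivity, fun R ρ hρ hR => ?_⟩
  have hR0 : 0 < R := hρ.trans_le hR
  have h1 : Real.exp (-(a * R)) ≤ R ^ (-a) := by
    rw [Real.rpow_def_of_pos hR0]
    refine Real.exp_le_exp.2 ?_
    have : Real.log R ≤ R := (Real.log_le_sub_one_of_pos hR0).trans (by linarith)
    nlinarith
  have h2 : c * Real.exp (-(k * R)) ≤ f ρ := by
    refine le_trans ?_ (hf ρ hρ.le)
    gcongr
  calc Real.exp (-(ε * R * Real.log (1 + δ * R)))
      ≤ Real.exp (D - (k + a) * R) := Real.exp_le_exp.2 (by linarith [hD R hR0.le])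
    _ = Real.exp D / c * (Real.exp (-(a * R)) * (c * Real.exp (-(k * R)))) := by
      rw [show D - (k + a) * R = D + -(a * R) + -(k * R) by ring, Real.exp_add, Real.exp_add]
      field_simp
    _ ≤ _ := by gcongr

end SuperexponentialDecay

/-! ### The density as a compound Poisson average. -/

section DensityRepresentation

open Filter Topology FourierTransform

variable {E : Type*} [NormedAddCommGroup E] [InnerProductSpace ℝ E] [FiniteDimensional ℝ E]
  [MeasurableSpace E] [BorelSpace E]

/-- The compound Poisson factor has modulus at most one, so integrability comes from the small
jumps. Expanding that factor and applying Fubini recentres the inversion integral at `x - y`. The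
small-jump law is never needed as a measure, only its inversion integral. -/
theorem exists_density_le_of_charFun_eq {P σ τ : Measure E} [IsProbabilityMeasure P]
    [IsFiniteMeasure τ] {m : E}
    (hcont : Continuous fun ξ => shiftedExponent σ ξ 0 0)
    (hint : ∀ x : E, Integrable (shiftedInversionIntegrand σ x 0 0))
    (hP : ∀ ξ, charFun P ξ = Complex.exp (Complex.I * (⟪ξ, m⟫ : ℝ))
      * (Complex.exp (shiftedExponent σ ξ 0 0) * charFun (compoundPoisson τ) ξ)) :
    ∃ p : E → ℝ, Continuous p ∧ (∀ x, 0 ≤ p x) ∧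
      P = volume.withDensity (fun x => ENNReal.ofReal (p x)) ∧
      ∀ x, ENNReal.ofReal (p (x + m)) ≤ ∫⁻ y, ENNReal.ofReal (((2 * Real.pi) ^
        Module.finrank ℝ E)⁻¹ * ‖∫ ξ, shiftedInversionIntegrand σ (x - y) 0 0 ξ‖)
          ∂compoundPoisson τ := by
  have hPi : Integrable (charFun P) := by
    refine (hint 0).norm.mono' ?_ (Eventually.of_forall fun ξ => ?_)
    · exact measurable_charFun.aestronglyMeasurable
    · rw [hP, norm_mul, norm_mul, mul_comm Complex.I, Complex.norm_exp_ofReal_mul_I, one_mul]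
      simp only [shiftedInversionIntegrand, inner_zero_right,
        Complex.ofReal_zero, mul_zero, add_zero, zero_add]
      exact mul_le_of_le_one_right (norm_nonneg _) (norm_charFun_le_one ξ)
  have hPi2 : Integrable fun v => charFun P ((2 * Real.pi) • v) :=
    hPi.comp_smul (by positivity)
  obtain ⟨p, hpc, hp0, hpF, hPp⟩ := withDensity_of_integrable_charFun P hPi2
  refine ⟨p, hpc, hp0, hPp, fun x => ?_⟩
  have h1 : (p (x + m) : ℂ) = (((2 * Real.pi) ^ Module.finrank ℝ E)⁻¹ : ℝ)
      • ∫ ξ, Complex.exp (-Complex.I * (⟪ξ, x + m⟫ : ℝ)) * charFun P ξ := by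
    rw [hpF, Real.fourier_eq']
    have := Measure.integral_comp_smul (volume : Measure E)
      (fun ξ => Complex.exp (-Complex.I * (⟪ξ, x + m⟫ : ℝ)) * charFun P ξ) (2 * Real.pi)
    rw [abs_of_pos (by positivity)] at this
    rw [← this]
    refine integral_congr_ae (Eventually.of_forall fun v => ?_)
    simp only [smul_eq_mul, inner_smul_left, RCLike.conj_to_real]
    congr 2
    push_cast
    ring
  have h2 : ∫ ξ, Complex.exp (-Complex.I * (⟪ξ, x + m⟫ : ℝ)) * charFun P ξ
      = ∫ y, (∫ ξ, shiftedInversionIntegrand σ (x - y) 0 0 ξ) ∂compoundPoisson τ := by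
    rw [integral_integral_swap]
    · refine integral_congr_ae (Eventually.of_forall fun ξ => ?_)
      simp only
      rw [hP, charFun_apply, ← integral_const_mul, ← integral_const_mul, ← integral_const_mul]
      refine integral_congr_ae (Eventually.of_forall fun y => ?_)
      simp only [shiftedInversionIntegrand]
      rw [← Complex.exp_add, ← Complex.exp_add, ← Complex.exp_add]
      congr 1
      simp only [inner_add_right, inner_sub_right, inner_zero_left, real_inner_comm ξ y]
      push_cast
      ring
    · have h3 : Integrable (fun z : E × E => shiftedInversionIntegrand σ x 0 0 z.2)
          ((compoundPoisson τ).prod volume) := (hint x).comp_snd _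
      refine h3.norm.mono' (Continuous.aestronglyMeasurable ?_) (Eventually.of_forall fun z => ?_)
      · unfold Function.uncurry shiftedInversionIntegrand
        have : Continuous fun z : E × E => shiftedExponent σ z.2 0 0 := hcont.comp continuous_snd
        fun_prop
      · simp only [Function.uncurry, shiftedInversionIntegrand, Complex.exp_add]
        simp [Complex.norm_exp]
  have h4 : ENNReal.ofReal (p (x + m)) = ‖(p (x + m) : ℂ)‖ₑ := by
    rw [← ofReal_norm, Complex.norm_real, Real.norm_of_nonneg (hp0 _)]
  rw [h4, h1, h2, ← integral_smul]
  refine (enorm_integral_le_lintegral_enorm _).trans (lintegral_mono fun y => ?_)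
  rw [← ofReal_norm, norm_smul, Real.norm_of_nonneg (by positivity)]

end DensityRepresentation

/-! ### Measures in polar coordinates and their local mass. -/

section PolarMeasures

open Filter Topology

variable {E : Type*} [NormedAddCommGroup E] [InnerProductSpace ℝ E]

theorem norm_smul_sphere {s : ℝ} (hs : 0 < s) (θ : sphere (0 : E) 1) : ‖s • (θ : E)‖ = s := by
  rw [norm_smul, Real.norm_of_nonneg hs.le, norm_eq_of_mem_sphere, mul_one]

variable [MeasurableSpace E] [BorelSpace E]

/-- The measure with radial density `k` and angular part `μ`. -/
noncomputable def polarMeasure (μ : Measure (sphere (0 : E) 1)) (k : ℝ → ℝ≥0∞) : Measure E :=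
  (μ.prod ((volume.restrict (Ioi 0)).withDensity k)).map fun p => p.2 • (p.1 : E)

theorem measurable_smul_sphere :
    Measurable fun p : sphere (0 : E) 1 × ℝ => p.2 • (p.1 : E) :=
  Continuous.measurable (by fun_prop)

theorem lintegral_polarMeasure (μ : Measure (sphere (0 : E) 1)) [SFinite μ] {k : ℝ → ℝ≥0∞}
    (hk : AEMeasurable k (volume.restrict (Ioi 0))) {F : E → ℝ≥0∞} (hF : Measurable F) :
    ∫⁻ y, F y ∂polarMeasure μ k = ∫⁻ θ, (∫⁻ s in Ioi (0 : ℝ), F (s • (θ : E)) * k s) ∂μ := by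
  have h : Measurable fun p : sphere (0 : E) 1 × ℝ => F (p.2 • (p.1 : E)) :=
    hF.comp measurable_smul_sphere
  rw [polarMeasure, lintegral_map hF measurable_smul_sphere, lintegral_prod _ h.aemeasurable]
  refine lintegral_congr fun θ => ?_
  have h1 : Measurable fun s : ℝ => F (s • (θ : E)) := by fun_prop
  rw [lintegral_withDensity_eq_lintegral_mul₀ hk h1.aemeasurable]
  refine lintegral_congr fun s => ?_
  rw [Pi.mul_apply, mul_comm]

theorem lintegral_polarMeasure_radial (μ : Measure (sphere (0 : E) 1)) [SFinite μ]
    {k : ℝ → ℝ≥0∞} (hk : AEMeasurable k (volume.restrict (Ioi 0))) {f : ℝ → ℝ≥0∞}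
    (hf : Measurable f) :
    ∫⁻ y, f ‖y‖ ∂polarMeasure μ k = μ univ * ∫⁻ s in Ioi (0 : ℝ), f s * k s := by
  rw [lintegral_polarMeasure μ hk (by fun_prop), mul_comm, ← lintegral_const]
  refine lintegral_congr fun θ => setLIntegral_congr_fun measurableSet_Ioi fun s hs => ?_
  simp only [norm_smul_sphere hs]

theorem polarMeasure_norm_eq (μ : Measure (sphere (0 : E) 1)) [SFinite μ]
    {k : ℝ → ℝ≥0∞} (hk : AEMeasurable k (volume.restrict (Ioi 0))) (r : ℝ) :
    polarMeasure μ k {y | ‖y‖ = r} = 0 := by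
  have h := lintegral_polarMeasure_radial μ hk (f := indicator {r} 1)
    (measurable_one.indicator (measurableSet_singleton r))
  have h1 : ∫⁻ y, indicator {r} (1 : ℝ → ℝ≥0∞) ‖y‖ ∂polarMeasure μ k
      = polarMeasure μ k {y | ‖y‖ = r} := by
    rw [← lintegral_indicator_one (measurableSet_eq_fun measurable_norm measurable_const)]
    rfl
  have h2 : ∫⁻ s in Ioi (0 : ℝ), indicator {r} (1 : ℝ → ℝ≥0∞) s * k s = 0 := by
    have h3 : ∀ᵐ s ∂(volume.restrict (Ioi (0 : ℝ))), s ≠ r :=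
      ae_restrict_of_ae (Measure.ae_ne volume r)
    rw [← lintegral_zero (μ := volume.restrict (Ioi (0 : ℝ)))]
    refine lintegral_congr_ae ?_
    filter_upwards [h3] with s hs
    simp [hs]
  rw [← h1, h, h2, mul_zero]

/-- Two points `sθ`, `s₀θ₀` of the set are within `2r`, so `|s - s₀| < 2r` and, as `s ≥ a`, `|θ -
θ₀| < 4r/a`. The set therefore sits in a product with angular mass at most `c(4r/a)^{γ-1}` and
radial mass at most `4rM`. -/
theorem polarMeasure_annulus_ball_le (μ : Measure (sphere (0 : E) 1)) [SFinite μ]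
    {k : ℝ → ℝ≥0∞} {c γ : ℝ} (hc : 0 ≤ c)
    (hμ : ∀ (θ : sphere (0 : E) 1) (ρ : ℝ), 0 < ρ → μ (ball θ ρ) ≤ ENNReal.ofReal (c * ρ ^ (γ - 1)))
    {a r M : ℝ} (ha : 0 < a) (hr : 0 < r) (hM : 0 ≤ M)
    (hkM : ∀ s, a ≤ s → k s ≤ ENNReal.ofReal M) (u : E) :
    polarMeasure μ k ({y | a ≤ ‖y‖} ∩ ball u r)
      ≤ ENNReal.ofReal (c * 4 ^ γ * r ^ γ * (a ^ (1 - γ) * M)) := by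
  have hms : MeasurableSet ({y : E | a ≤ ‖y‖} ∩ ball u r) :=
    (measurableSet_le measurable_const measurable_norm).inter measurableSet_ball
  set κ := (volume.restrict (Ioi (0 : ℝ))).withDensity k with hκ
  rw [polarMeasure, Measure.map_apply measurable_smul_sphere hms]
  set T := (fun p : sphere (0 : E) 1 × ℝ => p.2 • (p.1 : E)) ⁻¹' ({y | a ≤ ‖y‖} ∩ ball u r)
  have hneg : (μ.prod κ) (univ ×ˢ Iic 0) = 0 := by
    rw [Measure.prod_prod, hκ, withDensity_apply _ measurableSet_Iic,
      Measure.restrict_restrict measurableSet_Iic, Iic_inter_Ioi, Ioc_self]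
    simp
  -- The mass bound on `μ` needs a centre on the sphere, so it is taken from a point of the set
  -- itself; without one, only null radii `s ≤ 0` remain.
  rcases (T ∩ (univ ×ˢ Ioi 0)).eq_empty_or_nonempty with h0 | ⟨⟨θ₀, s₀⟩, ⟨⟨h1, h2⟩, h3⟩⟩
  · have : T ⊆ univ ×ˢ Iic 0 := by
      rintro ⟨θ, s⟩ hp
      by_contra hs
      have : (⟨θ, s⟩ : sphere (0 : E) 1 × ℝ) ∈ T ∩ (univ ×ˢ Ioi 0) :=
        ⟨hp, by simpa using hs⟩
      rw [h0] at this
      exact this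
    rw [measure_mono_null this hneg]
    exact zero_le
  · have hs₀ : 0 < s₀ := h3.2
    simp only [mem_ofPred_eq] at h1
    rw [norm_smul_sphere hs₀] at h1
    have hsub : T ⊆ (univ ×ˢ Iic 0) ∪ (ball θ₀ (4 * r / a) ×ˢ (Ici a ∩ ball s₀ (2 * r))) := by
      rintro ⟨θ, s⟩ ⟨h4, h5⟩
      rcases le_or_gt s 0 with hs | hs
      · exact Or.inl ⟨mem_univ _, hs⟩
      · right
        simp only [mem_ofPred_eq] at h4
        rw [norm_smul_sphere hs] at h4
        have h6 : ‖s • (θ : E) - s₀ • (θ₀ : E)‖ < 2 * r := by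
          rw [← dist_eq_norm]
          have := dist_triangle_right (s • (θ : E)) (s₀ • (θ₀ : E)) u
          simp only [mem_ball] at h2 h5
          linarith
        have h7 : |s - s₀| < 2 * r := by
          have := abs_norm_sub_norm_le (s • (θ : E)) (s₀ • (θ₀ : E))
          rw [norm_smul_sphere hs, norm_smul_sphere hs₀] at this
          linarith
        have h8 : s * ‖(θ : E) - θ₀‖ < 4 * r := by
          calc s * ‖(θ : E) - θ₀‖ = ‖s • ((θ : E) - θ₀)‖ := by
                rw [norm_smul, Real.norm_of_nonneg hs.le]
            _ = ‖(s • (θ : E) - s₀ • (θ₀ : E)) - (s - s₀) • (θ₀ : E)‖ := by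
                congr 1; module
            _ ≤ ‖s • (θ : E) - s₀ • (θ₀ : E)‖ + ‖(s - s₀) • (θ₀ : E)‖ := norm_sub_le _ _
            _ = ‖s • (θ : E) - s₀ • (θ₀ : E)‖ + |s - s₀| := by
                rw [norm_smul, norm_eq_of_mem_sphere, mul_one, Real.norm_eq_abs]
            _ < 4 * r := by linarith
        refine ⟨?_, h4, ?_⟩
        · rw [mem_ball, Subtype.dist_eq, dist_eq_norm, lt_div_iff₀ ha]
          refine lt_of_le_of_lt ?_ h8
          rw [mul_comm]
          gcongr
        · rw [mem_ball, Real.dist_eq]; exact h7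
    refine (measure_mono hsub).trans ((measure_union_le _ _).trans ?_)
    rw [hneg, zero_add, Measure.prod_prod]
    have h9 : κ (Ici a ∩ ball s₀ (2 * r)) ≤ ENNReal.ofReal (M * (4 * r)) := by
      have hm : MeasurableSet (Ici a ∩ ball s₀ (2 * r)) := measurableSet_Ici.inter measurableSet_ball
      rw [hκ, withDensity_apply _ hm]
      calc ∫⁻ s in Ici a ∩ ball s₀ (2 * r), k s ∂volume.restrict (Ioi 0)
          ≤ ∫⁻ _ in Ici a ∩ ball s₀ (2 * r), ENNReal.ofReal M ∂volume.restrict (Ioi 0) :=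
            setLIntegral_mono' hm fun s hs => hkM s hs.1
        _ = ENNReal.ofReal M * (volume.restrict (Ioi 0)) (Ici a ∩ ball s₀ (2 * r)) := by simp
        _ ≤ ENNReal.ofReal M * volume (ball s₀ (2 * r)) := by
            refine mul_le_mul_right ?_ _
            exact (Measure.restrict_apply_le _ _).trans (measure_mono inter_subset_right)
        _ = _ := by
            rw [Real.volume_ball, ← ENNReal.ofReal_mul hM]
            congr 2; ring
    refine (mul_le_mul' (hμ θ₀ _ (by positivity)) h9).trans ?_
    rw [← ENNReal.ofReal_mul (by positivity)]
    refine ENNReal.ofReal_le_ofReal (le_of_eq ?_)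
    have e1 : (4 * r / a) ^ (γ - 1) = 4 ^ γ * r ^ γ * a ^ (1 - γ) / (4 * r) := by
      rw [Real.div_rpow (by positivity) ha.le, Real.rpow_sub_one (by positivity),
        Real.mul_rpow (by norm_num) hr.le, show (1 - γ) = -(γ - 1) by ring,
        Real.rpow_neg ha.le]
      field_simp
    rw [e1]
    field_simp

end PolarMeasures

/-! ### Radial integrals of `q` and `φ`. -/

section RadialProfiles

open Filter Topology

/-- Nothing is known about `f` on negative numbers; truncating the argument at zero gives a globally
monotone function with the same values at norms. -/
theorem AntitoneOn.measurable_comp_norm {E : Type*} [NormedAddCommGroup E] [MeasurableSpace E]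
    [OpensMeasurableSpace E] {f : ℝ → ℝ} (hf : AntitoneOn f (Ici 0)) :
    Measurable fun y : E => f ‖y‖ := by
  have h1 : Antitone fun s : ℝ => f (max s 0) := fun a b hab =>
    hf (le_max_right a 0) (le_max_right b 0) (max_le_max_right 0 hab)
  have h2 := h1.measurable.comp (measurable_norm (α := E))
  have h3 : (fun s : ℝ => f (max s 0)) ∘ norm = fun y : E => f ‖y‖ := by
    ext y; simp
  rwa [h3] at h2

theorem aemeasurable_restrict_Ioi_of_antitoneOn {f : ℝ → ℝ} (hf : AntitoneOn f (Ici 0)) :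
    AEMeasurable f (volume.restrict (Ioi 0)) :=
  aemeasurable_restrict_of_antitoneOn measurableSet_Ioi (hf.mono Ioi_subset_Ici_self)

variable {α β c : ℝ} {q φ : ℝ → ℝ}

theorem antitoneOn_comp_div (hφ_anti : AntitoneOn φ (Ici 0)) {b : ℝ} (hb : 0 < b) :
    AntitoneOn (fun s => φ (s / b)) (Ici 0) := fun x hx y hy hxy =>
  hφ_anti (mem_Ici.2 (div_nonneg hx hb.le)) (mem_Ici.2 (div_nonneg hy hb.le))
    (by gcongr)

theorem ratio_le_one (hφ_pos : ∀ s, 0 ≤ s → 0 < φ s) (hφ_anti : AntitoneOn φ (Ici 0)) {s : ℝ}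
    (hs : 0 ≤ s) : φ s / φ (s / 2) ≤ 1 := by
  rw [div_le_one (hφ_pos _ (by positivity))]
  exact hφ_anti (mem_Ici.2 (by positivity)) hs (by linarith)

theorem aemeasurable_weighted_profile (hq_anti : AntitoneOn q (Ici 0))
    (hφ_anti : AntitoneOn φ (Ici 0)) (a : ℝ) :
    AEMeasurable (fun s => s ^ a * q s * (φ s / φ (s / 2))) (volume.restrict (Ioi 0)) := by
  have h1 := aemeasurable_restrict_Ioi_of_antitoneOn hq_anti
  have h2 := aemeasurable_restrict_Ioi_of_antitoneOn hφ_anti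
  have h3 := aemeasurable_restrict_Ioi_of_antitoneOn (antitoneOn_comp_div hφ_anti two_pos)
  have h4 : Measurable fun s : ℝ => s ^ a := by fun_prop
  exact (h4.aemeasurable.mul h1).mul (h2.div h3)

theorem weighted_profile_nonneg (hq_pos : ∀ s, 0 ≤ s → 0 < q s) (hφ_pos : ∀ s, 0 ≤ s → 0 < φ s)
    (a : ℝ) {s : ℝ} (hs : 0 ≤ s) : 0 ≤ s ^ a * q s * (φ s / φ (s / 2)) := by
  have := hq_pos s hs
  have := hφ_pos s hs
  have := hφ_pos (s / 2) (by positivity)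
  positivity

theorem weighted_profile_le (hq_pos : ∀ s, 0 ≤ s → 0 < q s) (hq_anti : AntitoneOn q (Ici 0))
    (hφ_pos : ∀ s, 0 ≤ s → 0 < φ s) (hφ_anti : AntitoneOn φ (Ici 0)) (a : ℝ) {s : ℝ}
    (hs : 0 ≤ s) : s ^ a * q s * (φ s / φ (s / 2)) ≤ q 0 * s ^ a := by
  have h1 := hq_pos s hs
  have h2 : q s ≤ q 0 := hq_anti self_mem_Ici hs hs
  have h3 := ratio_le_one hφ_pos hφ_anti hs
  calc s ^ a * q s * (φ s / φ (s / 2)) ≤ s ^ a * q s * 1 := by gcongr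
    _ = s ^ a * q s := mul_one _
    _ ≤ s ^ a * q 0 := by gcongr
    _ = _ := mul_comm _ _

theorem lintegral_weighted_profile_le_of_lt_two (hα : α < 2) (hq_pos : ∀ s, 0 ≤ s → 0 < q s)
    (hq_anti : AntitoneOn q (Ici 0))
    (hφ_pos : ∀ s, 0 ≤ s → 0 < φ s) (hφ_anti : AntitoneOn φ (Ici 0)) {h : ℝ} (hh : 0 < h) :
    ∫⁻ s in Ioc 0 h, ENNReal.ofReal (s ^ (1 - α) * q s * (φ s / φ (s / 2)))
      ≤ ENNReal.ofReal (q 0 / (2 - α) * h ^ (2 - α)) := by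
  have hi : IntegrableOn (fun s : ℝ => q 0 * s ^ (1 - α)) (Ioc 0 h) :=
    ((intervalIntegral.intervalIntegrable_rpow' (by linarith)).1).const_mul _
  calc _ ≤ ∫⁻ s in Ioc 0 h, ENNReal.ofReal (q 0 * s ^ (1 - α)) := by
        refine setLIntegral_mono' measurableSet_Ioc fun s hs => ENNReal.ofReal_le_ofReal ?_
        exact weighted_profile_le hq_pos hq_anti hφ_pos hφ_anti _ hs.1.le
    _ = ENNReal.ofReal (∫ s in Ioc 0 h, q 0 * s ^ (1 - α)) := by
        rw [ofReal_integral_eq_lintegral_ofReal hi]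
        refine (ae_restrict_iff' measurableSet_Ioc).2 (Eventually.of_forall fun s hs => ?_)
        have := hs.1
        have := hq_pos 0 le_rfl
        simp only [Pi.zero_apply]
        positivity
    _ = _ := by
        rw [← intervalIntegral.integral_of_le hh.le, intervalIntegral.integral_const_mul,
          integral_rpow (Or.inl (by linarith)), show 1 - α + 1 = 2 - α by ring,
          Real.zero_rpow (by linarith)]
        congr 1; ring

theorem lintegral_weighted_profile_le_of_growth (hα : α < 2) (hq_pos : ∀ s, 0 ≤ s → 0 < q s)
    (hq_anti : AntitoneOn q (Ici 0))
    (hφ_pos : ∀ s, 0 ≤ s → 0 < φ s) (hφ_anti : AntitoneOn φ (Ici 0))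
    (h_growth : ∀ r, 1 < r →
      ∫ s in (0 : ℝ)..r, s ^ (1 - α) * q s * (φ s / φ (s / 2)) ≤ c * r ^ (2 - β))
    {h : ℝ} (hh : 1 < h) :
    ∫⁻ s in Ioc 0 h, ENNReal.ofReal (s ^ (1 - α) * q s * (φ s / φ (s / 2)))
      ≤ ENNReal.ofReal (c * h ^ (2 - β)) := by
  have h0 : 0 < h := by linarith
  have hi : IntegrableOn (fun s : ℝ => s ^ (1 - α) * q s * (φ s / φ (s / 2))) (Ioc 0 h) := by
    have hi' : IntegrableOn (fun s : ℝ => q 0 * s ^ (1 - α)) (Ioc 0 h) :=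
      ((intervalIntegral.intervalIntegrable_rpow' (by linarith)).1).const_mul _
    refine hi'.mono' ?_ ?_
    · exact ((aemeasurable_weighted_profile hq_anti hφ_anti _).mono_measure
        (Measure.restrict_mono Ioc_subset_Ioi_self le_rfl)).aestronglyMeasurable
    · refine (ae_restrict_iff' measurableSet_Ioc).2 (Eventually.of_forall fun s hs => ?_)
      rw [Real.norm_of_nonneg (weighted_profile_nonneg hq_pos hφ_pos _ hs.1.le)]
      exact weighted_profile_le hq_pos hq_anti hφ_pos hφ_anti _ hs.1.le
  rw [← ofReal_integral_eq_lintegral_ofReal hi ((ae_restrict_iff' measurableSet_Ioc).2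
    (Eventually.of_forall fun s hs => weighted_profile_nonneg hq_pos hφ_pos _ hs.1.le)),
    ← intervalIntegral.integral_of_le h0.le]
  exact ENNReal.ofReal_le_ofReal (h_growth h hh)

theorem lintegral_tail_profile_le (hα : 0 < α) (hq_pos : ∀ s, 0 ≤ s → 0 < q s)
    (hq_anti : AntitoneOn q (Ici 0))
    (hφ_pos : ∀ s, 0 ≤ s → 0 < φ s) (hφ_anti : AntitoneOn φ (Ici 0)) {h : ℝ} (hh : 0 < h) :
    ∫⁻ s in Ioi h, ENNReal.ofReal (s ^ (-1 - α) * q s * (φ s / φ (s / 2)))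
      ≤ ENNReal.ofReal (q 0 / α * h ^ (-α)) := by
  have hi : IntegrableOn (fun s : ℝ => q 0 * s ^ (-1 - α)) (Ioi h) :=
    (integrableOn_Ioi_rpow_of_lt (by linarith) hh).const_mul _
  calc _ ≤ ∫⁻ s in Ioi h, ENNReal.ofReal (q 0 * s ^ (-1 - α)) := by
        refine setLIntegral_mono' measurableSet_Ioi fun s hs => ENNReal.ofReal_le_ofReal ?_
        exact weighted_profile_le hq_pos hq_anti hφ_pos hφ_anti _ (hh.trans hs).le
    _ = ENNReal.ofReal (∫ s in Ioi h, q 0 * s ^ (-1 - α)) := by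
        rw [ofReal_integral_eq_lintegral_ofReal hi]
        refine (ae_restrict_iff' measurableSet_Ioi).2 (Eventually.of_forall fun s hs => ?_)
        have : 0 < s := hh.trans hs
        have := hq_pos 0 le_rfl
        simp only [Pi.zero_apply]
        positivity
    _ = _ := by
        rw [integral_const_mul, integral_Ioi_rpow_of_lt (by linarith) hh,
          show -1 - α + 1 = -α by ring]
        congr 1; field_simp

/-- Dyadic decomposition: on `(2^k h, 2^{k+1} h]` one has `s^{-1-α} ≤ (2^k h)^{-2} s^{1-α}`, so the
growth condition gives a term of order `(2^k h)^{-β}`. The series is geometric with ratio `2^{-β} <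
1`. -/
theorem lintegral_tail_profile_le_of_growth (hα : α < 2) (hβ : 0 < β) (hc : 0 ≤ c)
    (hq_pos : ∀ s, 0 ≤ s → 0 < q s) (hq_anti : AntitoneOn q (Ici 0))
    (hφ_pos : ∀ s, 0 ≤ s → 0 < φ s) (hφ_anti : AntitoneOn φ (Ici 0))
    (h_growth : ∀ r, 1 < r →
      ∫ s in (0 : ℝ)..r, s ^ (1 - α) * q s * (φ s / φ (s / 2)) ≤ c * r ^ (2 - β))
    {h : ℝ} (hh : 1 < h) :
    ∫⁻ s in Ioi h, ENNReal.ofReal (s ^ (-1 - α) * q s * (φ s / φ (s / 2)))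
      ≤ ENNReal.ofReal (c * 2 ^ (2 - β) * (1 - 2 ^ (-β))⁻¹ * h ^ (-β)) := by
  have h0 : 0 < h := by linarith
  set ϑ : ℝ := 2 ^ (-β) with hϑ
  have hϑ0 : 0 < ϑ := by positivity
  have hϑ1 : ϑ < 1 := Real.rpow_lt_one_of_one_lt_of_neg (by norm_num) (by linarith)
  have hcover : Ioi h ⊆ ⋃ k : ℕ, Ioc (2 ^ k * h) (2 ^ (k + 1) * h) := by
    intro s hs
    have h1 : ∃ n : ℕ, s ≤ 2 ^ n * h := by
      obtain ⟨n, hn⟩ := pow_unbounded_of_one_lt (s / h) (one_lt_two (α := ℝ))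
      exact ⟨n, ((div_lt_iff₀ h0).1 hn).le⟩
    classical
    have h2 := Nat.find_spec h1
    have h3 : Nat.find h1 ≠ 0 := by
      intro h4
      rw [h4, pow_zero, one_mul] at h2
      exact absurd h2 (not_le.2 hs)
    obtain ⟨n, hn⟩ := Nat.exists_eq_succ_of_ne_zero h3
    refine mem_iUnion.2 ⟨n, not_le.1 (Nat.find_min h1 (m := n) (by omega)), ?_⟩
    rw [hn] at h2
    exact h2
  have hpiece : ∀ k : ℕ, ∫⁻ s in Ioc (2 ^ k * h) (2 ^ (k + 1) * h),
      ENNReal.ofReal (s ^ (-1 - α) * q s * (φ s / φ (s / 2)))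
        ≤ ENNReal.ofReal (c * 2 ^ (2 - β) * h ^ (-β) * ϑ ^ k) := by
    intro k
    have hk : 0 < 2 ^ k * h := by positivity
    have hk1 : (1 : ℝ) < 2 ^ (k + 1) * h := by
      have : (1 : ℝ) ≤ 2 ^ (k + 1) := one_le_pow₀ (by norm_num)
      nlinarith
    calc _ ≤ ∫⁻ s in Ioc (2 ^ k * h) (2 ^ (k + 1) * h), ENNReal.ofReal ((2 ^ k * h) ^ (-2 : ℝ))
          * ENNReal.ofReal (s ^ (1 - α) * q s * (φ s / φ (s / 2))) := by
          refine setLIntegral_mono' measurableSet_Ioc fun s hs => ?_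
          have hs0 : 0 < s := hk.trans hs.1
          rw [← ENNReal.ofReal_mul (by positivity)]
          refine ENNReal.ofReal_le_ofReal ?_
          have e : s ^ (-1 - α) = s ^ (-2 : ℝ) * s ^ (1 - α) := by
            rw [← Real.rpow_add hs0]; congr 1; ring
          rw [e, mul_assoc, mul_assoc, ← mul_assoc (s ^ (1 - α))]
          refine mul_le_mul_of_nonneg_right ?_ (weighted_profile_nonneg hq_pos hφ_pos _ hs0.le)
          exact Real.rpow_le_rpow_of_nonpos hk hs.1.le (by norm_num)
      _ ≤ ENNReal.ofReal ((2 ^ k * h) ^ (-2 : ℝ)) * ∫⁻ s in Ioc 0 (2 ^ (k + 1) * h),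
            ENNReal.ofReal (s ^ (1 - α) * q s * (φ s / φ (s / 2))) := by
          rw [lintegral_const_mul' _ _ ENNReal.ofReal_ne_top]
          gcongr
      _ ≤ ENNReal.ofReal ((2 ^ k * h) ^ (-2 : ℝ))
            * ENNReal.ofReal (c * (2 ^ (k + 1) * h) ^ (2 - β)) := by
          gcongr
          exact lintegral_weighted_profile_le_of_growth hα hq_pos hq_anti hφ_pos hφ_anti
            h_growth hk1
      _ = _ := by
          rw [← ENNReal.ofReal_mul (by positivity)]
          congr 1
          rw [pow_succ, mul_comm ((2 : ℝ) ^ k) 2, mul_assoc 2, Real.mul_rpow two_pos.le hk.le,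
            show 2 - β = -β - (-2 : ℝ) by ring, Real.rpow_sub hk, Real.rpow_sub two_pos,
            Real.mul_rpow (x := 2 ^ k) (z := -β) (by positivity) h0.le]
          have e : ((2 : ℝ) ^ k) ^ (-β) = ϑ ^ k := by
            rw [hϑ, ← Real.rpow_natCast, ← Real.rpow_mul two_pos.le, mul_comm,
              Real.rpow_mul two_pos.le, Real.rpow_natCast]
          rw [e]
          have : (2 ^ k * h) ^ (-2 : ℝ) ≠ 0 := by positivity
          field_simp
  have hsum : HasSum (fun k : ℕ => c * 2 ^ (2 - β) * h ^ (-β) * ϑ ^ k)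
      (c * 2 ^ (2 - β) * h ^ (-β) * (1 - ϑ)⁻¹) :=
    (hasSum_geometric_of_lt_one hϑ0.le hϑ1).mul_left _
  calc _ ≤ ∫⁻ s in ⋃ k : ℕ, Ioc (2 ^ k * h) (2 ^ (k + 1) * h),
          ENNReal.ofReal (s ^ (-1 - α) * q s * (φ s / φ (s / 2))) := lintegral_mono_set hcover
    _ ≤ _ := lintegral_iUnion_le _ _
    _ ≤ ∑' k : ℕ, ENNReal.ofReal (c * 2 ^ (2 - β) * h ^ (-β) * ϑ ^ k) :=
        ENNReal.tsum_le_tsum hpiece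
    _ = _ := by
        rw [← ENNReal.ofReal_tsum_of_nonneg (fun k => by positivity) hsum.summable, hsum.tsum_eq]
        congr 1; ring

end RadialProfiles

/-! ### Density bounds from small-jump decay and large-jump mass. -/

section SmallJumpDecay

variable {E : Type*} [NormedAddCommGroup E] [InnerProductSpace ℝ E] [FiniteDimensional ℝ E]
  [Nontrivial E] [MeasurableSpace E] [BorelSpace E]

theorem exists_smallJump_density_bound {c C A α : ℝ} (hC : 0 ≤ C) (hc : 0 < c) (hA : 0 ≤ A)
    (hα : 0 < α) :
    ∃ B, 0 < B ∧ ∀ (σ : Measure E) (h : ℝ), 0 < h → Integrable (fun y => ‖y‖ ^ 2) σ →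
      (∀ᵐ y ∂σ, ‖y‖ ≤ h) → ∫ y, ‖y‖ ^ 2 ∂σ ≤ A * h ^ 2 →
      (∀ ξ : E, c * (h * ‖ξ‖) ^ α - C ≤ ∫ y, (1 - Real.cos ⟪ξ, y⟫) ∂σ) → ∀ x : E,
      ‖∫ ξ, shiftedInversionIntegrand σ x 0 0 ξ‖ ≤ B * (h ^ Module.finrank ℝ E)⁻¹
        * Real.exp (-(1 / 4 * (‖x‖ / h) * Real.log (1 + 1 * (‖x‖ / h)))) := by
  obtain ⟨B, hB⟩ := exists_optimal_shift (A := A) (C := C) (k := Module.finrank ℝ E / α) hA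
    (by positivity)
  set J := ∫ ξ : E, Real.exp (-c * ‖ξ‖ ^ α) with hJ
  have hJ0 : 0 ≤ J := integral_nonneg fun ξ => (Real.exp_pos _).le
  refine ⟨Real.exp B * (J + 1), by positivity, fun σ h hh hσ hσh hσA hlow x => ?_⟩
  obtain ⟨s, hs, hsB⟩ := hB (‖x‖ / h) (by positivity)
  refine (norm_integral_shiftedInversionIntegrand_le hh hC hc hα hσ hσh hσA hlow x hs).trans ?_
  rw [← hJ]
  calc _ = Real.exp (-(s * (‖x‖ / h)) + C + A * (s ^ 2 * Real.exp s)
          + s * (Module.finrank ℝ E / α)) * (h ^ Module.finrank ℝ E)⁻¹ * J := by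
        rw [Real.exp_add _ (s * (Module.finrank ℝ E / α)), mul_div_assoc]; ring
    _ ≤ Real.exp (B - 1 / 4 * (‖x‖ / h) * Real.log (1 + ‖x‖ / h))
          * (h ^ Module.finrank ℝ E)⁻¹ * (J + 1) := by
        gcongr
        linarith
    _ = _ := by
        rw [one_mul, sub_eq_add_neg, Real.exp_add]; ring

/-- Upper bounds for a density which is the convolution of a small jump part and a compound Poisson
part, in terms of the local mass of a measure dominating the large jumps. -/
theorem exists_density_upper_bound {c C A α γ κ₁ κ₂ : ℝ} (hC : 0 ≤ C) (hc : 0 < c)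
    (hA : 0 < A) (hα : 0 < α) (hγ : 0 ≤ γ) {q φ : ℝ → ℝ}
    (hq_pos : ∀ s, 0 ≤ s → 0 < q s)
    (hφ_pos : ∀ s, 0 ≤ s → 0 < φ s) (hφ_anti : AntitoneOn φ (Ici 0))
    (hκ₁ : 0 < κ₁) (hq_doubling : ∀ s, 0 < s → q s ≤ κ₁ * q (2 * s))
    (hκ₂ : 0 < κ₂) (hφ_mul : ∀ a b, 0 ≤ a → 0 ≤ b → φ a * φ b ≤ κ₂ * φ (a + b)) :
    ∃ B K, 0 < B ∧ 0 < K ∧ ∀ (σ τ Λ P : Measure E) (m : E) (t h : ℝ), 0 < t → 0 < h →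
      IsProbabilityMeasure P → IsFiniteMeasure τ →
      Integrable (fun y => ‖y‖ ^ 2) σ →
      (∀ᵐ y ∂σ, ‖y‖ ≤ h) → ∫ y, ‖y‖ ^ 2 ∂σ ≤ A * h ^ 2 →
      (∀ ξ : E, c * (h * ‖ξ‖) ^ α - C ≤ ∫ y, (1 - Real.cos ⟪ξ, y⟫) ∂σ) →
      Λ univ ≤ ENNReal.ofReal A →
      (∀ F : E → ℝ≥0∞, Measurable F →
        ∫⁻ y, F y ∂τ ≤ ∫⁻ y, F y * ENNReal.ofReal (φ (‖y‖ / 2)) ∂Λ) →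
      (∀ (r a : ℝ) (u : E), 0 < r → 0 < a → Λ ({y | a ≤ ‖y‖} ∩ ball u r)
        ≤ ENNReal.ofReal (A * t * r ^ γ * (a ^ (-γ - α) * q a))) →
      (∀ ξ, charFun P ξ = Complex.exp (Complex.I * (⟪ξ, m⟫ : ℝ))
        * (Complex.exp (shiftedExponent σ ξ 0 0) * charFun (compoundPoisson τ) ξ)) →
      ∃ p : E → ℝ, Continuous p ∧ (∀ x, 0 ≤ p x) ∧
        P = volume.withDensity (fun x => ENNReal.ofReal (p x)) ∧
        (∀ x, p (x + m) ≤ B * (h ^ Module.finrank ℝ E)⁻¹) ∧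
        ∀ x, x ≠ 0 → p (x + m) ≤ B * (h ^ Module.finrank ℝ E)⁻¹ *
          (Real.exp (-(1 / 8 * (‖x‖ / h) * Real.log (1 + 1 / 2 * (‖x‖ / h))))
            + K * (t * h ^ γ * ‖x‖ ^ (-γ - α) * q ‖x‖ * φ (‖x‖ / 4))) := by
  obtain ⟨B₀, hB₀, hsmall⟩ := exists_smallJump_density_bound (E := E) hC hc hA.le hα
  set g : ℝ → ℝ := fun R => Real.exp (-(1 / 4 * R * Real.log (1 + 1 * R))) with hg
  have hg_anti : AntitoneOn g (Ici 0) := antitoneOn_exp_neg_mul_log (by norm_num) zero_le_one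
  have hg_sum : Summable fun k : ℕ => g k * ((k : ℝ) + 1) ^ γ :=
    summable_exp_neg_mul_log_mul_rpow (by norm_num) one_pos hγ
  set S := ∑' k : ℕ, g k * ((k : ℝ) + 1) ^ γ with hS
  have hS0 : 0 ≤ S := tsum_nonneg fun k => by positivity
  set B := ((2 * Real.pi) ^ Module.finrank ℝ E)⁻¹ * B₀ with hB
  have hB0 : 0 < B := by positivity
  -- The doubling constant of `a^{-γ-α} q(a)` under halving of `a`, increased by one to ensure `D ≥
  -- 1`.
  set D := 1 + 2 ^ (γ + α) * κ₁ with hD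
  set X := Real.exp (κ₂ * (2 * D * A)) with hX
  -- The factors are, in order: the weight at the origin, the inverse mass bound, the exponential
  -- series in `n`, the radial sum over `k` (plus one, for positivity), the local mass constant, and
  -- the doubling cost of passing from `‖x‖/2` to `‖x‖`.
  set K := (φ 0)⁻¹ * A⁻¹ * X * (S + 1) * A * (2 ^ (γ + α) * κ₁) with hK
  have hφ0 := hφ_pos 0 le_rfl
  have hK0 : 0 < K := by positivity
  refine ⟨B, K, hB0, hK0, ?_⟩
  intro σ τ Λ P m t h ht hh hP hτf hσ hσh hσA hlow hΛ hτ hG hchar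
  have hΛf : IsFiniteMeasure Λ := ⟨hΛ.trans_lt ENNReal.ofReal_lt_top⟩
  obtain ⟨p, hpc, hp0, hPp, hpm⟩ := exists_density_le_of_charFun_eq (P := P) (σ := σ) (τ := τ)
    (m := m) (continuous_shiftedExponent hσ hσh 0 0)
    (integrable_shiftedInversionIntegrand hh hC hc hα hσ hσh hlow) hchar
  set H := (h ^ Module.finrank ℝ E)⁻¹ with hH
  have hH0 : 0 < H := by positivity
  have hgm : Measurable g := by fun_prop
  have hpm' : ∀ x, ENNReal.ofReal (p (x + m))
      ≤ ENNReal.ofReal (B * H) * ∫⁻ y, ENNReal.ofReal (g (‖x - y‖ / h)) ∂compoundPoisson τ := by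
    intro x
    refine (hpm x).trans ?_
    rw [← lintegral_const_mul _ (by fun_prop)]
    refine lintegral_mono fun y => ?_
    rw [← ENNReal.ofReal_mul (by positivity)]
    refine ENNReal.ofReal_le_ofReal ?_
    calc _ ≤ ((2 * Real.pi) ^ Module.finrank ℝ E)⁻¹ * (B₀ * H * g (‖x - y‖ / h)) :=
          mul_le_mul_of_nonneg_left (hsmall σ h hh hσ hσh hσA hlow (x - y)) (by positivity)
      _ = _ := by rw [hB]; ring
  refine ⟨p, hpc, hp0, hPp, fun x => ?_, fun x hx => ?_⟩
  · refine (ENNReal.ofReal_le_ofReal_iff (by positivity)).1 ((hpm' x).trans ?_)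
    calc _ ≤ ENNReal.ofReal (B * H) * ∫⁻ _, 1 ∂compoundPoisson τ := by
          gcongr with y
          rw [← ENNReal.ofReal_one]
          refine ENNReal.ofReal_le_ofReal ?_
          have h1 := hg_anti self_mem_Ici (mem_Ici.2 (show 0 ≤ ‖x - y‖ / h by positivity))
            (show 0 ≤ ‖x - y‖ / h by positivity)
          simpa [hg] using h1
      _ = _ := by simp
  · have hx0 : 0 < ‖x‖ := norm_pos_iff.2 hx
    have hqx := hq_pos ‖x‖ hx0.le
    have hφx := hφ_pos (‖x‖ / 4) (by positivity)
    refine (ENNReal.ofReal_le_ofReal_iff (by positivity)).1 ((hpm' x).trans ?_)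
    rw [ENNReal.ofReal_mul (p := B * H) (by positivity)]
    refine mul_le_mul_right ?_ _
    have hD1 : 1 ≤ D := le_add_of_nonneg_right (by positivity)
    have hdoub : ∀ a, 0 < a → (a / 2) ^ (-γ - α) * q (a / 2)
        ≤ 2 ^ (γ + α) * κ₁ * (a ^ (-γ - α) * q a) := by
      intro a ha
      have h1 := hq_doubling (a / 2) (half_pos ha)
      rw [mul_div_cancel₀ _ two_ne_zero] at h1
      have h2 : (a / 2) ^ (-γ - α) = 2 ^ (γ + α) * a ^ (-γ - α) := by
        rw [Real.div_rpow ha.le two_pos.le, show -γ - α = -(γ + α) by ring,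
          Real.rpow_neg two_pos.le]
        field_simp
      rw [h2]
      calc _ ≤ 2 ^ (γ + α) * a ^ (-γ - α) * (κ₁ * q a) := by gcongr
        _ = _ := by ring
    have key := lintegral_compoundPoisson_le (τ := τ) (Λ := Λ)
      (ω := fun s => ENNReal.ofReal (φ (s / 2))) (g := fun R => ENNReal.ofReal (g R))
      (κ := ENNReal.ofReal κ₂) (C₀ := ENNReal.ofReal (φ 0)⁻¹) (L := ENNReal.ofReal A)
      (D := ENNReal.ofReal D) (h := h)
      (G := fun r a => ENNReal.ofReal (A * t * r ^ γ * (a ^ (-γ - α) * q a)))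
      (fun a ha b hb hab => ENNReal.ofReal_le_ofReal
        (antitoneOn_comp_div hφ_anti two_pos ha hb hab))
      (antitoneOn_comp_div hφ_anti two_pos).measurable_comp_norm.ennreal_ofReal hτ
      (fun a b ha hb => by
        rw [← ENNReal.ofReal_mul (hφ_pos _ (by positivity)).le, ← ENNReal.ofReal_mul hκ₂.le,
          add_div]
        exact ENNReal.ofReal_le_ofReal (hφ_mul _ _ (by positivity) (by positivity)))
      (by
        rw [← ENNReal.ofReal_mul (by positivity), zero_div, inv_mul_cancel₀ hφ0.ne',
          ENNReal.ofReal_one])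
      (fun a ha b hb hab => ENNReal.ofReal_le_ofReal (hg_anti ha hb hab))
      hgm.ennreal_ofReal hh hΛ (by simpa using hA) ENNReal.ofReal_ne_top
      (by simpa using ENNReal.ofReal_le_ofReal hD1) hG
      (fun r a hr ha => by
        rw [← ENNReal.ofReal_mul (by positivity)]
        refine ENNReal.ofReal_le_ofReal ?_
        have hqa := hq_pos a ha.le
        calc A * t * r ^ γ * ((a / 2) ^ (-γ - α) * q (a / 2))
            ≤ A * t * r ^ γ * (2 ^ (γ + α) * κ₁ * (a ^ (-γ - α) * q a)) := by
              gcongr A * t * r ^ γ * ?_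
              exact hdoub a ha
          _ ≤ A * t * r ^ γ * (D * (a ^ (-γ - α) * q a)) := by
              gcongr
              rw [hD]; linarith
          _ = _ := by ring)
      hx
    refine key.trans ?_
    -- The near part evaluates the profile at half of `R = ‖x‖/h`; this turns `1/4` into `1/8` and
    -- puts `1/2` inside the logarithm.
    have e1 : g (‖x‖ / (2 * h))
        = Real.exp (-(1 / 8 * (‖x‖ / h) * Real.log (1 + 1 / 2 * (‖x‖ / h)))) := by
      simp only [hg]
      congr 2
      rw [show ‖x‖ / (2 * h) = 1 / 2 * (‖x‖ / h) by field_simp]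
      ring_nf
    have e2 : (∑' n : ℕ, ENNReal.ofReal (1 / n.factorial)
        * (ENNReal.ofReal κ₂ * (2 * ENNReal.ofReal D * ENNReal.ofReal A)) ^ n)
        = ENNReal.ofReal X := by
      have h1 := NormedSpace.expSeries_div_hasSum_exp (κ₂ * (2 * D * A))
      rw [← Real.exp_eq_exp_ℝ] at h1
      rw [hX, ← h1.tsum_eq, ENNReal.ofReal_tsum_of_nonneg (fun n => by positivity) h1.summable]
      refine tsum_congr fun n => ?_
      rw [show (2 : ℝ≥0∞) = ENNReal.ofReal 2 by simp, ← ENNReal.ofReal_mul two_pos.le,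
        ← ENNReal.ofReal_mul (by positivity), ← ENNReal.ofReal_mul hκ₂.le,
        ← ENNReal.ofReal_pow (by positivity), ← ENNReal.ofReal_mul (by positivity)]
      congr 1; ring
    have e3 : (∑' k : ℕ, ENNReal.ofReal (g k) * ENNReal.ofReal
        (A * t * (((k : ℝ) + 1) * h) ^ γ * ((‖x‖ / 2) ^ (-γ - α) * q (‖x‖ / 2))))
        = ENNReal.ofReal (S * (A * t * h ^ γ * ((‖x‖ / 2) ^ (-γ - α) * q (‖x‖ / 2)))) := by
      have hqx2 := hq_pos (‖x‖ / 2) (by positivity)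
      rw [hS, ← tsum_mul_right, ENNReal.ofReal_tsum_of_nonneg (fun k => by positivity)
        (hg_sum.mul_right _)]
      refine tsum_congr fun k => ?_
      rw [← ENNReal.ofReal_mul (by positivity), Real.mul_rpow (by positivity) hh.le]
      congr 1; ring
    have e4 : ∀ Y, ENNReal.ofReal (φ 0)⁻¹ * (ENNReal.ofReal A)⁻¹ * ENNReal.ofReal (φ (‖x‖ / 2 / 2))
        * ENNReal.ofReal X * ENNReal.ofReal Y
        = ENNReal.ofReal ((φ 0)⁻¹ * A⁻¹ * φ (‖x‖ / 4) * X * Y) := fun Y => by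
      rw [← ENNReal.ofReal_inv_of_pos hA, show ‖x‖ / 2 / 2 = ‖x‖ / 4 by ring,
        ENNReal.ofReal_mul (p := (φ 0)⁻¹ * A⁻¹ * φ (‖x‖ / 4) * X) (by positivity),
        ENNReal.ofReal_mul (p := (φ 0)⁻¹ * A⁻¹ * φ (‖x‖ / 4)) (by positivity),
        ENNReal.ofReal_mul (p := (φ 0)⁻¹ * A⁻¹) (by positivity),
        ENNReal.ofReal_mul (p := (φ 0)⁻¹) (by positivity)]
    rw [e1, e2, e3, e4, ENNReal.ofReal_add (Real.exp_pos _).le (by positivity)]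
    refine add_le_add_right (ENNReal.ofReal_le_ofReal ?_) _
    calc (φ 0)⁻¹ * A⁻¹ * φ (‖x‖ / 4) * X
          * (S * (A * t * h ^ γ * ((‖x‖ / 2) ^ (-γ - α) * q (‖x‖ / 2))))
        ≤ (φ 0)⁻¹ * A⁻¹ * φ (‖x‖ / 4) * X * ((S + 1) * (A * t * h ^ γ
          * (2 ^ (γ + α) * κ₁ * (‖x‖ ^ (-γ - α) * q ‖x‖)))) := by
          have := hdoub ‖x‖ hx0
          have hqx2 := hq_pos (‖x‖ / 2) (by positivity)
          gcongr
          linarith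
      _ = _ := by rw [hK]; ring

end SmallJumpDecay

/-! ### Splitting the Lévy–Khinchin exponent. -/

section LevyMeasures

open Filter Topology

variable {d : ℕ} {ν : Measure (EuclideanSpace ℝ (Fin d))}

theorem IsLevyMeasure.integrable_min (hν : IsLevyMeasure ν) :
    Integrable (fun y => min 1 (‖y‖ ^ 2)) ν := by
  refine ⟨Continuous.aestronglyMeasurable (by fun_prop), ?_⟩
  rw [hasFiniteIntegral_iff_ofReal (Eventually.of_forall fun y => by
    simp only [Pi.zero_apply]; positivity)]
  exact hν

theorem IsLevyMeasure.measure_compl_ball_lt_top (hν : IsLevyMeasure ν) {h : ℝ} (hh : 0 < h) :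
    ν (ball 0 h)ᶜ < ∞ := by
  refine lt_of_le_of_lt (measure_mono fun y hy => ?_)
    (hν.integrable_min.measure_ge_lt_top (ε := min 1 (h ^ 2)) (by positivity))
  simp only [mem_compl_iff, mem_ball_zero_iff, not_lt] at hy
  simp only [mem_ofPred_eq]
  gcongr

theorem IsLevyMeasure.integrableOn_sq_norm (hν : IsLevyMeasure ν) (h : ℝ) :
    IntegrableOn (fun y => ‖y‖ ^ 2) (ball 0 h) ν := by
  refine (hν.integrable_min.const_mul (max 1 (h ^ 2))).integrableOn.mono'
    (Continuous.aestronglyMeasurable (by fun_prop))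
    ((ae_restrict_iff' measurableSet_ball).2 (Eventually.of_forall fun y hy => ?_))
  rw [mem_ball_zero_iff] at hy
  rw [Real.norm_of_nonneg (by positivity)]
  rcases le_total 1 (‖y‖ ^ 2) with h1 | h1
  · rw [min_eq_left h1, mul_one]
    refine le_trans ?_ (le_max_right _ _)
    gcongr
  · rw [min_eq_right h1]
    exact le_mul_of_one_le_left (by positivity) (le_max_left _ _)

/-- The vector field `(1_{|y| < h} - 1_{|y| < 1}) y` whose integral is the drift correction. -/
noncomputable def truncationDifference {d : ℕ} (h : ℝ) (y : EuclideanSpace ℝ (Fin d)) :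
    EuclideanSpace ℝ (Fin d) :=
  (ball 0 h).indicator id y - (ball 0 1).indicator id y

theorem measurable_truncationDifference (h : ℝ) :
    Measurable (truncationDifference (d := d) h) :=
  (measurable_id.indicator measurableSet_ball).sub (measurable_id.indicator measurableSet_ball)

/-- The two truncations differ only for `‖y‖` between `min h 1` and `max h 1`, a region away from
the origin and from infinity. -/
theorem IsLevyMeasure.integrable_truncationDifference (hν : IsLevyMeasure ν) {h : ℝ} (hh : 0 < h) :
    Integrable (truncationDifference h) ν := by
  have hm : 0 < min h 1 := lt_min hh one_pos
  refine (hν.integrable_min.const_mul (max h 1 / (min h 1) ^ 2)).mono'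
    (measurable_truncationDifference h).aestronglyMeasurable (Eventually.of_forall fun y => ?_)
  have h0 : 0 ≤ max h 1 / min h 1 ^ 2 * min 1 (‖y‖ ^ 2) := by positivity
  have key : min h 1 ≤ ‖y‖ → ‖y‖ ≤ max h 1 → ‖y‖ ≤ max h 1 / min h 1 ^ 2 * min 1 (‖y‖ ^ 2) := by
    intro h1 h2
    refine h2.trans ?_
    rw [div_mul_eq_mul_div, le_div_iff₀ (by positivity)]
    have : min h 1 ^ 2 ≤ min 1 (‖y‖ ^ 2) :=
      le_min (pow_le_one₀ hm.le (min_le_right _ _)) (by gcongr)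
    gcongr
  unfold truncationDifference
  by_cases h1 : ‖y‖ < h <;> by_cases h2 : ‖y‖ < 1
  · simpa [indicator, h1, h2] using h0
  · simpa [indicator, h1, h2] using
      key ((min_le_right _ _).trans (not_lt.1 h2)) (h1.le.trans (le_max_left _ _))
  · simpa [indicator, h1, h2] using
      key ((min_le_left _ _).trans (not_lt.1 h1)) (h2.le.trans (le_max_right _ _))
  · simpa [indicator, h1, h2] using h0

/-- The strict inequalities in the drift and the open balls disagree on one sphere, which is null by
hypothesis. The integral form treats `h ≤ 1` and `h > 1` alike. -/
theorem driftAt_eq_add_integral (hν0 : ∀ r, ν {y | ‖y‖ = r} = 0)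
    (b : EuclideanSpace ℝ (Fin d)) (h : ℝ) :
    driftAt ν b h = b + ∫ y, truncationDifference h y ∂ν := by
  have hne : ∀ r, ∀ᵐ y ∂ν, ‖y‖ ≠ r := fun r => by
    rw [ae_iff]; simpa using hν0 r
  have hms : ∀ r s : ℝ, MeasurableSet {y : EuclideanSpace ℝ (Fin d) | r < ‖y‖ ∧ ‖y‖ < s} :=
    fun r s => (measurableSet_lt measurable_const measurable_norm).inter
      (measurableSet_lt measurable_norm measurable_const)
  unfold driftAt
  split_ifs with h1
  · rw [sub_eq_add_neg, ← integral_neg, ← integral_indicator (hms _ _)]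
    congr 1
    refine integral_congr_ae ?_
    filter_upwards [hne h] with y hy
    unfold truncationDifference
    by_cases h2 : ‖y‖ < h
    · have h3 : ‖y‖ < 1 := h2.trans_le h1
      simp [indicator, h2, h3, h2.not_gt]
    · have h4 : h < ‖y‖ := lt_of_le_of_ne (not_lt.1 h2) (Ne.symm hy)
      by_cases h3 : ‖y‖ < 1 <;> simp [indicator, h2, h3, h4]
  · rw [← integral_indicator (hms _ _)]
    congr 1
    refine integral_congr_ae ?_
    filter_upwards [hne 1] with y hy
    unfold truncationDifference
    push Not at h1
    by_cases h2 : ‖y‖ < 1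
    · have h3 : ‖y‖ < h := h2.trans h1
      simp [indicator, h2, h3, h2.not_gt]
    · have h4 : 1 < ‖y‖ := lt_of_le_of_ne (not_lt.1 h2) (Ne.symm hy)
      by_cases h3 : ‖y‖ < h <;> simp [indicator, h2, h3, h4]

/-- Decomposition of the Lévy–Khinchin exponent into drift, small jumps and large jumps. -/
theorem neg_mul_levyExponent_eq (hν : IsLevyMeasure ν) (hν0 : ∀ r, ν {y | ‖y‖ = r} = 0)
    (b ξ : EuclideanSpace ℝ (Fin d)) {t h : ℝ} (ht : 0 < t) (hh : 0 < h) :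
    -(t : ℂ) * levyExponent ν b ξ = Complex.I * (⟪ξ, t • driftAt ν b h⟫ : ℝ)
      + (shiftedExponent (ENNReal.ofReal t • ν.restrict (ball 0 h)) ξ 0 0
        + (charFun (ENNReal.ofReal t • ν.restrict (ball 0 h)ᶜ) ξ
          - (ENNReal.ofReal t • ν.restrict (ball 0 h)ᶜ).real univ)) := by
  set B : Set (EuclideanSpace ℝ (Fin d)) := ball 0 h with hB
  have hBm : MeasurableSet B := measurableSet_ball
  have hfin : IsFiniteMeasure (ν.restrict Bᶜ) :=
    ⟨by simpa using hν.measure_compl_ball_lt_top hh⟩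
  set u : EuclideanSpace ℝ (Fin d) → ℂ := fun y => compensatedExp ((⟪ξ, y⟫ : ℝ) : ℂ) with hu
  set w : EuclideanSpace ℝ (Fin d) → ℂ := fun y =>
    Complex.exp ((⟪y, ξ⟫ : ℝ) * Complex.I) - 1 with hw
  have hui : IntegrableOn u B ν := by
    have := integrable_shiftedExponent_integrand (h := h) (hν.integrableOn_sq_norm h)
      ((ae_restrict_iff' measurableSet_ball).2 (Eventually.of_forall fun y hy =>
        (mem_ball_zero_iff.1 hy).le)) ξ 0 0
    simpa [hu, IntegrableOn] using this
  have hei : Integrable (fun y => Complex.exp ((⟪y, ξ⟫ : ℝ) * Complex.I)) (ν.restrict Bᶜ) := by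
    refine (integrable_const (1 : ℝ)).mono' (Continuous.aestronglyMeasurable (by fun_prop))
      (Eventually.of_forall fun y => ?_)
    rw [Complex.norm_exp_ofReal_mul_I]
  have hwi : IntegrableOn w Bᶜ ν := hei.sub (integrable_const 1)
  have hvi := hν.integrable_truncationDifference hh
  have hpt : ∀ y, Complex.exp (Complex.I * (⟪ξ, y⟫ : ℝ)) - 1 - Complex.I * (⟪ξ, y⟫ : ℝ)
      * (ball (0 : EuclideanSpace ℝ (Fin d)) 1).indicator 1 y
      = B.indicator u y + Bᶜ.indicator w y
        + Complex.I * ((⟪ξ, truncationDifference h y⟫ : ℝ) : ℂ) := by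
    intro y
    have e : Complex.exp ((⟪y, ξ⟫ : ℝ) * Complex.I) = Complex.exp (Complex.I * (⟪ξ, y⟫ : ℝ)) := by
      rw [real_inner_comm, mul_comm]
    unfold truncationDifference
    by_cases h1 : ‖y‖ < h <;> by_cases h2 : ‖y‖ < 1 <;>
      simp [indicator, hB, h1, h2, hu, hw, compensatedExp, e, sub_eq_add_neg]
  have hint : ∫ y, (Complex.exp (Complex.I * (⟪ξ, y⟫ : ℝ)) - 1 - Complex.I * (⟪ξ, y⟫ : ℝ)
      * (ball (0 : EuclideanSpace ℝ (Fin d)) 1).indicator 1 y) ∂ν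
      = ∫ y in B, u y ∂ν + ∫ y in Bᶜ, w y ∂ν
        + Complex.I * ((⟪ξ, ∫ y, truncationDifference h y ∂ν⟫ : ℝ) : ℂ) := by
    simp_rw [hpt]
    have h1 := hui.integrable_indicator hBm
    have h2 := hwi.integrable_indicator hBm.compl
    have h3 : Integrable (fun y => Complex.I * ((⟪ξ, truncationDifference h y⟫ : ℝ) : ℂ)) ν :=
      ((hvi.const_inner ξ).ofReal).const_mul _
    have h12 : Integrable (fun y => B.indicator u y + Bᶜ.indicator w y) ν := h1.add h2
    rw [integral_add h12 h3, integral_add h1 h2, integral_indicator hBm,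
      integral_indicator hBm.compl, integral_const_mul, integral_complex_ofReal,
      integral_inner hvi]
  have hσ : shiftedExponent (ENNReal.ofReal t • ν.restrict B) ξ 0 0 = t * ∫ y in B, u y ∂ν := by
    rw [shiftedExponent, integral_smul_measure, ENNReal.toReal_ofReal ht.le, Complex.real_smul]
    simp [hu]
  have hτ : charFun (ENNReal.ofReal t • ν.restrict Bᶜ) ξ
      - (ENNReal.ofReal t • ν.restrict Bᶜ).real univ = t * ∫ y in Bᶜ, w y ∂ν := by
    rw [charFun_apply, integral_smul_measure, ENNReal.toReal_ofReal ht.le, Complex.real_smul,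
      integral_sub hei (integrable_const 1), measureReal_ennreal_smul_apply,
      ENNReal.toReal_ofReal ht.le]
    simp [mul_sub]
  rw [hσ, hτ, levyExponent, hint, driftAt_eq_add_integral hν0, inner_smul_right, inner_add_right]
  push_cast
  ring

/-- Large jumps contribute at most twice their total mass to the real part. Read backwards, this
transfers a lower bound on `Re Φ` to the small jumps. -/
theorem re_levyExponent_le (hν : IsLevyMeasure ν) (hν0 : ∀ r, ν {y | ‖y‖ = r} = 0)
    (b ξ : EuclideanSpace ℝ (Fin d)) {t h : ℝ} (ht : 0 < t) (hh : 0 < h) :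
    t * (levyExponent ν b ξ).re
      ≤ ∫ y, (1 - Real.cos ⟪ξ, y⟫) ∂(ENNReal.ofReal t • ν.restrict (ball 0 h))
        + 2 * (ENNReal.ofReal t • ν.restrict (ball 0 h)ᶜ).real univ := by
  set σ := ENNReal.ofReal t • ν.restrict (ball 0 h)
  set τ := ENNReal.ofReal t • ν.restrict (ball 0 h)ᶜ
  have hσ2 : Integrable (fun y => ‖y‖ ^ 2) σ :=
    (hν.integrableOn_sq_norm h).smul_measure ENNReal.ofReal_ne_top
  have hσh : ∀ᵐ y ∂σ, ‖y‖ ≤ h := Measure.ae_smul_measure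
    ((ae_restrict_iff' measurableSet_ball).2 (Eventually.of_forall fun y hy =>
        (mem_ball_zero_iff.1 hy).le)) _
  have h1 := congrArg Complex.re (neg_mul_levyExponent_eq hν hν0 b ξ ht hh)
  have h2 : (shiftedExponent σ ξ 0 0).re = -∫ y, (1 - Real.cos ⟪ξ, y⟫) ∂σ := by
    have hi := integrable_shiftedExponent_integrand hσ2 hσh ξ 0 0
    have : (shiftedExponent σ ξ 0 0).re
        = ∫ y, (compensatedExp (⟪ξ, y⟫ + 0 * ⟪(0 : EuclideanSpace ℝ (Fin d)), y⟫)).re ∂σ :=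
      (integral_re hi).symm
    rw [this, ← integral_neg]
    refine integral_congr_ae (Eventually.of_forall fun y => ?_)
    simp only [compensatedExp, zero_mul, add_zero]
    rw [mul_comm]
    simp only [Complex.sub_re, Complex.exp_ofReal_mul_I_re, Complex.one_re, Complex.mul_re,
      Complex.ofReal_re, Complex.I_re, mul_zero, Complex.ofReal_im, Complex.I_im, zero_mul,
      sub_zero]
    ring
  have h3 : -(2 * τ.real univ) ≤ (charFun τ ξ - τ.real univ).re := by
    have h4 : -(τ.real univ) ≤ (charFun τ ξ).re :=
      (abs_le.1 ((Complex.abs_re_le_norm _).trans (norm_charFun_le ξ))).1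
    rw [Complex.sub_re, Complex.ofReal_re]
    linarith
  rw [Complex.add_re, Complex.add_re, h2] at h1
  have h5 : (-(t : ℂ) * levyExponent ν b ξ).re = -(t * (levyExponent ν b ξ).re) := by simp
  have h6 : (Complex.I * ((⟪ξ, t • driftAt ν b h⟫ : ℝ) : ℂ)).re = 0 := by simp
  rw [h5, h6] at h1
  linarith

end LevyMeasures

/-! ### Consequences of the polar domination of `ν`. -/

section PolarDomination

open Filter Topology

variable {d : ℕ} {ν : Measure (EuclideanSpace ℝ (Fin d))}
  {μ : Measure (sphere (0 : EuclideanSpace ℝ (Fin d)) 1)} [IsFiniteMeasure μ] {α : ℝ} {q φ : ℝ → ℝ}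

/-- The radial density `s^{-1-α} q(s) φ(s)/φ(s/2)`. -/
noncomputable def tiltedRadialDensity (α : ℝ) (q φ : ℝ → ℝ) (s : ℝ) : ℝ≥0∞ :=
  ENNReal.ofReal (s ^ (-1 - α) * q s * (φ s / φ (s / 2)))

theorem aemeasurable_tiltedRadialDensity (hq_anti : AntitoneOn q (Ici 0))
    (hφ_anti : AntitoneOn φ (Ici 0)) :
    AEMeasurable (tiltedRadialDensity α q φ) (volume.restrict (Ioi 0)) :=
  (aemeasurable_weighted_profile hq_anti hφ_anti _).ennreal_ofReal

theorem PolarDominated.lintegral_le (hν : PolarDominated ν μ α q φ)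
    (hq_anti : AntitoneOn q (Ici 0))
    (hφ_pos : ∀ s, 0 ≤ s → 0 < φ s) (hφ_anti : AntitoneOn φ (Ici 0))
    {F : EuclideanSpace ℝ (Fin d) → ℝ≥0∞} (hF : Measurable F) :
    ∫⁻ y, F y ∂ν ≤ ∫⁻ y, F y * ENNReal.ofReal (φ (‖y‖ / 2))
      ∂polarMeasure μ (tiltedRadialDensity α q φ) := by
  set k₀ : ℝ → ℝ≥0∞ := fun s => ENNReal.ofReal (s ^ (-1 - α) * q s * φ s) with hk₀
  have hk₀m : AEMeasurable k₀ (volume.restrict (Ioi 0)) := by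
    have h4 : Measurable fun s : ℝ => s ^ (-1 - α) := by fun_prop
    exact ((h4.aemeasurable.mul (aemeasurable_restrict_Ioi_of_antitoneOn hq_anti)).mul
      (aemeasurable_restrict_Ioi_of_antitoneOn hφ_anti)).ennreal_ofReal
  have hle : ν ≤ polarMeasure μ k₀ := by
    refine Measure.le_intro fun A hA _ => ?_
    rw [← lintegral_indicator_one (μ := polarMeasure μ k₀) hA,
      lintegral_polarMeasure μ hk₀m (measurable_one.indicator hA)]
    exact hν A hA
  have hw : Measurable fun y : EuclideanSpace ℝ (Fin d) => ENNReal.ofReal (φ (‖y‖ / 2)) :=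
    (antitoneOn_comp_div hφ_anti two_pos).measurable_comp_norm.ennreal_ofReal
  have hFw : Measurable fun y => F y * ENNReal.ofReal (φ (‖y‖ / 2)) := hF.mul hw
  refine (lintegral_mono' hle le_rfl).trans (le_of_eq ?_)
  rw [lintegral_polarMeasure μ hk₀m hF, lintegral_polarMeasure μ
    (aemeasurable_tiltedRadialDensity hq_anti hφ_anti) hFw]
  refine lintegral_congr fun θ => setLIntegral_congr_fun measurableSet_Ioi fun s hs => ?_
  have hs' : 0 < s := hs
  have h1 := hφ_pos (s / 2) (by positivity)
  simp only [norm_smul_sphere hs', hk₀, tiltedRadialDensity]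
  rw [mul_assoc (F _), ← ENNReal.ofReal_mul h1.le]
  congr 2
  field_simp

theorem PolarDominated.measure_norm_eq (hν : PolarDominated ν μ α q φ)
    (hq_anti : AntitoneOn q (Ici 0))
    (hφ_pos : ∀ s, 0 ≤ s → 0 < φ s) (hφ_anti : AntitoneOn φ (Ici 0)) (r : ℝ) :
    ν {y | ‖y‖ = r} = 0 := by
  have hm : MeasurableSet {y : EuclideanSpace ℝ (Fin d) | ‖y‖ = r} :=
    measurableSet_eq_fun measurable_norm measurable_const
  have h1 := hν.lintegral_le hq_anti hφ_pos hφ_anti (measurable_one.indicator hm)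
  rw [lintegral_indicator_one hm] at h1
  refine le_antisymm (h1.trans (le_of_eq ?_)) zero_le
  have h2 := polarMeasure_norm_eq μ
    (aemeasurable_tiltedRadialDensity (α := α) hq_anti hφ_anti) r
  refine (lintegral_congr_ae ?_).trans lintegral_zero
  filter_upwards [measure_eq_zero_iff_ae_notMem.1 h2] with y hy
  simp only [indicator, mem_ofPred_eq] at hy ⊢
  rw [if_neg hy, zero_mul]

/-- Bounding the weight `φ(s/2)` by `φ(0)` leaves `s² · s^{-1-α} = s^{1-α}`, the integrand of the
growth condition. -/
theorem PolarDominated.lintegral_sq_norm_le (hν : PolarDominated ν μ α q φ)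
    (hq_anti : AntitoneOn q (Ici 0))
    (hφ_pos : ∀ s, 0 ≤ s → 0 < φ s) (hφ_anti : AntitoneOn φ (Ici 0)) (h : ℝ) :
    ∫⁻ y in ball 0 h, ENNReal.ofReal (‖y‖ ^ 2) ∂ν
      ≤ ENNReal.ofReal (φ 0) * (μ univ * ∫⁻ s in Ioc 0 h,
          ENNReal.ofReal (s ^ (1 - α) * q s * (φ s / φ (s / 2)))) := by
  set f : ℝ → ℝ≥0∞ := (Iio h).indicator fun s => ENNReal.ofReal (s ^ 2) with hf
  have hfm : Measurable f := (by fun_prop : Measurable fun s : ℝ => ENNReal.ofReal (s ^ 2)).indicator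
    measurableSet_Iio
  have hk := aemeasurable_tiltedRadialDensity (α := α) hq_anti hφ_anti
  calc ∫⁻ y in ball 0 h, ENNReal.ofReal (‖y‖ ^ 2) ∂ν = ∫⁻ y, f ‖y‖ ∂ν := by
        rw [← lintegral_indicator measurableSet_ball]
        refine lintegral_congr fun y => ?_
        simp [hf, indicator]
    _ ≤ ∫⁻ y, f ‖y‖ * ENNReal.ofReal (φ (‖y‖ / 2))
          ∂polarMeasure μ (tiltedRadialDensity α q φ) :=
        hν.lintegral_le hq_anti hφ_pos hφ_anti (by fun_prop)
    _ ≤ ∫⁻ y, ENNReal.ofReal (φ 0) * f ‖y‖ ∂polarMeasure μ (tiltedRadialDensity α q φ) := by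
        refine lintegral_mono fun y => ?_
        rw [mul_comm]
        gcongr
        exact hφ_anti self_mem_Ici (mem_Ici.2 (by positivity)) (by positivity)
    _ = ENNReal.ofReal (φ 0) * (μ univ * ∫⁻ s in Ioi (0 : ℝ), f s * tiltedRadialDensity α q φ s) := by
        rw [lintegral_const_mul _ (by fun_prop), lintegral_polarMeasure_radial μ hk hfm]
    _ ≤ _ := by
        refine mul_le_mul_right (mul_le_mul_right ?_ _) _
        rw [← lintegral_indicator measurableSet_Ioi, ← lintegral_indicator measurableSet_Ioc]
        refine lintegral_mono fun s => ?_
        by_cases hs : 0 < s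
        · by_cases hsh : s < h
          · have hs2 : s ^ 2 = s ^ (2 : ℝ) := by norm_cast
            rw [indicator_of_mem (show s ∈ Ioi (0 : ℝ) from hs),
              indicator_of_mem (show s ∈ Ioc (0 : ℝ) h from ⟨hs, hsh.le⟩), hf,
              indicator_of_mem (show s ∈ Iio h from hsh), tiltedRadialDensity,
              ← ENNReal.ofReal_mul (by positivity), hs2, ← mul_assoc, ← mul_assoc,
              ← Real.rpow_add hs]
            ring_nf
            exact le_rfl
          · simp [hf, indicator, hsh]
        · simp [indicator, hs]

theorem polarMeasure_compl_ball (hq_anti : AntitoneOn q (Ici 0))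
    (hφ_anti : AntitoneOn φ (Ici 0)) {h : ℝ} (hh : 0 < h) :
    polarMeasure μ (tiltedRadialDensity α q φ) (ball 0 h)ᶜ
      = μ univ * ∫⁻ s in Ioi h, tiltedRadialDensity α q φ s := by
  have h1 := lintegral_polarMeasure_radial μ
    (aemeasurable_tiltedRadialDensity (α := α) hq_anti hφ_anti) (f := (Ici h).indicator 1)
    (measurable_one.indicator measurableSet_Ici)
  rw [← lintegral_indicator_one (measurableSet_ball).compl]
  refine Eq.trans (lintegral_congr fun y => ?_) (h1.trans ?_)
  · simp [indicator]
  · congr 1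
    rw [setLIntegral_congr (Ioi_ae_eq_Ici (a := h)), ← lintegral_indicator measurableSet_Ioi,
      ← lintegral_indicator measurableSet_Ici]
    refine lintegral_congr fun s => ?_
    by_cases hs : h ≤ s
    · have : 0 < s := hh.trans_le hs
      simp [indicator, hs, this]
    · simp [indicator, hs]

end PolarDomination

/-! ### Transition densities at the scale adapted to time. -/

section TransitionDensities

open Filter Topology

variable {d : ℕ} {α β γ : ℝ} {q φ : ℝ → ℝ}
  {μ : Measure (sphere (0 : EuclideanSpace ℝ (Fin d)) 1)} [IsFiniteMeasure μ]

/-- Bounds for the density of `P_t` at a scale `h` adapted to the time `t`. -/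
theorem exists_density_bound_at_scale (hd : 1 ≤ d) (hα : 0 < α) (hγ : 1 ≤ γ)
    (hq_pos : ∀ s, 0 ≤ s → 0 < q s) (hq_anti : AntitoneOn q (Ici 0))
    (hφ_pos : ∀ s, 0 ≤ s → 0 < φ s) (hφ_anti : AntitoneOn φ (Ici 0))
    (hq_doubling : ∃ κ₁ : ℝ, 0 < κ₁ ∧ ∀ s, 0 < s → q s ≤ κ₁ * q (2 * s))
    (hφ_mul : ∃ κ₂ : ℝ, 0 < κ₂ ∧ ∀ a b, 0 ≤ a → 0 ≤ b → φ a * φ b ≤ κ₂ * φ (a + b))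
    {cμ : ℝ} (hcμ : 0 < cμ)
    (hμ : ∀ (θ : sphere (0 : EuclideanSpace ℝ (Fin d)) 1) (ρ : ℝ), 0 < ρ →
      μ (ball θ ρ) ≤ ENNReal.ofReal (cμ * ρ ^ (γ - 1)))
    {c₀ : ℝ} (hc₀ : 0 < c₀) {A : ℝ} (hA : cμ * 4 ^ γ ≤ A) :
    ∃ B K, 0 < B ∧ 0 < K ∧ ∀ (ν : Measure (EuclideanSpace ℝ (Fin d)))
      (b : EuclideanSpace ℝ (Fin d)) (P : ℝ → Measure (EuclideanSpace ℝ (Fin d))) (t h : ℝ),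
      IsLevyMeasure ν → PolarDominated ν μ α q φ →
      (∀ ξ, c₀ * min (‖ξ‖ ^ α) (‖ξ‖ ^ β) ≤ (levyExponent ν b ξ).re) →
      IsLevySemigroup ν b P → 0 < t → 0 < h →
      (∀ u, 0 ≤ u → (h * u) ^ α - 1 ≤ t * min (u ^ α) (u ^ β)) →
      t * (φ 0 * (μ.real univ * (∫⁻ s in Ioc 0 h,
          ENNReal.ofReal (s ^ (1 - α) * q s * (φ s / φ (s / 2)))).toReal)) ≤ A * h ^ 2 →
      ∫⁻ s in Ioc 0 h, ENNReal.ofReal (s ^ (1 - α) * q s * (φ s / φ (s / 2))) ≠ ∞ →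
      t * (μ.real univ * (∫⁻ s in Ioi h, tiltedRadialDensity α q φ s).toReal) ≤ A →
      ∫⁻ s in Ioi h, tiltedRadialDensity α q φ s ≠ ∞ →
      ∃ p : EuclideanSpace ℝ (Fin d) → ℝ, Continuous p ∧ (∀ x, 0 ≤ p x) ∧
        P t = volume.withDensity (fun x => ENNReal.ofReal (p x)) ∧
        (∀ x, p (x + t • driftAt ν b h) ≤ B * (h ^ d)⁻¹) ∧
        ∀ x, x ≠ 0 → p (x + t • driftAt ν b h) ≤ B * (h ^ d)⁻¹ *
          (Real.exp (-(1 / 8 * (‖x‖ / h) * Real.log (1 + 1 / 2 * (‖x‖ / h))))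
            + K * (t * h ^ γ * ‖x‖ ^ (-γ - α) * q ‖x‖ * φ (‖x‖ / 4))) := by
  obtain ⟨κ₁, hκ₁, hq_doubling⟩ := hq_doubling
  obtain ⟨κ₂, hκ₂, hφ_mul⟩ := hφ_mul
  have hA0 : 0 < A := lt_of_lt_of_le (by positivity) hA
  have hφ0 := hφ_pos 0 le_rfl
  have : Nonempty (Fin d) := ⟨⟨0, hd⟩⟩
  -- The additive loss `C` has two sources: `c₀` from the `-1` in the scale condition, and `2 φ(0)
  -- A` from removing large jumps of total mass at most `φ(0) A`.
  obtain ⟨B, K, hB, hK, hmain⟩ := exists_density_upper_bound (E := EuclideanSpace ℝ (Fin d))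
    (c := c₀) (C := c₀ + 2 * (φ 0 * A)) (A := A) (γ := γ) (by positivity) hc₀ hA0 hα
    (by linarith) hq_pos hφ_pos hφ_anti hκ₁ hq_doubling hκ₂ hφ_mul
  rw [finrank_euclideanSpace_fin] at hmain
  refine ⟨B, K, hB, hK, ?_⟩
  intro ν b P t h hν hdom hre hP ht hh hscale hin hin_top hout hout_top
  have hν0 := hdom.measure_norm_eq hq_anti hφ_pos hφ_anti
  set σ := ENNReal.ofReal t • ν.restrict (ball 0 h) with hσ_def
  set τ := ENNReal.ofReal t • ν.restrict (ball 0 h)ᶜ with hτ_def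
  set Λ := ENNReal.ofReal t •
    (polarMeasure μ (tiltedRadialDensity α q φ)).restrict (ball 0 h)ᶜ with hΛ_def
  have hkm := aemeasurable_tiltedRadialDensity (α := α) hq_anti hφ_anti
  have hPt := hP.isProbabilityMeasure t ht.le
  have hνfin : IsFiniteMeasure (ν.restrict (ball 0 h)ᶜ) :=
    ⟨by simpa using hν.measure_compl_ball_lt_top hh⟩
  have hτfin : IsFiniteMeasure τ := ⟨by
    rw [hτ_def, Measure.smul_apply, smul_eq_mul]
    exact ENNReal.mul_lt_top ENNReal.ofReal_lt_top (measure_lt_top _ _)⟩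
  have hσ2 : Integrable (fun y => ‖y‖ ^ 2) σ :=
    (hν.integrableOn_sq_norm h).smul_measure ENNReal.ofReal_ne_top
  have hσh : ∀ᵐ y ∂σ, ‖y‖ ≤ h := Measure.ae_smul_measure
    ((ae_restrict_iff' measurableSet_ball).2 (Eventually.of_forall fun y hy =>
        (mem_ball_zero_iff.1 hy).le)) _
  have hσA : ∫ y, ‖y‖ ^ 2 ∂σ ≤ A * h ^ 2 := by
    rw [hσ_def, integral_smul_measure, ENNReal.toReal_ofReal ht.le, smul_eq_mul]
    refine le_trans (mul_le_mul_of_nonneg_left ?_ ht.le) hin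
    rw [integral_eq_lintegral_of_nonneg_ae (Eventually.of_forall fun y => by
      simp only [Pi.zero_apply]; positivity) (Continuous.aestronglyMeasurable (by fun_prop))]
    refine (ENNReal.toReal_mono ?_ (hdom.lintegral_sq_norm_le hq_anti hφ_pos hφ_anti
      h)).trans (le_of_eq ?_)
    · exact ENNReal.mul_ne_top ENNReal.ofReal_ne_top
        (ENNReal.mul_ne_top (measure_ne_top _ _) hin_top)
    · rw [ENNReal.toReal_mul, ENNReal.toReal_mul, ENNReal.toReal_ofReal hφ0.le]; rfl
  have hΛA : Λ univ ≤ ENNReal.ofReal A := by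
    rw [hΛ_def, Measure.smul_apply, Measure.restrict_apply_univ, smul_eq_mul,
      polarMeasure_compl_ball hq_anti hφ_anti hh]
    refine le_trans (le_of_eq ?_) (ENNReal.ofReal_le_ofReal hout)
    rw [ENNReal.ofReal_mul ht.le, ENNReal.ofReal_mul measureReal_nonneg, ofReal_measureReal,
      ENNReal.ofReal_toReal hout_top]
  have hτΛ : ∀ F : EuclideanSpace ℝ (Fin d) → ℝ≥0∞, Measurable F →
      ∫⁻ y, F y ∂τ ≤ ∫⁻ y, F y * ENNReal.ofReal (φ (‖y‖ / 2)) ∂Λ := by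
    intro F hF
    rw [hτ_def, hΛ_def, lintegral_smul_measure, lintegral_smul_measure]
    refine mul_le_mul_right ?_ _
    rw [← lintegral_indicator measurableSet_ball.compl,
      ← lintegral_indicator measurableSet_ball.compl]
    refine (hdom.lintegral_le hq_anti hφ_pos hφ_anti
      (hF.indicator measurableSet_ball.compl)).trans (le_of_eq (lintegral_congr fun y => ?_))
    rw [indicator_mul_left]
  have hτA : τ.real univ ≤ φ 0 * A := by
    refine ENNReal.toReal_le_of_le_ofReal (by positivity) ?_
    calc τ univ = ∫⁻ _, 1 ∂τ := by simp
      _ ≤ ∫⁻ y, 1 * ENNReal.ofReal (φ (‖y‖ / 2)) ∂Λ := hτΛ _ measurable_const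
      _ ≤ ∫⁻ _, ENNReal.ofReal (φ 0) ∂Λ := by
          refine lintegral_mono fun y => ?_
          rw [one_mul]
          exact ENNReal.ofReal_le_ofReal
            (hφ_anti self_mem_Ici (mem_Ici.2 (by positivity)) (by positivity))
      _ = ENNReal.ofReal (φ 0) * Λ univ := by simp
      _ ≤ ENNReal.ofReal (φ 0) * ENNReal.ofReal A := by gcongr
      _ = _ := by rw [ENNReal.ofReal_mul hφ0.le]
  refine hmain σ τ Λ (P t) (t • driftAt ν b h) t h ht hh hPt hτfin hσ2 hσh hσA (fun ξ => ?_)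
    hΛA hτΛ (fun r a u hr ha => ?_) (fun ξ => ?_)
  · have h1 := re_levyExponent_le hν hν0 b ξ ht hh
    have h2 := mul_le_mul_of_nonneg_left (hre ξ) ht.le
    have h3 := mul_le_mul_of_nonneg_left (hscale ‖ξ‖ (norm_nonneg ξ)) hc₀.le
    have h4 : t * (c₀ * min (‖ξ‖ ^ α) (‖ξ‖ ^ β)) = c₀ * (t * min (‖ξ‖ ^ α) (‖ξ‖ ^ β)) := by ring
    linarith
  · have hqa := hq_pos a ha.le
    have hbound := polarMeasure_annulus_ball_le μ (k := tiltedRadialDensity α q φ) hcμ.le hμ ha hr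
      (M := a ^ (-1 - α) * q a) (by positivity) (fun s hs => by
        have hs0 : 0 < s := ha.trans_le hs
        refine ENNReal.ofReal_le_ofReal ?_
        have h1 := ratio_le_one hφ_pos hφ_anti hs0.le
        have h2 := hq_pos s hs0.le
        have h3 : q s ≤ q a := hq_anti ha.le hs0.le hs
        have h4 : s ^ (-1 - α) ≤ a ^ (-1 - α) :=
          Real.rpow_le_rpow_of_nonpos ha hs (by linarith)
        calc s ^ (-1 - α) * q s * (φ s / φ (s / 2)) ≤ s ^ (-1 - α) * q s * 1 := by gcongr
          _ ≤ a ^ (-1 - α) * q a := by rw [mul_one]; gcongr) u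
    rw [hΛ_def, Measure.smul_apply, smul_eq_mul]
    calc _ ≤ ENNReal.ofReal t * ENNReal.ofReal
            (cμ * 4 ^ γ * r ^ γ * (a ^ (1 - γ) * (a ^ (-1 - α) * q a))) :=
          mul_le_mul_right ((Measure.restrict_apply_le _ _).trans hbound) _
      _ ≤ _ := by
          rw [← ENNReal.ofReal_mul ht.le, ← mul_assoc (a ^ (1 - γ)), ← Real.rpow_add ha,
            show 1 - γ + (-1 - α) = -γ - α by ring]
          refine ENNReal.ofReal_le_ofReal ?_
          calc _ = (cμ * 4 ^ γ) * (t * r ^ γ * (a ^ (-γ - α) * q a)) := by ring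
            _ ≤ A * (t * r ^ γ * (a ^ (-γ - α) * q a)) := by gcongr
            _ = _ := by ring
  · rw [hP.charFun_eq t ht.le, neg_mul_levyExponent_eq hν hν0 b ξ ht hh, Complex.exp_add,
      Complex.exp_add, charFun_compoundPoisson]

theorem exists_exp_lower_bound_of_doubling
    (hq_pos : ∀ s, 0 ≤ s → 0 < q s) (hq_anti : AntitoneOn q (Ici 0))
    (hq_doubling : ∃ κ₁ : ℝ, 0 < κ₁ ∧ ∀ s, 0 < s → q s ≤ κ₁ * q (2 * s)) :
    ∃ c k, 0 < c ∧ 0 ≤ k ∧ ∀ ρ, 0 ≤ ρ → c * Real.exp (-(k * ρ)) ≤ q ρ := by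
  obtain ⟨κ, hκ, hq⟩ := hq_doubling
  have h0 := hq_pos 0 le_rfl
  have h1 := hq_pos 1 zero_le_one
  -- For `n ≥ 1`, doubling applies because `n + 1 ≤ 2n`. At `n = 0` it is unavailable, and the ratio
  -- `q 1 / q 0` takes its place.
  refine exists_exp_lower_bound (δ := min (q 1 / q 0) κ⁻¹) hq_pos hq_anti
    (lt_min (by positivity) (by positivity)) fun n => ?_
  have hn := hq_pos n (Nat.cast_nonneg n)
  rcases Nat.eq_zero_or_pos n with rfl | hn0
  · simp only [Nat.cast_zero, zero_add]
    calc min (q 1 / q 0) κ⁻¹ * q 0 ≤ q 1 / q 0 * q 0 := by gcongr; exact min_le_left _ _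
      _ = q 1 := by field_simp
  · have hn1 : (1 : ℝ) ≤ n := by exact_mod_cast hn0
    calc min (q 1 / q 0) κ⁻¹ * q n ≤ κ⁻¹ * q n := by gcongr; exact min_le_right _ _
      _ ≤ κ⁻¹ * (κ * q (2 * n)) := by gcongr; exact hq n (by linarith)
      _ = q (2 * n) := by field_simp
      _ ≤ q (n + 1) := hq_anti (mem_Ici.2 (by linarith)) (mem_Ici.2 (by linarith)) (by linarith)

theorem exists_exp_lower_bound_of_submultiplicative
    (hφ_pos : ∀ s, 0 ≤ s → 0 < φ s) (hφ_anti : AntitoneOn φ (Ici 0))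
    (hφ_mul : ∃ κ₂ : ℝ, 0 < κ₂ ∧ ∀ a b, 0 ≤ a → 0 ≤ b → φ a * φ b ≤ κ₂ * φ (a + b)) :
    ∃ c k, 0 < c ∧ 0 ≤ k ∧ ∀ ρ, 0 ≤ ρ → c * Real.exp (-(k * ρ)) ≤ φ ρ := by
  obtain ⟨κ, hκ, hφ⟩ := hφ_mul
  have h1 := hφ_pos 1 zero_le_one
  refine exists_exp_lower_bound (δ := φ 1 / κ) hφ_pos hφ_anti (by positivity) fun n => ?_
  rw [div_mul_eq_mul_div, div_le_iff₀ hκ, mul_comm (φ _) κ, mul_comm (φ 1)]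
  exact hφ n 1 (Nat.cast_nonneg n) zero_le_one

/-- The superexponential term is absorbed by the polynomial profile. -/
theorem exists_exp_neg_mul_log_le_profile (hα : 0 < α) (hγ : 1 ≤ γ)
    (hq_pos : ∀ s, 0 ≤ s → 0 < q s) (hq_anti : AntitoneOn q (Ici 0))
    (hφ_pos : ∀ s, 0 ≤ s → 0 < φ s) (hφ_anti : AntitoneOn φ (Ici 0))
    (hq_doubling : ∃ κ₁ : ℝ, 0 < κ₁ ∧ ∀ s, 0 < s → q s ≤ κ₁ * q (2 * s))
    (hφ_mul : ∃ κ₂ : ℝ, 0 < κ₂ ∧ ∀ a b, 0 ≤ a → 0 ≤ b → φ a * φ b ≤ κ₂ * φ (a + b)) :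
    ∃ C, 0 < C ∧ ∀ R ρ, 0 < ρ → ρ ≤ R →
      Real.exp (-(1 / 8 * R * Real.log (1 + 1 / 2 * R)))
        ≤ C * (R ^ (-(γ + α)) * (q ρ * φ (ρ / 4))) := by
  obtain ⟨c, k, hc, hk, hq⟩ := exists_exp_lower_bound_of_doubling hq_pos hq_anti hq_doubling
  obtain ⟨c', k', hc', hk', hφ⟩ :=
    exists_exp_lower_bound_of_submultiplicative hφ_pos hφ_anti hφ_mul
  refine exists_exp_neg_mul_log_le_rpow_mul (f := fun ρ => q ρ * φ (ρ / 4)) (c := c * c')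
    (k := k + k' / 4) (by positivity) (by positivity) (by norm_num) (by norm_num) (by linarith)
    fun ρ hρ => ?_
  calc c * c' * Real.exp (-((k + k' / 4) * ρ))
      = (c * Real.exp (-(k * ρ))) * (c' * Real.exp (-(k' * (ρ / 4)))) := by
        rw [show -((k + k' / 4) * ρ) = -(k * ρ) + -(k' * (ρ / 4)) by ring, Real.exp_add]; ring
    _ ≤ _ := by
        have h1 := hq_pos ρ hρ
        have h2 := hφ (ρ / 4) (by positivity)
        have h3 := hq ρ hρ
        gcongr

/-- With `h^α = t` the left side is `t u^α - 1`: for `u ≥ 1` the minimum is `u^α`, and for `u ≤ 1`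
the left side is nonpositive. -/
theorem rpow_sub_one_le_mul_min_of_le_one (hα : 0 < α) (hβ : α ≤ β) {t : ℝ} (ht : 0 < t)
    (ht1 : t ≤ 1) {u : ℝ} (hu : 0 ≤ u) :
    (t ^ (1 / α) * u) ^ α - 1 ≤ t * min (u ^ α) (u ^ β) := by
  have h1 : (t ^ (1 / α)) ^ α = t := by
    rw [← Real.rpow_mul ht.le, one_div_mul_cancel hα.ne', Real.rpow_one]
  have h2 := Real.rpow_nonneg hu α
  have h3 := Real.rpow_nonneg hu β
  rw [Real.mul_rpow (by positivity) hu, h1]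
  rcases le_total 1 u with h | h
  · rw [min_eq_left (Real.rpow_le_rpow_of_exponent_le h hβ)]
    linarith
  · have h4 : u ^ α ≤ 1 := Real.rpow_le_one hu h hα.le
    have h5 : 0 ≤ t * min (u ^ α) (u ^ β) := by positivity
    nlinarith

/-- Against `u^α` one uses `h^α ≤ h^β = t`; against `u^β`, that `v^α - 1 ≤ v^β` for `v = hu ≥ 0`. -/
theorem rpow_sub_one_le_mul_min_of_one_lt (hα : 0 < α) (hβ : α ≤ β) {t : ℝ} (ht1 : 1 < t)
    {u : ℝ} (hu : 0 ≤ u) :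
    (t ^ (1 / β) * u) ^ α - 1 ≤ t * min (u ^ α) (u ^ β) := by
  have hβ0 : 0 < β := hα.trans_le hβ
  have ht : 0 < t := by linarith
  have hv : 0 ≤ t ^ (1 / β) * u := by positivity
  have h1 : (t ^ (1 / β)) ^ β = t := by
    rw [← Real.rpow_mul ht.le, one_div_mul_cancel hβ0.ne', Real.rpow_one]
  have hle1 : (1 : ℝ) ≤ t ^ (1 / β) := Real.one_le_rpow ht1.le (by positivity)
  have h2 : (t ^ (1 / β)) ^ α ≤ t := by
    calc (t ^ (1 / β)) ^ α ≤ (t ^ (1 / β)) ^ β := Real.rpow_le_rpow_of_exponent_le hle1 hβ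
      _ = t := h1
  have h3 : (t ^ (1 / β) * u) ^ α ≤ t * u ^ α := by
    rw [Real.mul_rpow (by positivity) hu]; gcongr
  have h4 : (t ^ (1 / β) * u) ^ β = t * u ^ β := by rw [Real.mul_rpow (by positivity) hu, h1]
  rw [mul_min_of_nonneg _ _ ht.le, le_min_iff]
  refine ⟨by linarith, ?_⟩
  rw [← h4]
  rcases le_total 1 (t ^ (1 / β) * u) with h | h
  · linarith [Real.rpow_le_rpow_of_exponent_le h hβ]
  · linarith [Real.rpow_le_one hv h hα.le, Real.rpow_nonneg hv β]

end TransitionDensities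

/-! ### Scaling arithmetic and combination of bounds. -/

section ScaleConditions

/-- Since `t = h^δ`, the factor `t` cancels `h^{-δ}`. The exponent `e = 2` serves the second moment,
`e = 0` the tail mass. -/
theorem mul_toReal_le_of_le_ofReal {I : ℝ≥0∞} {t h δ k e : ℝ} (hh : 0 < h) (ht : h ^ δ = t)
    (hk : 0 ≤ k) (hI : I ≤ ENNReal.ofReal (k * h ^ (e - δ))) : t * I.toReal ≤ k * h ^ e := by
  have ht0 : 0 ≤ t := ht ▸ (Real.rpow_pos_of_pos hh δ).le
  have h1 : I.toReal ≤ k * h ^ (e - δ) := ENNReal.toReal_le_of_le_ofReal (by positivity) hI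
  calc t * I.toReal ≤ t * (k * h ^ (e - δ)) := by gcongr
    _ = k * h ^ e := by
        rw [← ht, mul_left_comm, ← Real.rpow_add hh, add_sub_cancel]

theorem rpow_one_div_rpow {t δ : ℝ} (ht : 0 < t) (hδ : 0 < δ) : (t ^ (1 / δ)) ^ δ = t := by
  rw [← Real.rpow_mul ht.le, one_div_mul_cancel hδ.ne', Real.rpow_one]

theorem inv_pow_rpow_one_div {t : ℝ} (ht : 0 < t) (δ : ℝ) (d : ℕ) :
    ((t ^ (1 / δ)) ^ d)⁻¹ = t ^ (-(d : ℝ) / δ) := by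
  rw [← Real.rpow_natCast, ← Real.rpow_mul ht.le, ← Real.rpow_neg ht.le]
  congr 1
  ring

theorem mul_rpow_one_div_rpow {t : ℝ} (ht : 0 < t) (δ γ : ℝ) :
    t * (t ^ (1 / δ)) ^ γ = t ^ (1 + γ / δ) := by
  rw [← Real.rpow_mul ht.le, Real.rpow_add ht, Real.rpow_one]
  congr 2
  ring

theorem div_rpow_one_div {t : ℝ} (ht : 0 < t) (δ r : ℝ) :
    r / t ^ (1 / δ) = t ^ (-1 / δ) * r := by
  rw [neg_div, Real.rpow_neg ht.le, div_eq_inv_mul]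

/-- The uniform bound serves when `X ≥ 1`, the decaying one when `X ≤ 1`; in the latter `e` is
absorbed into `X`. -/
theorem le_mul_min_one {y B C K H X e : ℝ} (hB : 0 < B) (hC : 0 < C) (hK : 0 < K) (hH : 0 < H)
    (hX : 0 ≤ X) (h1 : y ≤ B * H) (h2 : y ≤ B * H * (e + K * X)) (he : e ≤ C * X) :
    y ≤ B * (1 + C + K) * H * min 1 X := by
  have hBH : 0 < B * H := mul_pos hB hH
  rcases le_total 1 X with h | h
  · rw [min_eq_left h]
    nlinarith
  · rw [min_eq_right h]
    have : B * H * (e + K * X) ≤ B * H * ((1 + C + K) * X) := by gcongr; nlinarith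
    linarith

theorem le_mul_min_one_add {y B K H X e : ℝ} (hB : 0 < B) (hK : 0 < K) (hH : 0 < H)
    (hX : 0 ≤ X) (he : 0 ≤ e) (h1 : y ≤ B * H) (h2 : y ≤ B * H * (e + K * X)) :
    y ≤ B * (1 + K) * H * (min 1 X + e) := by
  have hBH : 0 < B * H := mul_pos hB hH
  rcases le_total 1 X with h | h
  · rw [min_eq_left h]
    have : B * H * 1 ≤ B * H * ((1 + K) * (1 + e)) := by gcongr; nlinarith
    linarith
  · rw [min_eq_right h]
    have : B * H * (e + K * X) ≤ B * H * ((1 + K) * (X + e)) := by gcongr; nlinarith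
    linarith

end ScaleConditions

/-! ### The main theorem. -/

theorem theorem1 {d : ℕ} (hd : 1 ≤ d) (α β γ : ℝ)
    (hα : α ∈ Ioo (0 : ℝ) 2) (hβ : β ∈ Icc α 2) (hγ : γ ∈ Icc (1 : ℝ) d)
    (μ : Measure (sphere (0 : EuclideanSpace ℝ (Fin d)) 1)) [IsFiniteMeasure μ]
    (q φ : ℝ → ℝ)
    -- `q` and `φ` are positive and nonincreasing (hence bounded) on `[0, ∞)`
    (hq_pos : ∀ s, 0 ≤ s → 0 < q s) (hq_anti : AntitoneOn q (Ici 0))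
    (hφ_pos : ∀ s, 0 ≤ s → 0 < φ s) (hφ_anti : AntitoneOn φ (Ici 0))
    (hq_doubling : ∃ κ₁ : ℝ, 0 < κ₁ ∧ ∀ s, 0 < s → q s ≤ κ₁ * q (2 * s))
    (hφ_mul : ∃ κ₂ : ℝ, 0 < κ₂ ∧ ∀ a b, 0 ≤ a → 0 ≤ b → φ a * φ b ≤ κ₂ * φ (a + b))
    (h_growth : ∃ c : ℝ, 0 ≤ c ∧ ∀ r, 1 < r →
      ∫ s in (0 : ℝ)..r, s ^ (1 - α) * q s * (φ s / φ (s / 2)) ≤ c * r ^ (2 - β))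
    (hμ : ∃ c : ℝ, 0 < c ∧ ∀ (θ : sphere (0 : EuclideanSpace ℝ (Fin d)) 1) (ρ : ℝ), 0 < ρ →
      μ (ball θ ρ) ≤ ENNReal.ofReal (c * ρ ^ (γ - 1)))
    (c₀ : ℝ) (hc₀ : 0 < c₀) :
    ∃ c c₁ c₂ c₃ : ℝ, 0 < c ∧ 0 < c₁ ∧ 0 < c₂ ∧ 0 < c₃ ∧
      ∀ (ν : Measure (EuclideanSpace ℝ (Fin d))) (b : EuclideanSpace ℝ (Fin d))
        (P : ℝ → Measure (EuclideanSpace ℝ (Fin d))),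
        IsLevyMeasure ν → PolarDominated ν μ α q φ →
        (∀ ξ, c₀ * min (‖ξ‖ ^ α) (‖ξ‖ ^ β) ≤ (levyExponent ν b ξ).re) →
        IsLevySemigroup ν b P →
        (∀ t, 0 < t → P t ≪ volume) ∧
        ∃ p : ℝ → EuclideanSpace ℝ (Fin d) → ℝ,
          (∀ t, 0 < t → Continuous (p t) ∧ (∀ x, 0 ≤ p t x) ∧
            P t = volume.withDensity (fun x => ENNReal.ofReal (p t x))) ∧
          (∀ t, 0 < t → t ≤ 1 → ∀ x,
            p t (x + t • driftAt ν b (t ^ (1 / α)))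
              ≤ c * t ^ (-(d : ℝ) / α) * minProfile α γ α q φ t ‖x‖) ∧
          (∀ t, 1 < t → ∀ x,
            p t (x + t • driftAt ν b (t ^ (1 / β)))
              ≤ c₁ * t ^ (-(d : ℝ) / β) * (minProfile α γ β q φ t ‖x‖
                + Real.exp (-c₂ * t ^ (-1 / β) * ‖x‖
                    * Real.log (1 + c₃ * t ^ (-1 / β) * ‖x‖)))) := by
  obtain ⟨hα0, hα2⟩ := hα
  obtain ⟨hαβ, -⟩ := hβ
  have hβ0 : 0 < β := hα0.trans_le hαβ
  obtain ⟨cg, hcg, h_growth⟩ := h_growth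
  obtain ⟨cμ, hcμ, hμ⟩ := hμ
  have hq0 := hq_pos 0 le_rfl
  have hφ0 := hφ_pos 0 le_rfl
  set M := μ.real univ with hM
  have hM0 : 0 ≤ M := measureReal_nonneg
  have hϑ : 0 < 1 - (2 : ℝ) ^ (-β) :=
    sub_pos.2 (Real.rpow_lt_one_of_one_lt_of_neg (by norm_num) (by linarith))
  have h2α : 0 < 2 - α := by linarith
  set kα := q 0 / (2 - α) with hkα
  set lα := q 0 / α with hlα
  set lβ := cg * 2 ^ (2 - β) * (1 - (2 : ℝ) ^ (-β))⁻¹ with hlβ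
  have hkα0 : 0 ≤ kα := by positivity
  have hlα0 : 0 ≤ lα := by positivity
  have hlβ0 : 0 ≤ lβ := by positivity
  set a₁ := φ 0 * M * kα with ha₁
  set a₂ := φ 0 * M * cg with ha₂
  set a₃ := M * lα with ha₃
  set a₄ := M * lβ with ha₄
  have ha₁0 : 0 ≤ a₁ := by positivity
  have ha₂0 : 0 ≤ a₂ := by positivity
  have ha₃0 : 0 ≤ a₃ := by positivity
  have ha₄0 : 0 ≤ a₄ := by positivity
  have ha₀ : 0 ≤ cμ * 4 ^ γ := by positivity
  -- One constant for both time regimes: local mass of `Λ`, second moment for `t ≤ 1` and `t > 1`,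
  -- tail mass for `t ≤ 1` and `t > 1`.
  set A := cμ * 4 ^ γ + a₁ + a₂ + a₃ + a₄ with hA
  obtain ⟨B, K, hB, hK, hbound⟩ := exists_density_bound_at_scale (β := β) hd hα0 hγ.1 hq_pos
    hq_anti hφ_pos hφ_anti hq_doubling hφ_mul hcμ hμ hc₀ (A := A) (by linarith)
  obtain ⟨C, hC, hexp⟩ := exists_exp_neg_mul_log_le_profile hα0 hγ.1 hq_pos hq_anti hφ_pos
    hφ_anti hq_doubling hφ_mul
  -- the hypotheses of the bound at scale `h`, for `h ^ δ = t`
  have hscale : ∀ {t h δ k l : ℝ}, 0 < h → h ^ δ = t → 0 ≤ k → 0 ≤ l →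
      φ 0 * M * k ≤ A → M * l ≤ A →
      ∫⁻ s in Ioc 0 h, ENNReal.ofReal (s ^ (1 - α) * q s * (φ s / φ (s / 2)))
        ≤ ENNReal.ofReal (k * h ^ (2 - δ)) →
      ∫⁻ s in Ioi h, tiltedRadialDensity α q φ s ≤ ENNReal.ofReal (l * h ^ (-δ)) →
      t * (φ 0 * (M * (∫⁻ s in Ioc 0 h,
          ENNReal.ofReal (s ^ (1 - α) * q s * (φ s / φ (s / 2)))).toReal)) ≤ A * h ^ 2 ∧
      t * (M * (∫⁻ s in Ioi h, tiltedRadialDensity α q φ s).toReal) ≤ A := by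
    intro t h δ k l hh ht hk hl hkA hlA hI hJ
    have hI' := mul_toReal_le_of_le_ofReal hh ht hk hI
    have hJ' := mul_toReal_le_of_le_ofReal (e := 0) hh ht hl (by simpa using hJ)
    rw [Real.rpow_two] at hI'
    rw [Real.rpow_zero, mul_one] at hJ'
    constructor
    · calc _ = φ 0 * M * (t * (∫⁻ s in Ioc 0 h,
            ENNReal.ofReal (s ^ (1 - α) * q s * (φ s / φ (s / 2)))).toReal) := by ring
        _ ≤ φ 0 * M * (k * h ^ 2) := by gcongr
        _ = φ 0 * M * k * h ^ 2 := by ring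
        _ ≤ A * h ^ 2 := by gcongr
    · calc _ = M * (t * (∫⁻ s in Ioi h, tiltedRadialDensity α q φ s).toReal) := by ring
        _ ≤ M * l := by gcongr
        _ ≤ A := hlA
  refine ⟨B * (1 + C + K), B * (1 + K), 1 / 8, 1 / 2, by positivity, by positivity, by norm_num,
    by norm_num, fun ν b P hν hdom hre hP => ?_⟩
  have key : ∀ t, ∃ p : EuclideanSpace ℝ (Fin d) → ℝ, 0 < t →
      (Continuous p ∧ (∀ x, 0 ≤ p x) ∧
        P t = volume.withDensity (fun x => ENNReal.ofReal (p x))) ∧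
      (t ≤ 1 → ∀ x, p (x + t • driftAt ν b (t ^ (1 / α)))
        ≤ B * (1 + C + K) * t ^ (-(d : ℝ) / α) * minProfile α γ α q φ t ‖x‖) ∧
      (1 < t → ∀ x, p (x + t • driftAt ν b (t ^ (1 / β)))
        ≤ B * (1 + K) * t ^ (-(d : ℝ) / β) * (minProfile α γ β q φ t ‖x‖
          + Real.exp (-(1 / 8) * t ^ (-1 / β) * ‖x‖
              * Real.log (1 + 1 / 2 * t ^ (-1 / β) * ‖x‖)))) := by
    intro t
    rcases le_or_gt t 0 with ht0 | ht
    · exact ⟨0, fun h => absurd h ht0.not_gt⟩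
    rcases le_or_gt t 1 with ht1 | ht1
    · have hh : 0 < t ^ (1 / α) := by positivity
      have hht := rpow_one_div_rpow ht hα0
      have hI := lintegral_weighted_profile_le_of_lt_two hα2 hq_pos hq_anti hφ_pos hφ_anti hh
      have hJ := lintegral_tail_profile_le hα0 hq_pos hq_anti hφ_pos hφ_anti hh
      obtain ⟨hI', hJ'⟩ := hscale hh hht hkα0 hlα0 (by linarith) (by linarith) hI hJ
      obtain ⟨p, hpc, hp0, hpP, hp1, hp2⟩ := hbound ν b P t _ hν hdom hre hP ht hh
        (fun u hu => rpow_sub_one_le_mul_min_of_le_one hα0 hαβ ht ht1 hu) hI'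
        (ne_top_of_le_ne_top ENNReal.ofReal_ne_top hI) hJ'
        (ne_top_of_le_ne_top ENNReal.ofReal_ne_top hJ)
      refine ⟨p, fun _ => ⟨⟨hpc, hp0, hpP⟩, fun _ x => ?_, fun h => absurd h ht1.not_gt⟩⟩
      have h1 := hp1 x
      rw [inv_pow_rpow_one_div ht] at h1
      have hH : 0 < t ^ (-(d : ℝ) / α) := by positivity
      rcases eq_or_ne x 0 with rfl | hx
      · rw [minProfile, norm_zero, if_pos rfl, mul_one]
        refine h1.trans ?_
        gcongr
        nlinarith
      · have hx' := norm_pos_iff.2 hx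
        have h2 := hp2 x hx
        rw [inv_pow_rpow_one_div ht, mul_rpow_one_div_rpow ht] at h2
        rw [minProfile, if_neg hx'.ne']
        have hqx := hq_pos ‖x‖ hx'.le
        have hφx := hφ_pos (‖x‖ / 4) (by positivity)
        refine le_mul_min_one hB hC hK hH (by positivity) h1 h2 ?_
        -- The place where `t ≤ 1` removes the exponential term: `h ≤ 1` gives `‖x‖ ≤ ‖x‖/h`, as
        -- absorption into the profile at `‖x‖` requires.
        have hh1 : t ^ (1 / α) ≤ 1 := Real.rpow_le_one ht.le ht1 (by positivity)
        refine (hexp _ ‖x‖ hx' ((le_div_iff₀ hh).2 (mul_le_of_le_one_right hx'.le hh1))).trans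
          (le_of_eq ?_)
        rw [Real.div_rpow hx'.le hh.le, Real.rpow_neg hh.le (γ + α), div_inv_eq_mul,
          Real.rpow_add hh, hht, neg_add', ← mul_rpow_one_div_rpow ht]
        ring
    · have hh1 : 1 < t ^ (1 / β) := Real.one_lt_rpow ht1 (by positivity)
      have hh : 0 < t ^ (1 / β) := by positivity
      have hht := rpow_one_div_rpow ht hβ0
      have hI := lintegral_weighted_profile_le_of_growth hα2 hq_pos hq_anti hφ_pos hφ_anti
        h_growth hh1
      have hJ := lintegral_tail_profile_le_of_growth hα2 hβ0 hcg hq_pos hq_anti hφ_pos hφ_anti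
        h_growth hh1
      obtain ⟨hI', hJ'⟩ := hscale hh hht hcg hlβ0 (by linarith) (by linarith) hI hJ
      obtain ⟨p, hpc, hp0, hpP, hp1, hp2⟩ := hbound ν b P t _ hν hdom hre hP ht hh
        (fun u hu => rpow_sub_one_le_mul_min_of_one_lt hα0 hαβ ht1 hu) hI'
        (ne_top_of_le_ne_top ENNReal.ofReal_ne_top hI) hJ'
        (ne_top_of_le_ne_top ENNReal.ofReal_ne_top hJ)
      refine ⟨p, fun _ => ⟨⟨hpc, hp0, hpP⟩, fun h => absurd h ht1.not_ge, fun _ x => ?_⟩⟩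
      have h1 := hp1 x
      rw [inv_pow_rpow_one_div ht] at h1
      have hH : 0 < t ^ (-(d : ℝ) / β) := by positivity
      rcases eq_or_ne x 0 with rfl | hx
      · rw [minProfile, norm_zero, if_pos rfl]
        simp only [mul_zero, zero_mul, Real.exp_zero]
        refine h1.trans ?_
        have := mul_pos hB hH
        have := mul_pos this hK
        nlinarith
      · have hx' := norm_pos_iff.2 hx
        have h2 := hp2 x hx
        rw [inv_pow_rpow_one_div ht, mul_rpow_one_div_rpow ht, div_rpow_one_div ht] at h2
        rw [minProfile, if_neg hx'.ne']
        have hqx := hq_pos ‖x‖ hx'.le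
        have hφx := hφ_pos (‖x‖ / 4) (by positivity)
        refine le_mul_min_one_add hB hK hH (by positivity) (Real.exp_pos _).le h1 ?_
        convert h2 using 4
        rw [mul_assoc (1 / 2 : ℝ)]
        ring
  choose p hp using key
  refine ⟨fun t ht => ?_, p, fun t ht => (hp t ht).1, fun t ht ht1 => (hp t ht).2.1 ht1,
    fun t ht1 => (hp t (by linarith)).2.2 ht1⟩
  rw [(hp t ht).1.2.2]
  exact withDensity_absolutelyContinuous _ _
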